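/- Let $\mathcal X,\mathcal Y,\mathcal Z$ be finite sets and let $p(y,z|x)$ be the transition probability of a discrete memoryless wiretap channel with input $x\in\mathcal X$, output $y\in\mathcal Y$ at the legitimate receiver and output $z\in\mathcal Z$ at the eavesdropper. A code of block length $n$ and rates $(R_p,R_s)$, $R_p,R_s\ge 0$, consists of independent messages $W_p$ and $W_s$, uniformly distributed on sets of sizes $\lceil 2^{nR_p}\rceil$ and $\lceil 2^{nR_s}\rceil$ respectively, a stochastic encoder $p(x^n|w_p,w_s)$, and a decoder that estimates $(W_p,W_s)$ from $Y^n$; here $(Y^n,Z^n)$ are the outputs of $n$ memoryless uses of the channel with input $X^n$. The pair $(R_p,R_s)$ is achievable if there is a sequence of such codes, one for each $n$, for which the average probability that $(W_p,W_s)$ is decoded incorrectly and the leakage rate $\frac1n I(W_s;Z^n)$ both tend to $0$ as $n\to\infty$. The private-confidential message capacity region is the closure of the set of achievable pairs. Then the private-confidential message capacity region is exactly the set of nonnegative pairs $(R_p,R_s)$ satisfying $$R_s\le I(V;Y|U)-I(V;Z|U),\qquad R_s+R_p\le I(V;Y)$$ for some joint distribution $p(u,v,x,y,z)=p(u)\,p(v|u)\,p(x|v)\,p(y,z|x)$,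 where $U$ and $V$ are auxiliary random variables with finite alphabets. (All information quantities are in bits.) -/

import Mathlib

open Filter Topology

namespace Wiretap

noncomputable section

/-! Random variables on a finite sample space `Ω` with probability mass function `p : Ω → ℝ`.
All information quantities are in bits. -/

open scoped Classical in
/-- The law of the random variable `A`: `a ↦ Pr[A = a]`. -/
def law {Ω α : Type*} [Fintype Ω] (p : Ω → ℝ) (A : Ω → α) (a : α) : ℝ :=
  ∑ ω, if A ω = a then p ω else 0

open scoped Classical in
/-- The probability of an event. -/
def prob {Ω : Type*} [Fintype Ω] (p : Ω → ℝ) (E : Ω → Prop) : ℝ :=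
  ∑ ω, if E ω then p ω else 0

/-- Shannon entropy `H(A) = - ∑ Pr[A = a] log₂ Pr[A = a]`. -/
def entropy {Ω α : Type*} [Fintype Ω] [Fintype α] (p : Ω → ℝ) (A : Ω → α) : ℝ :=
  ∑ a, Real.negMulLog (law p A a) / Real.log 2

/-- Mutual information `I(A;B) = H(A) + H(B) - H(A,B)`. -/
def mutualInfo {Ω α β : Type*} [Fintype Ω] [Fintype α] [Fintype β]
    (p : Ω → ℝ) (A : Ω → α) (B : Ω → β) : ℝ :=
  entropy p A + entropy p B - entropy p (fun ω => (A ω, B ω))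

/-- Conditional mutual information `I(A;B|C) = H(A,C) + H(B,C) - H(A,B,C) - H(C)`. -/
def condMutualInfo {Ω α β γ : Type*} [Fintype Ω] [Fintype α] [Fintype β] [Fintype γ]
    (p : Ω → ℝ) (A : Ω → α) (B : Ω → β) (C : Ω → γ) : ℝ :=
  entropy p (fun ω => (A ω, C ω)) + entropy p (fun ω => (B ω, C ω))
    - entropy p (fun ω => (A ω, B ω, C ω)) - entropy p C

/-- The transition probabilities `p(y,z|x)` of a wiretap channel with finite alphabets:
input `x`, output `y` at the legitimate receiver, output `z` at the eavesdropper. -/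
structure Channel (X Y Z : Type*) [Fintype Y] [Fintype Z] where
  /-- `trans x (y, z)` is `p(y,z|x)` -/
  trans : X → Y × Z → ℝ
  trans_mem : ∀ x, trans x ∈ stdSimplex ℝ (Y × Z)

/-- A code of block length `n` with `Mp` private and `Ms` confidential messages:
a stochastic encoder `p(xⁿ | wp, ws)` and a decoder for the legitimate receiver. -/
structure Code (X Y : Type*) [Fintype X] (n Mp Ms : ℕ) where
  enc : Fin Mp × Fin Ms → (Fin n → X) → ℝ
  enc_mem : ∀ w, enc w ∈ stdSimplex ℝ (Fin n → X)
  dec : (Fin n → Y) → Fin Mp × Fin Ms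

section Coding

variable {X Y Z : Type*} [Fintype X] [Fintype Y] [Fintype Z]

/-- The joint law of `((Wp, Ws), Xⁿ, Yⁿ, Zⁿ)`: the messages are independent and uniform, and the
channel is used `n` times without memory (and without feedback). -/
def Code.jointLaw {n Mp Ms : ℕ} (c : Code X Y n Mp Ms) (W : Channel X Y Z) :
    (Fin Mp × Fin Ms) × (Fin n → X) × (Fin n → Y) × (Fin n → Z) → ℝ :=
  fun (w, x, y, z) =>
    ((Mp : ℝ) * (Ms : ℝ))⁻¹ * c.enc w x * ∏ i, W.trans (x i) (y i, z i)

/-- The average probability that the legitimate receiver decodes `(Wp, Ws)` incorrectly. -/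
def Code.errorProb {n Mp Ms : ℕ} (c : Code X Y n Mp Ms) (W : Channel X Y Z) : ℝ :=
  prob (c.jointLaw W) (fun ω => c.dec ω.2.2.1 ≠ ω.1)

/-- The information `I(Ws; Zⁿ)` leaked to the eavesdropper about the confidential message. -/
def Code.leakage {n Mp Ms : ℕ} (c : Code X Y n Mp Ms) (W : Channel X Y Z) : ℝ :=
  mutualInfo (c.jointLaw W) (fun ω => ω.1.2) (fun ω => ω.2.2.2)

/-- `(Rp, Rs)` is achieved by a sequence of codes with `⌈2^(n Rp)⌉` private and `⌈2^(n Rs)⌉`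
confidential messages: the error probability and the leakage rate `I(Ws; Zⁿ) / n` vanish. -/
def Achievable (W : Channel X Y Z) (Rp Rs : ℝ) : Prop :=
  0 ≤ Rp ∧ 0 ≤ Rs ∧
    ∃ c : ∀ n : ℕ,
        Code X Y n ⌈(2 : ℝ) ^ ((n : ℝ) * Rp)⌉₊ ⌈(2 : ℝ) ^ ((n : ℝ) * Rs)⌉₊,
      Tendsto (fun n => (c n).errorProb W) atTop (𝓝 0) ∧
      Tendsto (fun n : ℕ => (c n).leakage W / (n : ℝ)) atTop (𝓝 0)

/-- The private-confidential message capacity region: the closure of the set of achievable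
rate pairs `(Rp, Rs)`. -/
def capacityRegion (W : Channel X Y Z) : Set (ℝ × ℝ) :=
  closure {R | Achievable W R.1 R.2}

/-- The joint law `p(u) p(v|u) p(x|v) p(y,z|x)`. -/
def auxLaw {U V : Type*} (W : Channel X Y Z) (pU : U → ℝ) (pV : U → V → ℝ) (pX : V → X → ℝ) :
    U × V × X × Y × Z → ℝ :=
  fun (u, v, x, y, z) => pU u * pV u v * pX v x * W.trans x (y, z)

end Coding

section Coordinates

variable {U V X Y Z : Type*}

/-- The random variables `U`, `V`, `Y`, `Z` on the sample space of tuples `(u, v, x, y, z)`. -/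
def rvU (ω : U × V × X × Y × Z) : U := ω.1

def rvV (ω : U × V × X × Y × Z) : V := ω.2.1

def rvY (ω : U × V × X × Y × Z) : Y := ω.2.2.2.1

def rvZ (ω : U × V × X × Y × Z) : Z := ω.2.2.2.2

end Coordinates

end

end Wiretap

/-!
The capacity region of the wiretap channel with private and confidential messages.

**Converse.** Fano's inequality and the leakage bound reduce the claim to single-letter bounds for
`I(W;Yⁿ) - I(W;Zⁿ)` and `I(W;Yⁿ)`, where `W = (Wp, Ws)`. The first telescopes along the hybrid
vectors `(Y before k, Z from k on)`, which yields terms `I(V;Y|U) - I(V;Z|U)` with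
`U = (Y before i, Z after i)` and `V = (W, U)`; by the chain rule the second is at most the sum of
the `I(V;Y)` with the same `V`. This is `converse_bound`. To average over time and to pass to
the limit without cardinality bounds, the pairs below `(I(V;Y|U) - I(V;Z|U), I(V;Y))` are described
as `boundSet`: the auxiliary variables `V` and `U` amount to convex combinations of the points
`(P, H(Y) - H(Z), H(Y))`, taken twice, and convex hulls of compact sets are compact. Hence
`boundSet` is closed and convex, and `exists_aux_of_mem_boundSet` recovers finite auxiliary
variables from its points.

**Achievability.** A message `(wp, ws)` and a local random index `d` select a codeword of a random
superposition codebook, whose cloud centres are drawn from `p(u)` and whose codewords from `p(v|u)`;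
the cloud depends on `(wp, d)` only. For every `ws`, the codewords of `ws` in a cloud have rate just
above `I(V;Z|U)`, so that by soft covering the output of the eavesdropper looks as if it came from
the centre of the cloud, whatever `ws` is (`codebookE_leakageTerm_le`, `codebookLeakage_le`). A
decoder with two likelihood thresholds, against `p(y|u)` and against `p(y)`, fails rarely while the
rates of a cloud and of the codebook are below `I(V;Y|U)` and `I(V;Y)` (`codebookE_errorTerm_le`).
Both bounds are `s`-th moments of likelihood ratios and multiplicative over channel uses. The factor
of one channel use is `1` at `s = 0`, where its derivative is the mean log-likelihood ratio plus a
rate and hence negative, so it is below `1` for some small `s` (`exists_moment_lt_one`). If the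
private messages are too few to fill a cloud, `d` does; if there are too many, they are spread over
several clouds (`exists_clouds`).

For `Rs = 0` the condition `I(V;Y|U) ≥ I(V;Z|U)` may be an equality, and the codebooks are instead
built for a constant `U` and an eavesdropper with constant output (`achievable_private_of_lt`):
a single confidential message cannot leak.
-/

namespace Wiretap

noncomputable section

open scoped Classical

open scoped Pointwise

/-! ### Expectation over independent coordinates -/

section ProductExpectation

variable {ι β : Type*} [Fintype ι] [DecidableEq ι] [Fintype β]

/-- The expectation of `F t` when the coordinates `t i` are independent with laws `q i`. -/
def piE (q : ι → β → ℝ) (F : (ι → β) → ℝ) : ℝ := ∑ t, (∏ i, q i (t i)) * F t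

theorem sum_prod_pi (f : ι → β → ℝ) : ∑ t : ι → β, ∏ i, f i (t i) = ∏ i, ∑ b, f i b := by
  rw [Finset.prod_univ_sum, Fintype.piFinset_univ]

theorem prod_mem_stdSimplex {q : ι → β → ℝ} (hq : ∀ i, q i ∈ stdSimplex ℝ β) :
    (fun t : ι → β => ∏ i, q i (t i)) ∈ stdSimplex ℝ (ι → β) :=
  ⟨fun t => Finset.prod_nonneg fun i _ => (hq i).1 _, by
    rw [sum_prod_pi]; exact Finset.prod_eq_one fun i _ => (hq i).2⟩

theorem piE_const {q : ι → β → ℝ} (hq : ∀ i, q i ∈ stdSimplex ℝ β) (c : ℝ) :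
    piE q (fun _ => c) = c := by
  rw [piE, ← Finset.sum_mul, (prod_mem_stdSimplex hq).2, one_mul]

theorem piE_mono {q : ι → β → ℝ} (hq : ∀ i, q i ∈ stdSimplex ℝ β) {F G : (ι → β) → ℝ}
    (h : ∀ t, (∀ i, 0 < q i (t i)) → F t ≤ G t) : piE q F ≤ piE q G := by
  refine Finset.sum_le_sum fun t _ => ?_
  by_cases ht : ∀ i, 0 < q i (t i)
  · exact mul_le_mul_of_nonneg_left (h t ht) (Finset.prod_nonneg fun i _ => (hq i).1 _)
  · push Not at ht
    obtain ⟨i, hi⟩ := ht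
    have : ∏ i, q i (t i) = 0 :=
      Finset.prod_eq_zero (Finset.mem_univ i) (le_antisymm hi ((hq i).1 _))
    simp [this]

theorem piE_add (q : ι → β → ℝ) (F G : (ι → β) → ℝ) :
    piE q (fun t => F t + G t) = piE q F + piE q G := by
  simp [piE, mul_add, Finset.sum_add_distrib]

theorem piE_const_mul (q : ι → β → ℝ) (c : ℝ) (F : (ι → β) → ℝ) :
    piE q (fun t => c * F t) = c * piE q F := by
  simp only [piE, Finset.mul_sum]
  exact Finset.sum_congr rfl fun t _ => by ring

theorem piE_sum {κ : Type*} (s : Finset κ) (q : ι → β → ℝ) (F : κ → (ι → β) → ℝ) :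
    piE q (fun t => ∑ k ∈ s, F k t) = ∑ k ∈ s, piE q (F k) := by
  simp only [piE, Finset.mul_sum]
  exact Finset.sum_comm

/-- Drawing coordinate `i` afresh does not change an expectation: `(t, s) ↦ (update t i s, t i)`
is an involution that preserves the law of `t` and an independent copy `s` of `t i`. -/
theorem piE_resample {q : ι → β → ℝ} (i : ι) (hq : ∑ b, q i b = 1) (F : (ι → β) → ℝ) :
    piE q F = piE q (fun t => ∑ s, q i s * F (Function.update t i s)) := by
  have key : ∀ (t : ι → β) (s : β), (∏ j, q j (Function.update t i s j)) * q i (t i)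
      = (∏ j, q j (t j)) * q i s := by
    intro t s
    rw [← Finset.mul_prod_erase Finset.univ _ (Finset.mem_univ i),
      ← Finset.mul_prod_erase Finset.univ (fun j => q j (t j)) (Finset.mem_univ i)]
    have : ∏ x ∈ Finset.univ.erase i, q x (Function.update t i s x)
        = ∏ x ∈ Finset.univ.erase i, q x (t x) :=
      Finset.prod_congr rfl fun x hx => by
        rw [Function.update_of_ne (Finset.ne_of_mem_erase hx)]
    rw [this, Function.update_self]
    ring
  let e : (ι → β) × β → (ι → β) × β := fun x => (Function.update x.1 i x.2, x.1 i)
  have he : Function.Involutive e := by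
    rintro ⟨t, s⟩
    simp [e]
  have h1 : piE q F = ∑ x : (ι → β) × β, (∏ j, q j (x.1 j)) * q i x.2 * F x.1 := by
    rw [Fintype.sum_prod_type, piE]
    refine Finset.sum_congr rfl fun t _ => ?_
    simp only
    rw [← Finset.sum_mul, ← Finset.mul_sum, hq, mul_one]
  rw [h1, ← he.bijective.sum_comp, Fintype.sum_prod_type, piE]
  refine Finset.sum_congr rfl fun t _ => ?_
  rw [Finset.mul_sum]
  refine Finset.sum_congr rfl fun s _ => ?_
  simp only [e]
  rw [key]
  ring

theorem piE_eval {q : ι → β → ℝ} (hq : ∀ i, q i ∈ stdSimplex ℝ β) (i : ι) (f : β → ℝ) :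
    piE q (fun t => f (t i)) = ∑ b, q i b * f b := by
  rw [piE_resample i (hq i).2]
  simp only [Function.update_self]
  exact piE_const hq _

theorem piE_eval₂ {q : ι → β → ℝ} (hq : ∀ i, q i ∈ stdSimplex ℝ β) {i j : ι} (hij : i ≠ j)
    (f : β → β → ℝ) :
    piE q (fun t => f (t i) (t j)) = ∑ b, q i b * ∑ b', q j b' * f b b' := by
  rw [piE_resample i (hq i).2]
  simp only [Function.update_self, Function.update_of_ne hij.symm]
  rw [piE_eval hq j (fun b' => ∑ s, q i s * f s b')]
  simp only [Finset.mul_sum]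
  rw [Finset.sum_comm]
  exact Finset.sum_congr rfl fun _ _ => Finset.sum_congr rfl fun _ _ => by ring

end ProductExpectation

/-! ### Entropy in nats -/

section Entropy

variable {Ω : Type*} [Fintype Ω] {α β γ : Type*}

theorem law_eq (p : Ω → ℝ) (A : Ω → α) (a : α) [∀ ω, Decidable (A ω = a)] :
    law p A a = ∑ ω, if A ω = a then p ω else 0 := by
  rw [law]
  congr!

theorem law_congr (p : Ω → ℝ) {A : Ω → α} {B : Ω → β} {a : α} {b : β}
    (h : ∀ ω, A ω = a ↔ B ω = b) : law p A a = law p B b := by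
  simp only [law_eq, h]

theorem law_nonneg {p : Ω → ℝ} (hp : ∀ ω, 0 ≤ p ω) (A : Ω → α) (a : α) : 0 ≤ law p A a :=
  Finset.sum_nonneg fun ω _ => by split_ifs <;> simp [hp]

theorem law_pos {p : Ω → ℝ} (hp : ∀ ω, 0 ≤ p ω) (A : Ω → α) {ω : Ω} (h : 0 < p ω) :
    0 < law p A (A ω) := by
  refine lt_of_lt_of_le (by simpa using h)
    (Finset.single_le_sum (f := fun ω' => if A ω' = A ω then p ω' else 0)
      (fun ω' _ => by split_ifs <;> simp [hp]) (Finset.mem_univ ω))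

/-- The law of the unconscious statistician. -/
theorem sum_law_mul [Fintype α] (p : Ω → ℝ) (A : Ω → α) (f : α → ℝ) :
    ∑ a, law p A a * f a = ∑ ω, p ω * f (A ω) := by
  simp only [law_eq, Finset.sum_mul]
  rw [Finset.sum_comm]
  refine Finset.sum_congr rfl fun ω _ => ?_
  simp [ite_mul]

theorem sum_law [Fintype α] (p : Ω → ℝ) (A : Ω → α) : ∑ a, law p A a = ∑ ω, p ω := by
  simpa using sum_law_mul p A (fun _ => 1)

theorem law_mem_stdSimplex [Fintype α] {p : Ω → ℝ} (hp : p ∈ stdSimplex ℝ Ω) (A : Ω → α) :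
    law p A ∈ stdSimplex ℝ α :=
  ⟨law_nonneg hp.1 A, (sum_law p A).trans hp.2⟩

theorem sum_law_prod [Fintype β] (p : Ω → ℝ) (A : Ω → α) (B : Ω → β) (a : α) :
    ∑ b, law p (fun ω => (A ω, B ω)) (a, b) = law p A a := by
  simp only [law_eq, Prod.mk.injEq]
  rw [Finset.sum_comm]
  refine Finset.sum_congr rfl fun ω _ => ?_
  by_cases h : A ω = a <;> simp [h]

/-- The entropy in nats, as the expectation of `-log (law p A (A ω))`. -/
def ent (p : Ω → ℝ) (A : Ω → α) : ℝ := ∑ ω, p ω * -Real.log (law p A (A ω))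

theorem ent_eq_sum_negMulLog [Fintype α] (p : Ω → ℝ) (A : Ω → α) :
    ent p A = ∑ a, Real.negMulLog (law p A a) := by
  rw [ent, ← sum_law_mul p A (fun a => -Real.log (law p A a))]
  exact Finset.sum_congr rfl fun a _ => by rw [Real.negMulLog]; ring

theorem entropy_eq_ent_div [Fintype α] (p : Ω → ℝ) (A : Ω → α) :
    entropy p A = ent p A / Real.log 2 := by
  rw [ent_eq_sum_negMulLog, entropy, Finset.sum_div]

/-- The entropy depends only on the partition of the sample space into level sets. -/
theorem ent_congr (p : Ω → ℝ) {A : Ω → α} {B : Ω → β}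
    (h : ∀ ω ω', A ω = A ω' ↔ B ω = B ω') : ent p A = ent p B := by
  simp only [ent, law_eq, h]

/-- **Gibbs' inequality**: the entropy is at most the cross entropy with any sub-probability. -/
theorem ent_le_crossEntropy [Fintype α] {p : Ω → ℝ} (hp : p ∈ stdSimplex ℝ Ω) (A : Ω → α)
    {r : α → ℝ} (hr : ∀ a, 0 ≤ r a) (hr1 : ∑ a, r a ≤ 1) (hpos : ∀ ω, 0 < p ω → 0 < r (A ω)) :
    ent p A ≤ ∑ ω, p ω * -Real.log (r (A ω)) := by
  have h1 : ∀ ω, p ω * -Real.log (law p A (A ω)) - p ω * -Real.log (r (A ω))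
      ≤ p ω * (r (A ω) / law p A (A ω)) - p ω := by
    intro ω
    rcases (hp.1 ω).eq_or_lt with h0 | h0
    · simp [← h0]
    have hl := law_pos hp.1 A h0
    have := Real.log_le_sub_one_of_pos (div_pos (hpos ω h0) hl)
    rw [Real.log_div (hpos ω h0).ne' hl.ne'] at this
    nlinarith
  have h2 : ∑ ω, p ω * (r (A ω) / law p A (A ω)) ≤ ∑ a, r a := by
    rw [← sum_law_mul p A (fun a => r a / law p A a)]
    refine Finset.sum_le_sum fun a _ => ?_
    rcases (law_nonneg hp.1 A a).eq_or_lt with h0 | h0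
    · simp [← h0, hr a]
    · rw [mul_div_cancel₀ _ h0.ne']
  have h3 := Finset.sum_le_sum fun ω (_ : ω ∈ Finset.univ) => h1 ω
  rw [Finset.sum_sub_distrib, Finset.sum_sub_distrib, hp.2] at h3
  rw [ent]
  linarith

theorem law_prod_le {p : Ω → ℝ} (hp : ∀ ω, 0 ≤ p ω) (A : Ω → α) (B : Ω → β) (a : α) (b : β) :
    law p (fun ω => (A ω, B ω)) (a, b) ≤ law p B b := by
  refine Finset.sum_le_sum fun ω _ => ?_
  by_cases h : B ω = b
  · by_cases h' : A ω = a <;> simp [h, h', hp]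
  · simp [h]

theorem ent_le_ent_prod {p : Ω → ℝ} (hp : ∀ ω, 0 ≤ p ω) (A : Ω → α) (B : Ω → β) :
    ent p B ≤ ent p (fun ω => (A ω, B ω)) := by
  refine Finset.sum_le_sum fun ω _ => ?_
  rcases (hp ω).eq_or_lt with h0 | h0
  · simp [← h0]
  refine mul_le_mul_of_nonneg_left (neg_le_neg ?_) (hp ω)
  exact Real.log_le_log (law_pos hp (fun ω => (A ω, B ω)) h0) (law_prod_le hp A B _ _)

/-- **Strong subadditivity**: `H(A,B,C) + H(C) ≤ H(A,C) + H(B,C)`. -/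
theorem ent_submodular [Fintype α] [Fintype β] [Fintype γ] {p : Ω → ℝ}
    (hp : p ∈ stdSimplex ℝ Ω) (A : Ω → α) (B : Ω → β) (C : Ω → γ) :
    ent p (fun ω => (A ω, B ω, C ω)) + ent p C
      ≤ ent p (fun ω => (A ω, C ω)) + ent p (fun ω => (B ω, C ω)) := by
  set pac := law p (fun ω => (A ω, C ω)) with hac
  set pbc := law p (fun ω => (B ω, C ω)) with hbc
  have hsum : ∑ x : α × β × γ, pac (x.1, x.2.2) * pbc (x.2.1, x.2.2) / law p C x.2.2 ≤ 1 := by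
    have e1 : ∀ c, ∑ a, pac (a, c) = law p C c := by
      intro c
      rw [← sum_law_prod p C A c]
      refine Finset.sum_congr rfl fun a _ => ?_
      simp [hac, law_eq, and_comm]
    have e2 : ∀ c, ∑ b, pbc (b, c) = law p C c := by
      intro c
      rw [← sum_law_prod p C B c]
      refine Finset.sum_congr rfl fun a _ => ?_
      simp [hbc, law_eq, and_comm]
    calc _ = ∑ c, (∑ a, pac (a, c)) * (∑ b, pbc (b, c)) / law p C c := by
          rw [Fintype.sum_prod_type]
          simp only [Fintype.sum_prod_type]
          simp_rw [Finset.sum_mul_sum, Finset.sum_div]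
          rw [Finset.sum_comm]
          conv_rhs => rw [Finset.sum_comm]; enter [2, a]; rw [Finset.sum_comm]
          rw [Finset.sum_comm]
      _ = ∑ c, law p C c := Finset.sum_congr rfl fun c _ => by
          rw [e1, e2]
          by_cases h : law p C c = 0
          · simp [h]
          · rw [mul_div_cancel_right₀ _ h]
      _ ≤ 1 := ((sum_law p C).trans hp.2).le
  have h := ent_le_crossEntropy hp (fun ω => (A ω, B ω, C ω))
    (r := fun x => pac (x.1, x.2.2) * pbc (x.2.1, x.2.2) / law p C x.2.2)
    (fun x => div_nonneg (mul_nonneg (law_nonneg hp.1 _ _) (law_nonneg hp.1 _ _))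
      (law_nonneg hp.1 _ _)) hsum
    (fun ω h0 => div_pos (mul_pos (law_pos hp.1 (fun ω => (A ω, C ω)) h0)
      (law_pos hp.1 (fun ω => (B ω, C ω)) h0)) (law_pos hp.1 C h0))
  have h2 : ∑ ω, p ω * -Real.log (pac (A ω, C ω) * pbc (B ω, C ω) / law p C (C ω))
      = ent p (fun ω => (A ω, C ω)) + ent p (fun ω => (B ω, C ω)) - ent p C := by
    rw [ent, ent, ent, ← Finset.sum_add_distrib, ← Finset.sum_sub_distrib]
    refine Finset.sum_congr rfl fun ω _ => ?_
    rcases (hp.1 ω).eq_or_lt with h0 | h0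
    · simp [← h0]
    have x1 := law_pos hp.1 (fun ω => (A ω, C ω)) h0
    have x2 := law_pos hp.1 (fun ω => (B ω, C ω)) h0
    have x3 := law_pos hp.1 C h0
    rw [Real.log_div (mul_pos x1 x2).ne' x3.ne', Real.log_mul x1.ne' x2.ne']
    ring
  linarith [h, h2]

theorem ent_const {p : Ω → ℝ} (hp : ∑ ω, p ω = 1) (a : α) : ent p (fun _ => a) = 0 := by
  simp [ent, law_eq, hp]

theorem ent_prod_le [Fintype α] [Fintype β] {p : Ω → ℝ} (hp : p ∈ stdSimplex ℝ Ω)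
    (A : Ω → α) (B : Ω → β) : ent p (fun ω => (A ω, B ω)) ≤ ent p A + ent p B := by
  have h := ent_submodular hp A B (fun _ => ())
  rw [ent_const hp.2] at h
  have e1 : ent p (fun ω => (A ω, ())) = ent p A := ent_congr p (by simp)
  have e2 : ent p (fun ω => (B ω, ())) = ent p B := ent_congr p (by simp)
  have e3 : ent p (fun ω => (A ω, B ω, ())) = ent p (fun ω => (A ω, B ω)) := ent_congr p (by simp)
  linarith

theorem ent_of_uniform {p : Ω → ℝ} (hp : ∑ ω, p ω = 1) (A : Ω → α) {m : ℝ}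
    (h : ∀ a, law p A a = m⁻¹) : ent p A = Real.log m := by
  simp only [ent, h, Real.log_inv, neg_neg]
  rw [← Finset.sum_mul, hp, one_mul]

/-- **Fano's inequality**. It is Gibbs' inequality for the conditional law that gives weight `1/2`
to the estimate `d (B ω)` and spreads `1/2` uniformly. -/
theorem fano [Fintype α] [Nonempty α] [Fintype β] {p : Ω → ℝ} (hp : p ∈ stdSimplex ℝ Ω)
    (A : Ω → α) (B : Ω → β) (d : β → α) :
    ent p (fun ω => (A ω, B ω)) - ent p B
      ≤ Real.log 2 + prob p (fun ω => d (B ω) ≠ A ω) * Real.log (Fintype.card α) := by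
  have hc : (1 : ℝ) ≤ Fintype.card α := by exact_mod_cast Fintype.card_pos
  have hc0 : (0 : ℝ) < Fintype.card α := by linarith
  set q : α → β → ℝ := fun a b =>
    (if d b = a then 1 / 2 else 0) + 1 / (2 * Fintype.card α) with hq
  have hqpos : ∀ a b, 0 < q a b := fun a b => by
    simp only [hq]; split_ifs <;> positivity
  have hq1 : ∀ b, ∑ a, q a b = 1 := fun b => by
    simp only [hq, Finset.sum_add_distrib, Finset.sum_ite_eq, Finset.mem_univ, if_true,
      Finset.sum_const, Finset.card_univ, nsmul_eq_mul]
    field_simp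
    norm_num
  have h := ent_le_crossEntropy hp (fun ω => (A ω, B ω)) (r := fun x => law p B x.2 * q x.1 x.2)
    (fun x => mul_nonneg (law_nonneg hp.1 _ _) (hqpos _ _).le)
    (by
      rw [Fintype.sum_prod_type, Finset.sum_comm]
      simp only [← Finset.mul_sum, hq1, mul_one]
      exact ((sum_law p B).trans hp.2).le)
    (fun ω h0 => mul_pos (law_pos hp.1 B h0) (hqpos _ _))
  have h2 : ∑ ω, p ω * -Real.log (law p B (B ω) * q (A ω) (B ω)) ≤
      ent p B + (Real.log 2 + prob p (fun ω => d (B ω) ≠ A ω) * Real.log (Fintype.card α)) := by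
    have : Real.log 2 + prob p (fun ω => d (B ω) ≠ A ω) * Real.log (Fintype.card α)
        = ∑ ω, (p ω * Real.log 2 +
          (if d (B ω) ≠ A ω then p ω else 0) * Real.log (Fintype.card α)) := by
      rw [Finset.sum_add_distrib, ← Finset.sum_mul, hp.2, one_mul, prob, Finset.sum_mul]
      congr!
    rw [this, ent, ← Finset.sum_add_distrib]
    refine Finset.sum_le_sum fun ω _ => ?_
    rcases (hp.1 ω).eq_or_lt with h0 | h0
    · simp [← h0]
    rw [Real.log_mul (law_pos hp.1 B h0).ne' (hqpos _ _).ne']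
    have key : -Real.log (q (A ω) (B ω)) ≤
        Real.log 2 + (if d (B ω) ≠ A ω then 1 else 0) * Real.log (Fintype.card α) := by
      by_cases hd : d (B ω) = A ω
      · have : Real.log (1 / 2) ≤ Real.log (q (A ω) (B ω)) := by
          apply Real.log_le_log (by norm_num)
          simp only [hq, hd, if_true]
          have : (0 : ℝ) ≤ 1 / (2 * Fintype.card α) := by positivity
          linarith
        rw [one_div, Real.log_inv] at this
        simp [hd]
        linarith
      · simp only [hq, hd, if_false, zero_add, one_div, Real.log_inv, ne_eq, not_false_eq_true,
          if_true, neg_neg, one_mul]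
        rw [Real.log_mul (by norm_num) hc0.ne']
    have key2 := mul_le_mul_of_nonneg_left key h0.le
    split_ifs at key2 ⊢ <;> linarith
  linarith

end Entropy

/-! ### Entropies of the auxiliary law -/

section Kernels

variable {U V X Y Z : Type*} [Fintype Y] [Fintype Z]

/-- The Shannon entropy in nats of a probability vector. -/
def shannon (m : Y → ℝ) : ℝ := ∑ y, Real.negMulLog (m y)

/-- The output law of the kernel `K` when the input has law `P`. -/
def push [Fintype X] (P : X → ℝ) (K : X → Y → ℝ) (y : Y) : ℝ := ∑ x, P x * K x y

/-- The marginal channel `p(y|x)` to the legitimate receiver. -/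
def Channel.toY (W : Channel X Y Z) (x : X) (y : Y) : ℝ := ∑ z, W.trans x (y, z)

/-- The marginal channel `p(z|x)` to the eavesdropper. -/
def Channel.toZ (W : Channel X Y Z) (x : X) (z : Z) : ℝ := ∑ y, W.trans x (y, z)

theorem Channel.toY_mem (W : Channel X Y Z) (x : X) : W.toY x ∈ stdSimplex ℝ Y :=
  ⟨fun _ => Finset.sum_nonneg fun _ _ => (W.trans_mem x).1 _, by
    rw [← (W.trans_mem x).2, Fintype.sum_prod_type]; rfl⟩

theorem Channel.toZ_mem (W : Channel X Y Z) (x : X) : W.toZ x ∈ stdSimplex ℝ Z :=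
  ⟨fun _ => Finset.sum_nonneg fun _ _ => (W.trans_mem x).1 _, by
    rw [← (W.trans_mem x).2, Fintype.sum_prod_type_right]; rfl⟩

theorem push_mem [Fintype X] {P : X → ℝ} (hP : P ∈ stdSimplex ℝ X) {K : X → Y → ℝ}
    (hK : ∀ x, K x ∈ stdSimplex ℝ Y) : push P K ∈ stdSimplex ℝ Y :=
  ⟨fun _ => Finset.sum_nonneg fun x _ => mul_nonneg (hP.1 x) ((hK x).1 _), by
    simp only [push]
    rw [Finset.sum_comm]
    simp only [← Finset.mul_sum, (hK _).2, mul_one, hP.2]⟩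

theorem push_push {U V Y : Type*} [Fintype U] [Fintype V] (P : U → ℝ) (K : U → V → ℝ)
    (K' : V → Y → ℝ) :
    push (push P K) K' = push P (fun u => push (K u) K') := by
  funext y
  simp only [push, Finset.sum_mul, Finset.mul_sum]
  rw [Finset.sum_comm]
  exact Finset.sum_congr rfl fun _ _ => Finset.sum_congr rfl fun _ _ => by ring

/-- The chain rule for the entropy of a law `w a * k a b`. -/
theorem sum_negMulLog_mul [Fintype U] (w : U → ℝ) {k : U → Y → ℝ} (hk : ∀ a, ∑ b, k a b = 1) :
    ∑ a, ∑ b, Real.negMulLog (w a * k a b) = ∑ a, w a * shannon (k a) + shannon w := by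
  rw [shannon, ← Finset.sum_add_distrib]
  refine Finset.sum_congr rfl fun a _ => ?_
  simp only [Real.negMulLog_mul, Finset.sum_add_distrib, ← Finset.sum_mul, hk, shannon,
    Finset.mul_sum]
  ring

section Formulas

variable [Fintype U] [Fintype V] {Ω : Type*} [Fintype Ω] {p : Ω → ℝ} {A : Ω → V}
  {B : Ω → Y} {C : Ω → U}
  {pU : U → ℝ} {pV : U → V → ℝ} {K : V → Y → ℝ}

theorem condMutualInfo_of_law (hV : ∀ u, pV u ∈ stdSimplex ℝ V) (hK : ∀ v, K v ∈ stdSimplex ℝ Y)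
    (h : ∀ v y u, law p (fun ω => (A ω, B ω, C ω)) (v, y, u) = pU u * pV u v * K v y) :
    condMutualInfo p A B C = (∑ u, pU u * shannon (push (pV u) K)
      - ∑ u, ∑ v, pU u * pV u v * shannon (K v)) / Real.log 2 := by
  have hAC : ∀ v u, law p (fun ω => (A ω, C ω)) (v, u) = pU u * pV u v := fun v u => by
    rw [← sum_law_prod p _ B]
    calc _ = ∑ y, pU u * pV u v * K v y := Finset.sum_congr rfl fun y _ => by
          rw [← h]; exact law_congr p (by simp only [Prod.mk.injEq]; tauto)
      _ = _ := by rw [← Finset.mul_sum, (hK v).2, mul_one]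
  have hBC : ∀ y u, law p (fun ω => (B ω, C ω)) (y, u) = pU u * push (pV u) K y := fun y u => by
    rw [← sum_law_prod p _ A, push, Finset.mul_sum]
    refine Finset.sum_congr rfl fun v _ => ?_
    rw [← mul_assoc, ← h]; exact law_congr p (by simp only [Prod.mk.injEq]; tauto)
  have hC : ∀ u, law p C u = pU u := fun u => by
    rw [← sum_law_prod p _ A]
    calc _ = ∑ v, pU u * pV u v := Finset.sum_congr rfl fun v _ => by
          rw [← hAC]; exact law_congr p (by simp only [Prod.mk.injEq]; tauto)
      _ = _ := by rw [← Finset.mul_sum, (hV u).2, mul_one]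
  have e1 : ent p (fun ω => (A ω, C ω)) = ∑ u, pU u * shannon (pV u) + shannon pU := by
    rw [ent_eq_sum_negMulLog, Fintype.sum_prod_type_right,
      ← sum_negMulLog_mul _ (fun u => (hV u).2)]
    simp only [hAC]
  have e2 : ent p (fun ω => (B ω, C ω)) = ∑ u, pU u * shannon (push (pV u) K) + shannon pU := by
    rw [ent_eq_sum_negMulLog, Fintype.sum_prod_type_right,
      ← sum_negMulLog_mul _ (fun u => (push_mem (hV u) hK).2)]
    simp only [hBC]
  have e3 : ent p C = shannon pU := by
    rw [ent_eq_sum_negMulLog, shannon]; simp only [hC]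
  have e4 : ent p (fun ω => (A ω, B ω, C ω)) = ∑ u, ∑ v, pU u * pV u v * shannon (K v)
      + (∑ u, pU u * shannon (pV u) + shannon pU) := by
    rw [← sum_negMulLog_mul _ (fun u => (hV u).2), ← Fintype.sum_prod_type',
      ← Fintype.sum_prod_type']
    have := sum_negMulLog_mul (fun x : U × V => pU x.1 * pV x.1 x.2) (k := fun x => K x.2)
      (fun x => (hK x.2).2)
    rw [shannon] at this
    rw [← this, ent_eq_sum_negMulLog]
    simp only [Fintype.sum_prod_type, h]
    rw [Finset.sum_comm]
    rw [Finset.sum_comm]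
    conv_lhs => enter [2, v]; rw [Finset.sum_comm]
    rw [Finset.sum_comm]
  simp only [condMutualInfo, entropy_eq_ent_div, e1, e2, e3, e4]
  ring

theorem mutualInfo_of_law (hK : ∀ v, K v ∈ stdSimplex ℝ Y)
    (h : ∀ v y u, law p (fun ω => (A ω, B ω, C ω)) (v, y, u) = pU u * pV u v * K v y) :
    mutualInfo p A B = (shannon (push pU (fun u => push (pV u) K))
      - ∑ u, ∑ v, pU u * pV u v * shannon (K v)) / Real.log 2 := by
  have hAB : ∀ v y, law p (fun ω => (A ω, B ω)) (v, y) = push pU pV v * K v y := fun v y => by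
    rw [← sum_law_prod p _ C, push, Finset.sum_mul]
    refine Finset.sum_congr rfl fun u _ => ?_
    rw [← h]; exact law_congr p (by simp only [Prod.mk.injEq]; tauto)
  have hA : ∀ v, law p A v = push pU pV v := fun v => by
    rw [← sum_law_prod p _ B]
    simp only [hAB, ← Finset.mul_sum, (hK v).2, mul_one]
  have hB : ∀ y, law p B y = push (push pU pV) K y := fun y => by
    rw [← sum_law_prod p _ A]
    conv_rhs => rw [push]
    refine Finset.sum_congr rfl fun v _ => ?_
    rw [← hAB]; exact law_congr p (by simp only [Prod.mk.injEq]; tauto)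
  have e1 : ent p A = shannon (push pU pV) := by
    rw [ent_eq_sum_negMulLog, shannon]; simp only [hA]
  have e2 : ent p B = shannon (push pU (fun u => push (pV u) K)) := by
    rw [ent_eq_sum_negMulLog, shannon, ← push_push]; simp only [hB]
  have e3 : ent p (fun ω => (A ω, B ω)) = ∑ u, ∑ v, pU u * pV u v * shannon (K v)
      + shannon (push pU pV) := by
    rw [ent_eq_sum_negMulLog, Fintype.sum_prod_type]
    simp only [hAB]
    rw [sum_negMulLog_mul _ (fun v => (hK v).2)]
    congr 1
    simp only [push, Finset.sum_mul]
    exact Finset.sum_comm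
  simp only [mutualInfo, entropy_eq_ent_div, e1, e2, e3]
  ring

end Formulas

section AuxLaw

variable [Fintype U] [Fintype V] [Fintype X] (W : Channel X Y Z) {pU : U → ℝ}
  {pV : U → V → ℝ} {pX : V → X → ℝ}

theorem law_auxLaw_Y (v : V) (y : Y) (u : U) :
    law (auxLaw W pU pV pX) (fun ω => (rvV ω, rvY ω, rvU ω)) (v, y, u)
      = pU u * pV u v * push (pX v) W.toY y := by
  simp only [law_eq, Fintype.sum_prod_type, rvV, rvY, rvU, auxLaw, Prod.mk.injEq, push,
    Channel.toY]
  rw [Finset.sum_eq_single u (fun b _ hb => by simp [hb]) (by simp),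
    Finset.sum_eq_single v (fun b _ hb => by simp [hb]) (by simp)]
  simp only [true_and, and_true, Finset.mul_sum]
  refine Finset.sum_congr rfl fun x _ => ?_
  rw [Finset.sum_eq_single y (fun b _ hb => by simp [hb]) (by simp)]
  simp [mul_assoc]

theorem law_auxLaw_Z (v : V) (z : Z) (u : U) :
    law (auxLaw W pU pV pX) (fun ω => (rvV ω, rvZ ω, rvU ω)) (v, z, u)
      = pU u * pV u v * push (pX v) W.toZ z := by
  simp only [law_eq, Fintype.sum_prod_type, rvV, rvZ, rvU, auxLaw, Prod.mk.injEq, push,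
    Channel.toZ]
  rw [Finset.sum_eq_single u (fun b _ hb => by simp [hb]) (by simp),
    Finset.sum_eq_single v (fun b _ hb => by simp [hb]) (by simp)]
  simp only [true_and, and_true, Finset.mul_sum]
  refine Finset.sum_congr rfl fun x _ => Finset.sum_congr rfl fun y _ => ?_
  rw [Finset.sum_eq_single z (fun b _ hb => by simp [hb]) (by simp)]
  simp [mul_assoc]

end AuxLaw

end Kernels

/-! ### Convex description of the region -/

section CompactHull

/-- By Carathéodory's theorem the convex hull of a compact set `s` in a space of dimension `d` is
the image of the compact set `stdSimplex × s ^ (d + 1)`. -/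
theorem isCompact_convexHull_of_isCompact {E : Type*} [NormedAddCommGroup E] [NormedSpace ℝ E]
    [FiniteDimensional ℝ E] {s : Set E} (hs : IsCompact s) : IsCompact (convexHull ℝ s) := by
  rcases s.eq_empty_or_nonempty with rfl | ⟨x₀, hx₀⟩
  · simp
  let d := Module.finrank ℝ E + 1
  let f : (Fin d → ℝ) × (Fin d → E) → E := fun x => ∑ i, x.1 i • x.2 i
  have hf : Continuous f := by fun_prop
  have hc : IsCompact (stdSimplex ℝ (Fin d) ×ˢ Set.univ.pi fun _ : Fin d => s) :=
    (isCompact_stdSimplex ℝ _).prod (isCompact_univ_pi fun _ => hs)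
  convert hc.image hf
  refine Set.Subset.antisymm (fun x hx => ?_) ?_
  · obtain ⟨ι, _, z, w, hz, hai, hw, hw1, hwx⟩ := eq_pos_convex_span_of_mem_convexHull hx
    have hcard : Fintype.card ι ≤ Fintype.card (Fin d) := by
      rw [Fintype.card_fin]; exact hai.card_le_finrank_succ.trans (by
        exact Nat.succ_le_succ (Submodule.finrank_le _))
    obtain ⟨e⟩ := Function.Embedding.nonempty_of_card_le hcard
    refine ⟨(fun j => if h : ∃ i, e i = j then w h.choose else 0,
      fun j => if h : ∃ i, e i = j then z h.choose else x₀), ⟨⟨fun j => ?_, ?_⟩, fun j _ => ?_⟩, ?_⟩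
    · simp only; split_ifs
      exacts [(hw _).le, le_rfl]
    · rw [← hw1]
      symm
      refine Finset.sum_of_injOn e e.injective.injOn (by simp) (fun j _ hj => ?_) fun i _ => ?_
      · have : ¬ ∃ i, e i = j := by simpa using hj
        simp only [dif_neg this]
      · have h : ∃ i', e i' = e i := ⟨i, rfl⟩
        simp only [dif_pos h, e.injective h.choose_spec]
    · simp only; split_ifs
      exacts [hz (Set.mem_range_self _), hx₀]
    · rw [← hwx]
      symm
      refine Finset.sum_of_injOn e e.injective.injOn (by simp) (fun j _ hj => ?_) fun i _ => ?_
      · have : ¬ ∃ i, e i = j := by simpa using hj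
        simp only [dif_neg this, zero_smul]
      · have h : ∃ i', e i' = e i := ⟨i, rfl⟩
        simp only [dif_pos h, e.injective h.choose_spec]
  · rintro _ ⟨⟨w, z⟩, ⟨hw, hz⟩, rfl⟩
    exact mem_convexHull_of_exists_fintype w z hw.1 hw.2 (fun i => hz i trivial) rfl

end CompactHull

section Region

variable {X Y Z : Type*} [Fintype X] [Fintype Y] [Fintype Z]

theorem continuous_shannon : Continuous (shannon : (Y → ℝ) → ℝ) := by
  unfold shannon
  exact continuous_finsetSum _ fun y _ => Real.continuous_negMulLog.comp (continuous_apply y)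

theorem continuous_shannon_push (K : X → Y → ℝ) :
    Continuous fun P : X → ℝ => shannon (push P K) := by
  refine continuous_shannon.comp (continuous_pi fun y => ?_)
  unfold push
  fun_prop

theorem concaveOn_shannon : ConcaveOn ℝ {m : Y → ℝ | ∀ y, 0 ≤ m y} shannon := by
  refine ⟨fun a ha b hb s t hs ht _ y => ?_, fun a ha b hb s t hs ht hst => ?_⟩
  · exact add_nonneg (mul_nonneg hs (ha y)) (mul_nonneg ht (hb y))
  · simp only [shannon, Finset.smul_sum, ← Finset.sum_add_distrib]
    exact Finset.sum_le_sum fun y _ => Real.concaveOn_negMulLog.2 (ha y) (hb y) hs ht hst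

theorem concaveOn_shannon_push {K : X → Y → ℝ} (hK : ∀ x, K x ∈ stdSimplex ℝ Y) :
    ConcaveOn ℝ (stdSimplex ℝ X) fun P => shannon (push P K) := by
  refine ⟨convex_stdSimplex ℝ X, fun a ha b hb s t hs ht hst => ?_⟩
  have := concaveOn_shannon.2 (push_mem ha hK).1 (push_mem hb hK).1 hs ht hst
  convert this using 2
  funext y
  simp only [push, Pi.add_apply, Pi.smul_apply, smul_eq_mul, Finset.mul_sum,
    ← Finset.sum_add_distrib]
  exact Finset.sum_congr rfl fun _ _ => by ring

variable (W : Channel X Y Z)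

/-- The output entropy `H(Y)` for the input law `P`. -/
def outEntropy (P : X → ℝ) : ℝ := shannon (push P W.toY)

/-- The difference `H(Y) - H(Z)` for the input law `P`. -/
def entropyGap (P : X → ℝ) : ℝ := shannon (push P W.toY) - shannon (push P W.toZ)

/-- All triples `(P, H(Y) - H(Z), H(Y))` where `P` is an input law. -/
def lawCurve : Set ((X → ℝ) × ℝ × ℝ) :=
  (fun P => (P, entropyGap W P, outEntropy W P)) '' stdSimplex ℝ X

/-- All triples `(law of X, I(V;Y) - I(V;Z), H(Y|V))`, where `V` is an auxiliary variable. -/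
def innerTriples : Set ((X → ℝ) × ℝ × ℝ) :=
  (fun t => (t.1, entropyGap W t.1 - t.2.1, t.2.2)) '' convexHull ℝ (lawCurve W)

/-- All triples `(law of X, I(V;Y|U) - I(V;Z|U), H(Y|V))`, where `(U, V)` are auxiliary
variables. -/
def outerTriples : Set ((X → ℝ) × ℝ × ℝ) := convexHull ℝ (innerTriples W)

/-- The pairs `(r₁, r₂)` with `r₁ ≤ I(V;Y|U) - I(V;Z|U)` and `r₂ ≤ I(V;Y)` in nats. -/
def boundSet : Set (ℝ × ℝ) :=
  {r | ∃ t ∈ outerTriples W, r.1 ≤ t.2.1 ∧ r.2 ≤ outEntropy W t.1 - t.2.2}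

theorem continuous_outEntropy : Continuous (outEntropy W) := continuous_shannon_push _

theorem continuous_entropyGap : Continuous (entropyGap W) :=
  (continuous_shannon_push _).sub (continuous_shannon_push _)

theorem isCompact_outerTriples : IsCompact (outerTriples W) := by
  have h1 : IsCompact (lawCurve W) := (isCompact_stdSimplex ℝ X).image
    (continuous_id.prodMk ((continuous_entropyGap W).prodMk (continuous_outEntropy W)))
  refine isCompact_convexHull_of_isCompact
    ((isCompact_convexHull_of_isCompact h1).image ?_)
  exact continuous_fst.prodMk ((((continuous_entropyGap W).comp continuous_fst).sub
    (by fun_prop)).prodMk (by fun_prop))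

theorem isClosed_boundSet : IsClosed (boundSet W) := by
  have hφ : Continuous fun t : (X → ℝ) × ℝ × ℝ => (t.2.1, outEntropy W t.1 - t.2.2) :=
    Continuous.prodMk (by fun_prop) (((continuous_outEntropy W).comp continuous_fst).sub
      (by fun_prop))
  have h : boundSet W = (fun t : (X → ℝ) × ℝ × ℝ => (t.2.1, outEntropy W t.1 - t.2.2)) ''
      outerTriples W + Set.Iic (0 : ℝ × ℝ) := by
    ext r
    simp only [boundSet, Set.mem_add, Set.mem_image, exists_exists_and_eq_and, Set.mem_Iic]
    constructor
    · rintro ⟨t, ht, h1, h2⟩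
      refine ⟨t, ht, r - (t.2.1, outEntropy W t.1 - t.2.2), ?_, by simp⟩
      rw [Prod.le_def]
      exact ⟨by simpa using h1, by simpa using h2⟩
    · rintro ⟨t, ht, y, hy, rfl⟩
      rw [Prod.le_def] at hy
      exact ⟨t, ht, by simpa using hy.1, by simpa using hy.2⟩
  rw [h, add_comm]
  exact isClosed_Iic.add_right_of_isCompact ((isCompact_outerTriples W).image hφ)

theorem outerTriples_fst_mem {t : (X → ℝ) × ℝ × ℝ} (ht : t ∈ outerTriples W) :
    t.1 ∈ stdSimplex ℝ X := by
  have hc : Convex ℝ {t : (X → ℝ) × ℝ × ℝ | t.1 ∈ stdSimplex ℝ X} :=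
    (convex_stdSimplex ℝ X).linear_preimage (LinearMap.fst ℝ (X → ℝ) (ℝ × ℝ))
  refine convexHull_min ?_ hc ht
  rintro _ ⟨t', ht', rfl⟩
  have : convexHull ℝ (lawCurve W) ⊆ {t | t.1 ∈ stdSimplex ℝ X} := by
    refine convexHull_min ?_ hc
    rintro _ ⟨P, hP, rfl⟩
    exact hP
  have h := this ht'
  exact h

theorem convex_boundSet : Convex ℝ (boundSet W) := by
  rintro r ⟨t, ht, h1, h2⟩ r' ⟨t', ht', h1', h2'⟩ a b ha hb hab
  refine ⟨a • t + b • t', convex_convexHull ℝ _ ht ht' ha hb hab, ?_, ?_⟩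
  · simp only [Prod.fst_add, Prod.smul_fst, Prod.snd_add, Prod.smul_snd, smul_eq_mul]
    gcongr
  · have := (concaveOn_shannon_push W.toY_mem).2 (outerTriples_fst_mem W ht)
      (outerTriples_fst_mem W ht') ha hb hab
    simp only [outEntropy, Prod.fst_add, Prod.smul_fst, Prod.snd_add, Prod.smul_snd,
      smul_eq_mul] at *
    nlinarith [mul_le_mul_of_nonneg_left h2 ha, mul_le_mul_of_nonneg_left h2' hb]

/-- The pairs bounded by the information quantities of finite auxiliary variables. -/
theorem exists_aux_of_mem_boundSet {r : ℝ × ℝ} (hr : r ∈ boundSet W) :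
    ∃ (k l : ℕ) (pU : Fin k → ℝ) (pV : Fin k → Fin l → ℝ) (pX : Fin l → X → ℝ),
      pU ∈ stdSimplex ℝ (Fin k) ∧ (∀ u, pV u ∈ stdSimplex ℝ (Fin l)) ∧
      (∀ v, pX v ∈ stdSimplex ℝ X) ∧
      r.1 / Real.log 2 ≤ condMutualInfo (auxLaw W pU pV pX) rvV rvY rvU
        - condMutualInfo (auxLaw W pU pV pX) rvV rvZ rvU ∧
      r.2 / Real.log 2 ≤ mutualInfo (auxLaw W pU pV pX) rvV rvY := by
  have hl2 : 0 < Real.log 2 := Real.log_pos (by norm_num)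
  obtain ⟨t, ht, h1, h2⟩ := hr
  rw [outerTriples, mem_convexHull_iff_exists_fintype] at ht
  obtain ⟨ι, _, w, t', hw, hw1, ht', rfl⟩ := ht
  choose s hs hst using ht'
  simp only [mem_convexHull_iff_exists_fintype] at hs
  choose κ hκ w' P hw' hw1' hP hPs using hs
  choose Q hQ hQP using hP
  -- `V` is the disjoint union of the index sets of the inner convex combinations
  let V := Σ i, κ i
  let eU := Fintype.equivFin ι
  let eV := Fintype.equivFin V
  let pV : ι → V → ℝ := fun i v => if h : v.1 = i then w' i (h ▸ v.2) else 0
  let pX : V → X → ℝ := fun v => Q v.1 v.2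
  have hsumV : ∀ i (f : V → ℝ), ∑ v, pV i v * f v = ∑ j, w' i j * f ⟨i, j⟩ := by
    intro i f
    rw [Fintype.sum_sigma, Finset.sum_eq_single i]
    · simp [pV]
    · intro b _ hb
      simp [pV, hb]
    · simp
  have hpV : ∀ i, pV i ∈ stdSimplex ℝ V := fun i => ⟨fun v => by
      simp only [pV]; split_ifs
      exacts [hw' _ _, le_rfl], by
      simpa [hw1'] using hsumV i (fun _ => 1)⟩
  have hPfst : ∀ i, (t' i).1 = push (pV i) pX := by
    intro i
    funext x
    rw [push, hsumV i, ← hst i, ← hPs i]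
    simp [Prod.fst_sum, ← hQP, pX]
  have hgap : ∀ i, (t' i).2.1 = entropyGap W (t' i).1 - ∑ v, pV i v * entropyGap W (pX v) := by
    intro i
    rw [hsumV i, ← hst i, ← hPs i]
    simp [Prod.fst_sum, Prod.snd_sum, ← hQP, pX]
  have hout : ∀ i, (t' i).2.2 = ∑ v, pV i v * outEntropy W (pX v) := by
    intro i
    rw [hsumV i, ← hst i, ← hPs i]
    simp [Prod.snd_sum, ← hQP, pX]
  have hV' : ∀ u, (fun v => pV (eU.symm u) (eV.symm v)) ∈ stdSimplex ℝ (Fin (Fintype.card V)) :=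
    fun u => ⟨fun v => (hpV _).1 _, by
      rw [eV.symm.sum_comp (pV (eU.symm u))]; exact (hpV _).2⟩
  have hX' : ∀ v, pX (eV.symm v) ∈ stdSimplex ℝ X := fun v => hQ _ _
  have hKY : ∀ v, push (pX (eV.symm v)) W.toY ∈ stdSimplex ℝ Y := fun v =>
    push_mem (hX' v) W.toY_mem
  have hKZ : ∀ v, push (pX (eV.symm v)) W.toZ ∈ stdSimplex ℝ Z := fun v =>
    push_mem (hX' v) W.toZ_mem
  have epushY : ∀ i, push (fun v => pV i (eV.symm v)) (fun v => push (pX (eV.symm v)) W.toY)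
      = push (pV i) (fun v => push (pX v) W.toY) := fun i => by
    funext y
    exact eV.symm.sum_comp (fun v => pV i v * push (pX v) W.toY y)
  have epushZ : ∀ i, push (fun v => pV i (eV.symm v)) (fun v => push (pX (eV.symm v)) W.toZ)
      = push (pV i) (fun v => push (pX v) W.toZ) := fun i => by
    funext y
    exact eV.symm.sum_comp (fun v => pV i v * push (pX v) W.toZ y)
  have esum : ∀ f : V → ℝ, ∑ u, ∑ v, w (eU.symm u) * pV (eU.symm u) (eV.symm v) * f (eV.symm v)
      = ∑ i, w i * ∑ v, pV i v * f v := by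
    intro f
    rw [← eU.symm.sum_comp]
    refine Finset.sum_congr rfl fun u _ => ?_
    rw [Finset.mul_sum, ← eV.symm.sum_comp]
    exact Finset.sum_congr rfl fun _ _ => by ring
  refine ⟨Fintype.card ι, Fintype.card V, fun u => w (eU.symm u),
    fun u v => pV (eU.symm u) (eV.symm v), fun v => pX (eV.symm v),
    ⟨fun u => hw _, by rw [eU.symm.sum_comp w]; exact hw1⟩, hV', hX', ?_, ?_⟩
  · rw [condMutualInfo_of_law hV' hKY (law_auxLaw_Y W), condMutualInfo_of_law hV' hKZ
      (law_auxLaw_Z W), ← sub_div]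
    refine div_le_div_of_nonneg_right (h1.trans (le_of_eq ?_)) hl2.le
    simp only [epushY, epushZ]
    rw [esum (fun v => shannon (push (pX v) W.toY)), esum (fun v => shannon (push (pX v) W.toZ)),
      eU.symm.sum_comp (fun i => w i * shannon (push (pV i) fun v => push (pX v) W.toY)),
      eU.symm.sum_comp (fun i => w i * shannon (push (pV i) fun v => push (pX v) W.toZ))]
    simp only [Prod.snd_sum, Prod.fst_sum, Prod.smul_snd, Prod.smul_fst, smul_eq_mul, hgap,
      hPfst, entropyGap, push_push, mul_sub, Finset.sum_sub_distrib]
    ring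
  · rw [mutualInfo_of_law hKY (law_auxLaw_Y W)]
    refine div_le_div_of_nonneg_right (h2.trans (le_of_eq ?_)) hl2.le
    simp only [epushY]
    rw [esum (fun v => shannon (push (pX v) W.toY))]
    congr 1
    · rw [outEntropy]
      congr 1
      have : (∑ i, w i • t' i).1 = push w (fun i => push (pV i) pX) := by
        funext x
        simp [Prod.fst_sum, hPfst, push]
      rw [this, push_push]
      simp only [push_push]
      funext y
      exact (eU.symm.sum_comp
        (fun i => w i * push (pV i) (fun v => push (pX v) W.toY) y)).symm
    · simp only [Prod.snd_sum, Prod.smul_snd, smul_eq_mul, hout, outEntropy]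

end Region

/-! ### Single-letter triples from Markov chains -/

section SingleLetter

variable {X Y Z : Type*} [Fintype X] [Fintype Y] [Fintype Z] (W : Channel X Y Z)

/-- The point `(I(V;Y|U) - I(V;Z|U), I(V;Y))` of the auxiliary variables given by `pU`, `pV` and
`pX`. -/
theorem mem_boundSet_of_kernels {U V : Type*} [Fintype U] [Fintype V] {pU : U → ℝ}
    (hU : pU ∈ stdSimplex ℝ U) {pV : U → V → ℝ} (hV : ∀ u, pV u ∈ stdSimplex ℝ V)
    {pX : V → X → ℝ} (hX : ∀ v, pX v ∈ stdSimplex ℝ X) :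
    ((∑ u, pU u * shannon (push (pV u) fun v => push (pX v) W.toY)
        - ∑ u, ∑ v, pU u * pV u v * shannon (push (pX v) W.toY))
      - (∑ u, pU u * shannon (push (pV u) fun v => push (pX v) W.toZ)
        - ∑ u, ∑ v, pU u * pV u v * shannon (push (pX v) W.toZ)),
      shannon (push pU fun u => push (pV u) fun v => push (pX v) W.toY)
        - ∑ u, ∑ v, pU u * pV u v * shannon (push (pX v) W.toY)) ∈ boundSet W := by
  let s : U → (X → ℝ) × ℝ × ℝ := fun u =>
    ∑ v, pV u v • (pX v, entropyGap W (pX v), outEntropy W (pX v))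
  have hs : ∀ u, s u ∈ convexHull ℝ (lawCurve W) := fun u =>
    mem_convexHull_of_exists_fintype (pV u) _ (hV u).1 (hV u).2
      (fun v => ⟨pX v, hX v, rfl⟩) rfl
  let t : U → (X → ℝ) × ℝ × ℝ := fun u => ((s u).1, entropyGap W (s u).1 - (s u).2.1, (s u).2.2)
  have hs1 : ∀ u, (s u).1 = push (pV u) pX := fun u => by
    funext x
    simp [s, Prod.fst_sum, push]
  refine ⟨∑ u, pU u • t u, mem_convexHull_of_exists_fintype pU t hU.1 hU.2
    (fun u => ⟨s u, hs u, rfl⟩) rfl, le_of_eq ?_, le_of_eq ?_⟩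
  · simp only [Prod.snd_sum, Prod.fst_sum, Prod.smul_snd, Prod.smul_fst, smul_eq_mul, t, hs1]
    simp only [s, Prod.snd_sum, Prod.fst_sum, Prod.smul_snd, Prod.smul_fst, smul_eq_mul,
      entropyGap, push_push, mul_sub, Finset.sum_sub_distrib, Finset.mul_sum, mul_assoc]
    ring
  · have h1 : (∑ u, pU u • t u).1 = push pU (fun u => push (pV u) pX) := by
      funext x
      simp [Prod.fst_sum, t, hs1, push]
    rw [h1, outEntropy, push_push]
    simp only [push_push, Prod.snd_sum, Prod.smul_snd, smul_eq_mul, t, s, outEntropy,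
      Finset.mul_sum, mul_assoc]

/-- The probability vector proportional to `m`, or `d` when `m` has no mass. -/
def normalize {α : Type*} [Fintype α] (d m : α → ℝ) : α → ℝ :=
  if ∑ a, m a = 0 then d else fun a => (∑ a, m a)⁻¹ * m a

theorem normalize_mem {α : Type*} [Fintype α] {d m : α → ℝ} (hd : d ∈ stdSimplex ℝ α)
    (hm : ∀ a, 0 ≤ m a) : normalize d m ∈ stdSimplex ℝ α := by
  unfold normalize
  split_ifs with h
  · exact hd
  · exact ⟨fun a => mul_nonneg (inv_nonneg.2 (Finset.sum_nonneg fun a _ => hm a)) (hm a), by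
      rw [← Finset.mul_sum, inv_mul_cancel₀ h]⟩

theorem sum_mul_normalize {α : Type*} [Fintype α] (d : α → ℝ) {m : α → ℝ}
    (hm : ∀ a, 0 ≤ m a) (a : α) : (∑ a, m a) * normalize d m a = m a := by
  unfold normalize
  split_ifs with h
  · rw [h, zero_mul, (Finset.sum_eq_zero_iff_of_nonneg fun a _ => hm a).1 h a (Finset.mem_univ a)]
  · rw [mul_inv_cancel_left₀ h]

/-- If `A → X → B` is a Markov chain through `K`, the law of `(A, B, f A)` factors through
`pU`, `pV` and `pX`, which are versions of the law of `f A` and of the conditional laws of `A` and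
of `X`. -/
theorem law_triple_of_markov {Ω α β T : Type*} [Fintype Ω] (p : Ω → ℝ)
    (A : Ω → α) (f : α → β) (Xv : Ω → X) (B : Ω → T) {K : X → T → ℝ}
    (hB : ∀ v y, law p (fun ω => (A ω, B ω)) (v, y)
      = ∑ x, law p (fun ω => (A ω, Xv ω)) (v, x) * K x y)
    {pU : β → ℝ} {pV : β → α → ℝ} {pX : α → X → ℝ}
    (hV : ∀ u v, pU u * pV u v = if f v = u then law p A v else 0)
    (hX : ∀ v x, law p A v * pX v x = law p (fun ω => (A ω, Xv ω)) (v, x))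
    (v : α) (y : T) (u : β) :
    law p (fun ω => (A ω, B ω, f (A ω))) (v, y, u) = pU u * pV u v * push (pX v) K y := by
  rw [hV]
  split_ifs with h
  · rw [push, Finset.mul_sum]
    simp only [← mul_assoc, hX]
    rw [← hB]
    refine law_congr p fun ω => ?_
    simp only [Prod.mk.injEq]
    constructor
    · tauto
    · rintro ⟨rfl, rfl⟩; simp [h]
  · rw [zero_mul, law_eq]
    refine Finset.sum_eq_zero fun ω _ => if_neg ?_
    simp only [Prod.mk.injEq]
    rintro ⟨rfl, -, h'⟩
    exact h h'

/-- If `C` is a function of `A`, and `A → X → Y` and `A → X → Z` are Markov chains through the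
marginals of the channel, then `(U, V) = (C, A)` gives a point of `boundSet W`. -/
theorem mem_boundSet_of_markov {Ω α β : Type*} [Fintype Ω] [Fintype α] [Fintype β] {p : Ω → ℝ}
    (hp : p ∈ stdSimplex ℝ Ω) (A : Ω → α) (f : α → β) (Xv : Ω → X) (Yv : Ω → Y) (Zv : Ω → Z)
    (hY : ∀ v y, law p (fun ω => (A ω, Yv ω)) (v, y)
      = ∑ x, law p (fun ω => (A ω, Xv ω)) (v, x) * W.toY x y)
    (hZ : ∀ v z, law p (fun ω => (A ω, Zv ω)) (v, z)
      = ∑ x, law p (fun ω => (A ω, Xv ω)) (v, x) * W.toZ x z) :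
    (Real.log 2 * (condMutualInfo p A Yv (fun ω => f (A ω))
        - condMutualInfo p A Zv (fun ω => f (A ω))),
      Real.log 2 * mutualInfo p A Yv) ∈ boundSet W := by
  have hl2 : Real.log 2 ≠ 0 := (Real.log_pos (by norm_num)).ne'
  set pU := law p (fun ω => f (A ω)) with hpU
  let m : β → α → ℝ := fun u v => if f v = u then law p A v else 0
  have hm : ∀ u v, 0 ≤ m u v := fun u v => by
    simp only [m]; split_ifs
    exacts [law_nonneg hp.1 _ _, le_rfl]
  have hmsum : ∀ u, ∑ v, m u v = pU u := fun u => by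
    have := sum_law_mul p A (fun v => if f v = u then 1 else 0)
    simp only [mul_ite, mul_one, mul_zero] at this
    exact this
  let pV : β → α → ℝ := fun u => normalize (law p A) (m u)
  let pX : α → X → ℝ := fun v => normalize (law p Xv) (fun x => law p (fun ω => (A ω, Xv ω)) (v, x))
  have hV : ∀ u, pV u ∈ stdSimplex ℝ α := fun u =>
    normalize_mem (law_mem_stdSimplex hp A) (hm u)
  have hX : ∀ v, pX v ∈ stdSimplex ℝ X := fun v =>
    normalize_mem (law_mem_stdSimplex hp Xv) (fun x => law_nonneg hp.1 _ _)
  have e1 : ∀ u v, pU u * pV u v = m u v := fun u v => by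
    rw [← hmsum u]; exact sum_mul_normalize _ (hm u) v
  have e2 : ∀ v x, law p A v * pX v x = law p (fun ω => (A ω, Xv ω)) (v, x) := fun v x => by
    rw [← sum_law_prod p A Xv v]
    exact sum_mul_normalize _ (fun x => law_nonneg hp.1 _ _) x
  have key := mem_boundSet_of_kernels W (law_mem_stdSimplex hp (fun ω => f (A ω))) hV hX
  rw [condMutualInfo_of_law hV (fun v => push_mem (hX v) W.toY_mem)
      (law_triple_of_markov p A f Xv Yv hY e1 e2),
    condMutualInfo_of_law hV (fun v => push_mem (hX v) W.toZ_mem)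
      (law_triple_of_markov p A f Xv Zv hZ e1 e2),
    mutualInfo_of_law (fun v => push_mem (hX v) W.toY_mem)
      (law_triple_of_markov p A f Xv Yv hY e1 e2), ← sub_div,
    mul_div_cancel₀ _ hl2, mul_div_cancel₀ _ hl2]
  exact key

theorem boundSet_lower {r r' : ℝ × ℝ} (hr : r ∈ boundSet W) (h1 : r'.1 ≤ r.1) (h2 : r'.2 ≤ r.2) :
    r' ∈ boundSet W := by
  obtain ⟨t, ht, a, b⟩ := hr
  exact ⟨t, ht, h1.trans a, h2.trans b⟩

end SingleLetter

/-! ### The converse -/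

theorem Channel.sum_fst {X Y Z : Type*} [Fintype Y] [Fintype Z] (W : Channel X Y Z)
    (x : X) (y : Y) :
    (∑ s : Y × Z, if s.1 = y then W.trans x s else 0) = W.toY x y := by
  rw [Fintype.sum_prod_type, Finset.sum_eq_single y (fun b _ hb => by simp [hb]) (by simp)]
  simp [Channel.toY]

theorem Channel.sum_snd {X Y Z : Type*} [Fintype Y] [Fintype Z] (W : Channel X Y Z)
    (x : X) (z : Z) :
    (∑ s : Y × Z, if s.2 = z then W.trans x s else 0) = W.toZ x z := by
  rw [Fintype.sum_prod_type_right, Finset.sum_eq_single z (fun b _ hb => by simp [hb]) (by simp)]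
  simp [Channel.toZ]

section Converse

variable {X Y Z : Type*} [Fintype X] [Fintype Y] [Fintype Z]

theorem sum_jointLaw_mul {n Mp Ms : ℕ} (c : Code X Y n Mp Ms) (W : Channel X Y Z)
    (F : (Fin Mp × Fin Ms) × (Fin n → X) × (Fin n → Y) × (Fin n → Z) → ℝ) :
    ∑ ω, c.jointLaw W ω * F ω = ((Mp : ℝ) * Ms)⁻¹ * ∑ w, ∑ x, c.enc w x *
      piE (fun i => W.trans (x i)) (fun t => F (w, x, fun i => (t i).1, fun i => (t i).2)) := by
  rw [Fintype.sum_prod_type, Finset.mul_sum]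
  refine Finset.sum_congr rfl fun w _ => ?_
  rw [Fintype.sum_prod_type, Finset.mul_sum]
  refine Finset.sum_congr rfl fun x _ => ?_
  rw [piE, ← (Equiv.arrowProdEquivProdArrow (Fin n) (fun _ => Y) (fun _ => Z)).sum_comp,
    Finset.mul_sum, Finset.mul_sum]
  refine Finset.sum_congr rfl fun t _ => ?_
  simp only [Code.jointLaw, Equiv.arrowProdEquivProdArrow_apply]
  ring

theorem jointLaw_mem {n Mp Ms : ℕ} (c : Code X Y n Mp Ms) (W : Channel X Y Z) (hMp : 0 < Mp)
    (hMs : 0 < Ms) : c.jointLaw W ∈ stdSimplex ℝ _ := by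
  refine ⟨fun ω => ?_, ?_⟩
  · exact mul_nonneg (mul_nonneg (by positivity) ((c.enc_mem _).1 _))
      (Finset.prod_nonneg fun i _ => (W.trans_mem _).1 _)
  · have h := sum_jointLaw_mul c W (fun _ => 1)
    simp only [mul_one, piE_const (fun i => W.trans_mem _), (c.enc_mem _).2, Finset.sum_const,
      Finset.card_univ, Fintype.card_prod, Fintype.card_fin, nsmul_eq_mul] at h
    rw [h]
    push_cast
    have : (Mp : ℝ) * Ms ≠ 0 := by positivity
    field_simp

theorem sum_law_prod_mul {Ω α β : Type*} [Fintype Ω] [Fintype β] (p : Ω → ℝ) (A : Ω → α)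
    (B : Ω → β) (a : α) (f : β → ℝ) :
    ∑ b, law p (fun ω => (A ω, B ω)) (a, b) * f b
      = ∑ ω, p ω * if A ω = a then f (B ω) else 0 := by
  simp only [law_eq, Finset.sum_mul]
  rw [Finset.sum_comm]
  refine Finset.sum_congr rfl fun ω _ => ?_
  by_cases h : A ω = a <;> simp [h]

/-- The channel is memoryless: the outputs at time `i` depend on anything determined by the
messages, the inputs and the outputs at other times only through the input at time `i`. -/
theorem law_output {n Mp Ms : ℕ} (c : Code X Y n Mp Ms) (W : Channel X Y Z) {α T : Type*}
    (i : Fin n)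
    (A : (Fin Mp × Fin Ms) × (Fin n → X) × (Fin n → Y) × (Fin n → Z) → α)
    (hA : ∀ w x y z y' z', A (w, x, Function.update y i y', Function.update z i z')
      = A (w, x, y, z)) (g : Y × Z → T) (b : T) (v : α) :
    law (c.jointLaw W) (fun ω => (A ω, g (ω.2.2.1 i, ω.2.2.2 i))) (v, b)
      = ∑ x, law (c.jointLaw W) (fun ω => (A ω, ω.2.1 i)) (v, x) *
        ∑ s, if g s = b then W.trans x s else 0 := by
  rw [sum_law_prod_mul]
  have h1 : law (c.jointLaw W) (fun ω => (A ω, g (ω.2.2.1 i, ω.2.2.2 i))) (v, b) =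
      ∑ ω, c.jointLaw W ω *
        (if A ω = v then (if g (ω.2.2.1 i, ω.2.2.2 i) = b then 1 else 0) else 0) := by
    rw [law_eq]
    refine Finset.sum_congr rfl fun ω _ => ?_
    by_cases h : A ω = v <;> simp [h]
  rw [h1, sum_jointLaw_mul, sum_jointLaw_mul]
  congr 1
  refine Finset.sum_congr rfl fun w _ => Finset.sum_congr rfl fun x _ => ?_
  congr 1
  rw [piE_resample i (W.trans_mem (x i)).2]
  congr 1
  funext t
  have hu : ∀ s, A (w, x, (fun j => (Function.update t i s j).1),
      fun j => (Function.update t i s j).2) = A (w, x, (fun j => (t j).1), fun j => (t j).2) := by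
    intro s
    rw [← hA w x (fun j => (t j).1) (fun j => (t j).2) s.1 s.2]
    congr 4 <;> funext j <;> by_cases hj : j = i
    · subst hj; simp
    · simp [Function.update_of_ne hj]
    · subst hj; simp
    · simp [Function.update_of_ne hj]
  simp only [hu, Function.update_self]
  split_ifs
  · simp
  · simp

section Hybrids

variable {M X Y Z : Type*} {n : ℕ}

/-- The hybrid output vector: `y` before time `k`, and `z` from time `k` on. -/
def hybrid (k : ℕ) (ω : M × (Fin n → X) × (Fin n → Y) × (Fin n → Z)) : Fin n → Y ⊕ Z :=
  fun j => if j.val < k then Sum.inl (ω.2.2.1 j) else Sum.inr (ω.2.2.2 j)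

/-- The outputs `y` before time `i` and `z` after time `i`. -/
def hybridWithout (i : Fin n) (ω : M × (Fin n → X) × (Fin n → Y) × (Fin n → Z)) :
    Fin n → Option (Y ⊕ Z) :=
  fun j => if j.val < i.val then some (Sum.inl (ω.2.2.1 j))
    else if i.val < j.val then some (Sum.inr (ω.2.2.2 j)) else none

/-- The outputs `y` before time `k`. -/
def pastY (k : ℕ) (ω : M × (Fin n → X) × (Fin n → Y) × (Fin n → Z)) : Fin n → Option Y :=
  fun j => if j.val < k then some (ω.2.2.1 j) else none

theorem hybrid_succ_eq_iff (i : Fin n) (ω ω' : M × (Fin n → X) × (Fin n → Y) × (Fin n → Z)) :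
    hybrid (i.val + 1) ω = hybrid (i.val + 1) ω' ↔
      ω.2.2.1 i = ω'.2.2.1 i ∧ hybridWithout i ω = hybridWithout i ω' := by
  simp only [funext_iff, hybrid, hybridWithout]
  refine ⟨fun h => ⟨by simpa using h i, fun j => ?_⟩, fun h j => ?_⟩
  · have := h j
    grind
  · have := h.2 j
    by_cases hj : j = i
    · subst hj; simpa using h.1
    · have : j.val ≠ i.val := fun h => hj (Fin.ext h)
      grind

theorem hybrid_eq_iff (i : Fin n) (ω ω' : M × (Fin n → X) × (Fin n → Y) × (Fin n → Z)) :
    hybrid i.val ω = hybrid i.val ω' ↔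
      ω.2.2.2 i = ω'.2.2.2 i ∧ hybridWithout i ω = hybridWithout i ω' := by
  simp only [funext_iff, hybrid, hybridWithout]
  refine ⟨fun h => ⟨by simpa using h i, fun j => ?_⟩, fun h j => ?_⟩
  · have := h j
    grind
  · have := h.2 j
    by_cases hj : j = i
    · subst hj; simpa using h.1
    · have : j.val ≠ i.val := fun h => hj (Fin.ext h)
      grind

theorem pastY_succ_eq_iff (i : Fin n) (ω ω' : M × (Fin n → X) × (Fin n → Y) × (Fin n → Z)) :
    pastY (i.val + 1) ω = pastY (i.val + 1) ω' ↔
      ω.2.2.1 i = ω'.2.2.1 i ∧ pastY i.val ω = pastY i.val ω' := by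
  simp only [funext_iff, pastY]
  refine ⟨fun h => ⟨by simpa using h i, fun j => ?_⟩, fun h j => ?_⟩
  · have := h j
    grind
  · have := h.2 j
    by_cases hj : j = i
    · subst hj; simpa using h.1
    · have : j.val ≠ i.val := fun h => hj (Fin.ext h)
      grind

theorem pastY_eq_of_hybridWithout_eq (i : Fin n)
    (ω ω' : M × (Fin n → X) × (Fin n → Y) × (Fin n → Z))
    (h : hybridWithout i ω = hybridWithout i ω') : pastY i.val ω = pastY i.val ω' := by
  simp only [funext_iff, pastY, hybridWithout] at *
  intro j
  have := h j
  grind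

end Hybrids

theorem law_message {n Mp Ms : ℕ} (c : Code X Y n Mp Ms) (W : Channel X Y Z)
    (w : Fin Mp × Fin Ms) : law (c.jointLaw W) (fun ω => ω.1) w = ((Mp : ℝ) * Ms)⁻¹ := by
  have h := sum_jointLaw_mul c W (fun ω => if ω.1 = w then 1 else 0)
  have hE : ∀ (x : Fin n → X) (r : ℝ), piE (fun i => W.trans (x i)) (fun _ => r) = r :=
    fun x r => piE_const (fun i => W.trans_mem _) r
  simp only [mul_ite, mul_one, mul_zero] at h
  rw [law_eq]
  rw [h]
  have : ∑ w', ∑ x, c.enc w' x * piE (fun i => W.trans (x i)) (fun _ => if w' = w then 1 else 0)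
      = 1 := by
    simp_rw [fun (w' : Fin Mp × Fin Ms) x => hE x (if w' = w then 1 else 0)]
    rw [Finset.sum_eq_single w (fun b _ hb => by simp [hb]) (by simp)]
    simpa using (c.enc_mem w).2
  rw [this, mul_one]

theorem law_confidential {n Mp Ms : ℕ} (c : Code X Y n Mp Ms) (W : Channel X Y Z) (hMp : 0 < Mp)
    (w : Fin Ms) : law (c.jointLaw W) (fun ω => ω.1.2) w = (Ms : ℝ)⁻¹ := by
  have h := sum_law_mul (c.jointLaw W) (fun ω => ω.1) (fun v => if v.2 = w then 1 else 0)
  have h' : law (c.jointLaw W) (fun ω => ω.1.2) w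
      = ∑ v : Fin Mp × Fin Ms, ((Mp : ℝ) * Ms)⁻¹ * if v.2 = w then 1 else 0 := by
    rw [law_eq]
    simp only [law_message] at h
    rw [h]
    exact Finset.sum_congr rfl fun ω _ => by simp
  rw [h']
  simp only [mul_ite, mul_one, mul_zero, Fintype.sum_prod_type, Finset.sum_ite_eq',
    Finset.mem_univ, if_true, Finset.sum_const, Finset.card_univ, Fintype.card_fin, nsmul_eq_mul]
  have : (Mp : ℝ) ≠ 0 := by positivity
  rw [mul_inv, mul_inv_cancel_left₀ this]

/-- The single-letter bound on any code, with the Fano and leakage terms explicit. The gap between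
`I(W;Yⁿ)` and `I(W;Zⁿ)` telescopes along the hybrids of `Yⁿ` and `Zⁿ`. -/
theorem converse_bound {n Mp Ms : ℕ} (c : Code X Y n Mp Ms) (W : Channel X Y Z) (hn : 0 < n)
    (hMp : 0 < Mp) (hMs : 0 < Ms) :
    ((Real.log Ms - Real.log 2 * c.leakage W
        - (Real.log 2 + c.errorProb W * Real.log (Mp * Ms))) / n,
      (Real.log (Mp * Ms) - (Real.log 2 + c.errorProb W * Real.log (Mp * Ms))) / n)
      ∈ boundSet W := by
  have hl2 : Real.log 2 ≠ 0 := (Real.log_pos (by norm_num)).ne'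
  set p := c.jointLaw W with hp_def
  have hp := jointLaw_mem c W hMp hMs
  rw [← hp_def] at hp
  let Ω := (Fin Mp × Fin Ms) × (Fin n → X) × (Fin n → Y) × (Fin n → Z)
  let Wv : Ω → Fin Mp × Fin Ms := fun ω => ω.1
  let Wsv : Ω → Fin Ms := fun ω => ω.1.2
  let Yn : Ω → Fin n → Y := fun ω => ω.2.2.1
  let Zn : Ω → Fin n → Z := fun ω => ω.2.2.2
  have hne : Nonempty (Fin Mp × Fin Ms) := ⟨(⟨0, hMp⟩, ⟨0, hMs⟩)⟩
  set φ := Real.log 2 + c.errorProb W * Real.log (Mp * Ms) with hφ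
  -- Fano: `H(W|Yⁿ) ≤ φ`
  have hfano : ent p (fun ω => (Wv ω, Yn ω)) - ent p Yn ≤ φ := by
    have h := fano hp Wv Yn c.dec
    rwa [Fintype.card_prod, Fintype.card_fin, Fintype.card_fin, Nat.cast_mul] at h
  have hW : ent p Wv = Real.log (Mp * Ms) := ent_of_uniform hp.2 _ (law_message c W)
  have hWs : ent p Wsv = Real.log Ms := ent_of_uniform hp.2 _ (law_confidential c W hMp)
  have hleak : Real.log 2 * c.leakage W
      = ent p Wsv + ent p Zn - ent p (fun ω => (Wsv ω, Zn ω)) := by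
    simp only [Code.leakage, mutualInfo, entropy_eq_ent_div]
    field_simp
    rfl
  have hmono : ent p (fun ω => (Wsv ω, Zn ω)) ≤ ent p (fun ω => (Wv ω, Zn ω)) := by
    refine (ent_le_ent_prod hp.1 (fun ω => ω.1.1) (fun ω => (Wsv ω, Zn ω))).trans_eq ?_
    refine ent_congr p fun ω ω' => ?_
    simp only [Wv, Wsv, Prod.ext_iff]
    tauto
  -- the single-letter points of `U = (Y before i, Z after i)` and `V = (W, U)`
  let Uv : Fin n → Ω → Fin n → Option (Y ⊕ Z) := fun i => hybridWithout i
  let A : Fin n → Ω → (Fin Mp × Fin Ms) × (Fin n → Option (Y ⊕ Z)) := fun i ω => (Wv ω, Uv i ω)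
  let a : Fin n → ℝ := fun i =>
    (ent p (fun ω => (Yn ω i, Uv i ω)) - ent p (fun ω => (A i ω, Yn ω i)))
    - (ent p (fun ω => (Zn ω i, Uv i ω)) - ent p (fun ω => (A i ω, Zn ω i)))
  let b : Fin n → ℝ := fun i => ent p (fun ω => Yn ω i)
    - (ent p (fun ω => (A i ω, Yn ω i)) - ent p (A i))
  have hA : ∀ i w x y z y' z', A i (w, x, Function.update y i y', Function.update z i z')
      = A i (w, x, y, z) := by
    intro i w x y z y' z'
    simp only [A, Wv, Uv, Prod.mk.injEq, true_and]
    funext j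
    by_cases hj : j = i
    · subst hj; simp [hybridWithout]
    · simp [hybridWithout, Function.update_of_ne hj]
  have hab : ∀ i, (a i, b i) ∈ boundSet W := by
    intro i
    have h := mem_boundSet_of_markov W hp (A i) Prod.snd (fun ω => ω.2.1 i) (fun ω => Yn ω i)
      (fun ω => Zn ω i) (fun v y => by
        rw [hp_def, law_output c W i (A i) (hA i) Prod.fst y v]
        exact Finset.sum_congr rfl fun x _ => by rw [W.sum_fst])
      (fun v z => by
        rw [hp_def, law_output c W i (A i) (hA i) Prod.snd z v]
        exact Finset.sum_congr rfl fun x _ => by rw [W.sum_snd])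
    refine boundSet_lower W h (le_of_eq ?_) (le_of_eq ?_)
    · simp only [condMutualInfo, entropy_eq_ent_div]
      have e1 : ent p (fun ω => (A i ω, Yn ω i, (A i ω).2)) = ent p (fun ω => (A i ω, Yn ω i)) :=
        ent_congr p fun ω ω' => by
          simp only [Prod.ext_iff]
          tauto
      have e2 : ent p (fun ω => (A i ω, Zn ω i, (A i ω).2)) = ent p (fun ω => (A i ω, Zn ω i)) :=
        ent_congr p fun ω ω' => by
          simp only [Prod.ext_iff]
          tauto
      rw [e1, e2]
      simp only [a]
      field_simp
      ring
    · simp only [mutualInfo, entropy_eq_ent_div, b]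
      field_simp
      ring
  -- the telescoping sums
  have hsum_a : ∑ i, a i
      = (ent p Yn - ent p (fun ω => (Wv ω, Yn ω)))
        - (ent p Zn - ent p (fun ω => (Wv ω, Zn ω))) := by
    let G : ℕ → ℝ := fun k =>
      ent p (fun ω : Ω => hybrid k ω) - ent p (fun ω : Ω => (Wv ω, hybrid k ω))
    have ha : ∀ i : Fin n, a i = G (i.val + 1) - G i.val := by
      intro i
      have e1 : ent p (fun ω : Ω => hybrid (i.val + 1) ω) = ent p (fun ω => (Yn ω i, Uv i ω)) :=
        ent_congr p fun ω ω' => by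
          rw [hybrid_succ_eq_iff]; simp [Yn, Uv]
      have e2 : ent p (fun ω : Ω => hybrid i.val ω) = ent p (fun ω => (Zn ω i, Uv i ω)) :=
        ent_congr p fun ω ω' => by
          rw [hybrid_eq_iff]; simp [Zn, Uv]
      have e3 : ent p (fun ω : Ω => (Wv ω, hybrid (i.val + 1) ω))
          = ent p (fun ω => (A i ω, Yn ω i)) := ent_congr p fun ω ω' => by
        simp only [Prod.mk.injEq, hybrid_succ_eq_iff, A, Yn, Uv]; tauto
      have e4 : ent p (fun ω : Ω => (Wv ω, hybrid i.val ω))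
          = ent p (fun ω => (A i ω, Zn ω i)) := ent_congr p fun ω ω' => by
        simp only [Prod.mk.injEq, hybrid_eq_iff, A, Zn, Uv]; tauto
      simp only [G, e1, e2, e3, e4, a]
    have hY' : ∀ ω ω' : Ω, hybrid n ω = hybrid n ω' ↔ Yn ω = Yn ω' := fun ω ω' => by
      simp [funext_iff, hybrid, Yn]
    have hZ' : ∀ ω ω' : Ω, hybrid 0 ω = hybrid 0 ω' ↔ Zn ω = Zn ω' := fun ω ω' => by
      simp [funext_iff, hybrid, Zn]
    have g1 : G n = ent p Yn - ent p (fun ω => (Wv ω, Yn ω)) := by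
      have e : ent p (fun ω : Ω => (Wv ω, hybrid n ω)) = ent p (fun ω => (Wv ω, Yn ω)) :=
        ent_congr p fun ω ω' => by simp only [Prod.mk.injEq, hY']
      simp only [G]
      rw [ent_congr p hY', e]
    have g2 : G 0 = ent p Zn - ent p (fun ω => (Wv ω, Zn ω)) := by
      have e : ent p (fun ω : Ω => (Wv ω, hybrid 0 ω)) = ent p (fun ω => (Wv ω, Zn ω)) :=
        ent_congr p fun ω ω' => by simp only [Prod.mk.injEq, hZ']
      simp only [G]
      rw [ent_congr p hZ', e]
    simp only [ha]
    rw [Fin.sum_univ_eq_sum_range (fun k => G (k + 1) - G k) n, Finset.sum_range_sub, g1, g2]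
  -- here `U` may be replaced by the past of `Y` alone, as conditioning lowers entropy
  have hsum_b : ent p Yn + ent p Wv - ent p (fun ω => (Wv ω, Yn ω)) ≤ ∑ i, b i := by
    let G : ℕ → ℝ := fun k =>
      ent p (fun ω : Ω => pastY k ω) - ent p (fun ω : Ω => (Wv ω, pastY k ω))
    have hb : ∀ i : Fin n, G (i.val + 1) - G i.val ≤ b i := by
      intro i
      have e1 : ent p (fun ω : Ω => pastY (i.val + 1) ω)
          ≤ ent p (fun ω => Yn ω i) + ent p (fun ω : Ω => pastY i.val ω) := by
        refine le_trans (le_of_eq ?_) (ent_prod_le hp (fun ω => Yn ω i) (fun ω => pastY i.val ω))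
        exact ent_congr p fun ω ω' => by rw [pastY_succ_eq_iff]; simp [Yn]
      have e2 := ent_submodular hp (fun ω => Yn ω i) (Uv i) (fun ω => (Wv ω, pastY i.val ω))
      have e3 : ent p (fun ω => (Yn ω i, Uv i ω, Wv ω, pastY i.val ω))
          = ent p (fun ω => (A i ω, Yn ω i)) := ent_congr p fun ω ω' => by
        have := pastY_eq_of_hybridWithout_eq i ω ω'
        simp only [Prod.mk.injEq, A, Yn, Uv]; tauto
      have e4 : ent p (fun ω => (Uv i ω, Wv ω, pastY i.val ω)) = ent p (A i) :=
        ent_congr p fun ω ω' => by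
          have := pastY_eq_of_hybridWithout_eq i ω ω'
          simp only [Prod.mk.injEq, A, Uv]; tauto
      have e5 : ent p (fun ω => (Yn ω i, Wv ω, pastY i.val ω))
          = ent p (fun ω : Ω => (Wv ω, pastY (i.val + 1) ω)) := ent_congr p fun ω ω' => by
        simp only [Prod.mk.injEq, pastY_succ_eq_iff, Yn]; tauto
      rw [e3, e4, e5] at e2
      simp only [G, b]
      linarith
    have hY' : ∀ ω ω' : Ω, pastY n ω = pastY n ω' ↔ Yn ω = Yn ω' := fun ω ω' => by
      simp [funext_iff, pastY, Yn]
    have hZ' : ∀ ω ω' : Ω, pastY 0 ω = pastY 0 ω' := fun ω ω' => by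
      simp [funext_iff, pastY]
    have g1 : G n = ent p Yn - ent p (fun ω => (Wv ω, Yn ω)) := by
      have e : ent p (fun ω : Ω => (Wv ω, pastY n ω)) = ent p (fun ω => (Wv ω, Yn ω)) :=
        ent_congr p fun ω ω' => by simp only [Prod.mk.injEq, hY']
      simp only [G]
      rw [ent_congr p hY', e]
    have g2 : G 0 = - ent p Wv := by
      simp only [G]
      have e1 : ent p (fun ω : Ω => pastY 0 ω) = 0 := by
        rw [← ent_const hp.2 ()]
        exact ent_congr p fun ω ω' => by simp [hZ' ω ω']
      have e2 : ent p (fun ω : Ω => (Wv ω, pastY 0 ω)) = ent p Wv :=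
        ent_congr p fun ω ω' => by simp [hZ' ω ω']
      rw [e1, e2, zero_sub]
    have h := Finset.sum_le_sum fun i (_ : i ∈ Finset.univ) => hb i
    rw [Fin.sum_univ_eq_sum_range (fun k => G (k + 1) - G k) n, Finset.sum_range_sub, g1, g2] at h
    linarith
  -- averaging over time
  have hn0 : (0 : ℝ) < n := by exact_mod_cast hn
  have havg : ∑ i : Fin n, (n : ℝ)⁻¹ • (a i, b i) ∈ boundSet W :=
    (convex_boundSet W).sum_mem (fun i _ => by positivity) (by simp [hn0.ne']) (fun i _ => hab i)
  refine boundSet_lower W havg ?_ ?_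
  · simp only [Prod.fst_sum, Prod.smul_fst, smul_eq_mul, ← Finset.mul_sum]
    rw [div_eq_inv_mul]
    refine mul_le_mul_of_nonneg_left ?_ (by positivity)
    linarith
  · simp only [Prod.snd_sum, Prod.smul_snd, smul_eq_mul, ← Finset.mul_sum]
    rw [div_eq_inv_mul]
    refine mul_le_mul_of_nonneg_left ?_ (by positivity)
    linarith

end Converse

/-! ### Random superposition codes -/

section RandomCodebook

/-- Some outcome of positive probability does not exceed the expectation. -/
theorem exists_le_piE {ι β : Type*} [Fintype ι] [DecidableEq ι] [Fintype β] {q : ι → β → ℝ}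
    (hq : ∀ i, q i ∈ stdSimplex ℝ β) (F : (ι → β) → ℝ) :
    ∃ t, (∀ i, 0 < q i (t i)) ∧ F t ≤ piE q F := by
  by_contra! h
  have h0 : piE q (fun t => F t + -piE q F) = 0 := by
    rw [piE_add, piE_const hq]; ring
  have hprod : ∀ t : ι → β, 0 ≤ ∏ i, q i (t i) := (prod_mem_stdSimplex hq).1
  have hpos : ∀ t : ι → β, 0 < ∏ i, q i (t i) → ∀ i, 0 < q i (t i) := fun t ht i =>
    ((hq i).1 _).lt_of_ne' fun h0 => ht.ne' (Finset.prod_eq_zero (Finset.mem_univ i) h0)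
  have hnn : ∀ t ∈ Finset.univ, 0 ≤ (∏ i, q i (t i)) * (F t + -piE q F) := fun t _ => by
    rcases (hprod t).eq_or_lt with h1 | h1
    · simp [← h1]
    · exact mul_nonneg h1.le (by linarith [h t (hpos t h1)])
  have hz := (Finset.sum_eq_zero_iff_of_nonneg hnn).1 h0
  have : ∑ t : ι → β, ∏ i, q i (t i) = 0 := Finset.sum_eq_zero fun t ht => by
    by_contra hne
    have h1 := (hprod t).lt_of_ne' hne
    have h2 := hz t ht
    have h3 := h t (hpos t h1)
    have := mul_pos h1 (show 0 < F t + -piE q F by linarith)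
    linarith
  rw [(prod_mem_stdSimplex hq).2] at this
  exact one_ne_zero this

variable {U V Y Z A S B : Type*} [Fintype U] [Fintype V] [Fintype Y] [Fintype Z]
  [Fintype A] [Fintype S] [Fintype B]

/-- The expectation over a random superposition codebook: cloud centres `c b` are drawn from `pU`,
and the codeword of `(a, w)` is drawn from `pV (c (g a))`, where `g a` is the cloud of `a`. -/
def codebookE (pU : U → ℝ) (pV : U → V → ℝ) (g : A → B) (F : (B → U) → (A × S → V) → ℝ) : ℝ :=
  piE (fun _ : B => pU) fun c => piE (fun j : A × S => pV (c (g j.1))) fun v => F c v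

variable {pU : U → ℝ} {pV : U → V → ℝ}

theorem codebookE_add (g : A → B) (F G : (B → U) → (A × S → V) → ℝ) :
    codebookE pU pV g (fun c v => F c v + G c v) = codebookE pU pV g F + codebookE pU pV g G := by
  simp only [codebookE, piE_add]

theorem codebookE_const_mul (g : A → B) (r : ℝ) (F : (B → U) → (A × S → V) → ℝ) :
    codebookE pU pV g (fun c v => r * F c v) = r * codebookE pU pV g F := by
  simp only [codebookE, piE_const_mul]

theorem codebookE_sum {κ : Type*} (s : Finset κ) (g : A → B)
    (F : κ → (B → U) → (A × S → V) → ℝ) :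
    codebookE pU pV g (fun c v => ∑ k ∈ s, F k c v) = ∑ k ∈ s, codebookE pU pV g (F k) := by
  simp only [codebookE, piE_sum]

theorem codebookE_eval (hU : pU ∈ stdSimplex ℝ U) (hV : ∀ u, pV u ∈ stdSimplex ℝ V) (g : A → B)
    (j : A × S) (f : U → V → ℝ) :
    codebookE pU pV g (fun c v => f (c (g j.1)) (v j)) = ∑ u, pU u * ∑ v, pV u v * f u v := by
  rw [codebookE, ← piE_eval (fun _ => hU) (g j.1) (fun u => ∑ v, pV u v * f u v)]
  congr 1
  funext c
  exact piE_eval (fun j : A × S => hV (c (g j.1))) j (f (c (g j.1)))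

/-- Two codewords of the same cloud are independent given its centre. -/
theorem codebookE_same (hU : pU ∈ stdSimplex ℝ U) (hV : ∀ u, pV u ∈ stdSimplex ℝ V) (g : A → B)
    {j j' : A × S} (hj : j ≠ j') (hg : g j'.1 = g j.1) (f : U → V → V → ℝ) :
    codebookE pU pV g (fun c v => f (c (g j.1)) (v j) (v j'))
      = ∑ u, pU u * ∑ v, pV u v * ∑ v', pV u v' * f u v v' := by
  rw [codebookE,
    ← piE_eval (fun _ => hU) (g j.1) (fun u => ∑ v, pV u v * ∑ v', pV u v' * f u v v')]
  congr 1
  funext c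
  rw [piE_eval₂ (fun j : A × S => hV (c (g j.1))) hj (f (c (g j.1)))]
  simp only [hg]

/-- Codewords of different clouds are independent. -/
theorem codebookE_diff (hU : pU ∈ stdSimplex ℝ U) (hV : ∀ u, pV u ∈ stdSimplex ℝ V) (g : A → B)
    {j j' : A × S} (hg : g j'.1 ≠ g j.1) (f : V → V → ℝ) :
    codebookE pU pV g (fun _ v => f (v j) (v j'))
      = ∑ u, pU u * ∑ u', pU u' * ∑ v, pV u v * ∑ v', pV u' v' * f v v' := by
  rw [codebookE, ← piE_eval₂ (fun _ => hU) hg.symm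
    (fun u u' => ∑ v, pV u v * ∑ v', pV u' v' * f v v')]
  congr 1
  funext c
  exact piE_eval₂ (fun j : A × S => hV (c (g j.1))) (fun h => hg (by rw [h])) f

theorem exists_le_codebookE (hU : pU ∈ stdSimplex ℝ U) (hV : ∀ u, pV u ∈ stdSimplex ℝ V)
    (g : A → B) (F : (B → U) → (A × S → V) → ℝ) :
    ∃ c v, (∀ j : A × S, 0 < pV (c (g j.1)) (v j)) ∧ F c v ≤ codebookE pU pV g F := by
  obtain ⟨c, -, hc⟩ := exists_le_piE (fun _ : B => hU)
    (fun c => piE (fun j : A × S => pV (c (g j.1))) fun v => F c v)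
  obtain ⟨v, hv, hv'⟩ := exists_le_piE (fun j : A × S => hV (c (g j.1))) (fun v => F c v)
  exact ⟨c, v, hv, hv'.trans hc⟩

/-- The expected tilted likelihood ratio `E[(γ R(y|u) / K(y|v)) ^ s]` of a reference kernel `R`
against the channel `K`. -/
def tilted (pU : U → ℝ) (pV : U → V → ℝ) (K : V → Y → ℝ) (R : U → Y → ℝ) (γ s : ℝ) : ℝ :=
  ∑ u, pU u * ∑ v, pV u v * ∑ y, K v y * (γ * R u y / K v y) ^ s

/-- The indicator of a failed threshold test is at most the tilted likelihood ratio. -/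
theorem mul_ite_le_tilt {k r γ s : ℝ} (hγ : 0 < γ) (hr : 0 ≤ r) (hk : 0 ≤ k) (hs : 0 < s) :
    k * (if γ * r < k then 0 else 1) ≤ k * (γ * r / k) ^ s := by
  rcases hk.eq_or_lt with rfl | hk
  · simp
  refine mul_le_mul_of_nonneg_left ?_ hk.le
  split_ifs with h
  · exact Real.rpow_nonneg (by positivity) s
  · exact Real.one_le_rpow ((one_le_div hk).2 (not_lt.1 h)) hs.le

/-- Change of measure for a passed threshold test: below `1`, the likelihood ratio is at most its
`s`-th power. -/
theorem mul_ite_le_tilt_div {k r γ s : ℝ} (hr : 0 ≤ r) (hk : 0 ≤ k) (hγ : 0 < γ) (hs : 0 < s)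
    (hs1 : s ≤ 1) : r * (if γ * r < k then 1 else 0) ≤ k * (γ * r / k) ^ s / γ := by
  split_ifs with h
  · have hk' : 0 < k := (mul_nonneg hγ.le hr).trans_lt h
    have ht0 : 0 ≤ γ * r / k := by positivity
    have ht1 : γ * r / k ≤ 1 := (div_le_one hk').2 h.le
    have := Real.rpow_le_rpow_of_exponent_ge' ht0 ht1 hs.le hs1
    rw [Real.rpow_one] at this
    rw [le_div_iff₀ hγ]
    calc r * 1 * γ = k * (γ * r / k) := by field_simp
      _ ≤ _ := mul_le_mul_of_nonneg_left this hk
  · rw [mul_zero]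
    have : 0 ≤ γ * r / k := by positivity
    positivity

/-! ### The threshold decoder -/

/-- The union bound on the error of a threshold decoder when `j` is sent: the codeword `v j` fails
one of the two tests, or another codeword of the same cloud passes the first test, or a codeword of
another cloud passes the second one. -/
def errorTerm (K : V → Y → ℝ) (Q : U → Y → ℝ) (q : Y → ℝ) (γ₁ γ₂ : ℝ) (g : A → B) (j : A × S)
    (c : B → U) (v : A × S → V) : ℝ :=
  ∑ y, K (v j) y * ((if γ₁ * Q (c (g j.1)) y < K (v j) y then 0 else 1)
    + (if γ₂ * q y < K (v j) y then 0 else 1)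
    + ∑ j' ∈ Finset.univ.filter (· ≠ j), if g j'.1 = g j.1
        then (if γ₁ * Q (c (g j.1)) y < K (v j') y then 1 else 0)
        else (if γ₂ * q y < K (v j') y then 1 else 0))

/-- The decoder that looks for the only codeword passing both threshold tests. -/
theorem exists_decoder {U V B : Type*} [Nonempty A] [Nonempty S] {K : V → Y → ℝ}
    (hK : ∀ v, K v ∈ stdSimplex ℝ Y)
    (Q : U → Y → ℝ) (q : Y → ℝ) (γ₁ γ₂ : ℝ) (g : A → B) (c : B → U) (v : A × S → V) :
    ∃ dec : Y → A × S, ∀ j, ∑ y, K (v j) y * (if dec y = j then 0 else 1)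
      ≤ errorTerm K Q q γ₁ γ₂ g j c v := by
  let pass : A × S → Y → Prop := fun j y =>
    γ₁ * Q (c (g j.1)) y < K (v j) y ∧ γ₂ * q y < K (v j) y
  let dec : Y → A × S := fun y => if h : ∃ j, pass j y ∧ ∀ j', pass j' y → j' = j then h.choose
    else Classical.arbitrary _
  refine ⟨dec, fun j => Finset.sum_le_sum fun y _ => mul_le_mul_of_nonneg_left ?_ ((hK _).1 y)⟩
  set T : A × S → ℝ := fun j' => if g j'.1 = g j.1
        then (if γ₁ * Q (c (g j.1)) y < K (v j') y then 1 else 0)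
        else (if γ₂ * q y < K (v j') y then 1 else 0) with hT
  have hT0 : ∀ j', 0 ≤ T j' := fun j' => by simp only [hT]; split_ifs <;> norm_num
  have hT1 : ∀ j', pass j' y → T j' = 1 := fun j' h => by
    simp only [hT]
    split_ifs with h1 h2 h3
    · rfl
    · rw [← h1] at h2; exact absurd h.1 h2
    · rfl
    · exact absurd h.2 h3
  have hsum : 0 ≤ ∑ j' ∈ Finset.univ.filter (· ≠ j), T j' := Finset.sum_nonneg fun j' _ => hT0 j'
  by_cases h1 : γ₁ * Q (c (g j.1)) y < K (v j) y
  swap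
  · rw [if_neg h1]
    have e1 : (if dec y = j then (0 : ℝ) else 1) ≤ 1 := by split_ifs <;> norm_num
    have e2 : (0 : ℝ) ≤ (if γ₂ * q y < K (v j) y then 0 else 1) := by split_ifs <;> norm_num
    linarith
  by_cases h2 : γ₂ * q y < K (v j) y
  swap
  · rw [if_pos h1, if_neg h2]
    have e1 : (if dec y = j then (0 : ℝ) else 1) ≤ 1 := by split_ifs <;> norm_num
    linarith
  by_cases h3 : ∃ j', j' ≠ j ∧ pass j' y
  · obtain ⟨j', hj', hp⟩ := h3
    have := Finset.single_le_sum (f := T) (fun j' _ => hT0 j')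
      (show j' ∈ Finset.univ.filter (· ≠ j) by simp [hj'])
    rw [hT1 j' hp] at this
    rw [if_pos h1, if_pos h2]
    have e1 : (if dec y = j then (0 : ℝ) else 1) ≤ 1 := by split_ifs <;> norm_num
    linarith
  · push Not at h3
    have hex : ∃ j, pass j y ∧ ∀ j', pass j' y → j' = j :=
      ⟨j, ⟨h1, h2⟩, fun j' hp => by by_contra hne; exact h3 j' hne hp⟩
    have hd : dec y = j := by
      simp only [dec, dif_pos hex]
      by_contra hne
      exact h3 _ hne hex.choose_spec.1
    rw [if_pos hd, if_pos h1, if_pos h2]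
    linarith

/-- The expected error of the threshold decoder. A threshold that dominates the number of
competitors makes the union bound over them as small as the probability of a missed test. -/
theorem codebookE_errorTerm_le (hU : pU ∈ stdSimplex ℝ U) (hV : ∀ u, pV u ∈ stdSimplex ℝ V)
    {K : V → Y → ℝ} (hK : ∀ v, K v ∈ stdSimplex ℝ Y) {γ₁ γ₂ s₁ s₂ : ℝ} (hγ₁ : 0 < γ₁)
    (hγ₂ : 0 < γ₂) (hs₁ : 0 < s₁) (hs₁' : s₁ ≤ 1) (hs₂ : 0 < s₂) (hs₂' : s₂ ≤ 1) (g : A → B)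
    (j : A × S)
    (hN₁ : ((Finset.univ.filter fun a => g a = g j.1).card * Fintype.card S : ℝ) ≤ γ₁)
    (hN₂ : (Fintype.card A * Fintype.card S : ℝ) ≤ γ₂) :
    codebookE pU pV g (errorTerm K (fun u => push (pV u) K)
        (push pU fun u => push (pV u) K) γ₁ γ₂ g j)
      ≤ 2 * tilted pU pV K (fun u => push (pV u) K) γ₁ s₁
        + 2 * tilted pU pV K (fun _ => push pU fun u => push (pV u) K) γ₂ s₂ := by
  set Q : U → Y → ℝ := fun u => push (pV u) K with hQ
  set q : Y → ℝ := push pU Q with hq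
  have hQm : ∀ u, Q u ∈ stdSimplex ℝ Y := fun u => push_mem (hV u) hK
  have hqm : q ∈ stdSimplex ℝ Y := push_mem hU hQm
  set α₁ := tilted pU pV K Q γ₁ s₁ with hα₁
  set α₂ := tilted pU pV K (fun _ => q) γ₂ s₂ with hα₂
  have hmono : ∀ f f' : U → V → ℝ, (∀ u v, f u v ≤ f' u v) →
      ∑ u, pU u * ∑ v, pV u v * f u v ≤ ∑ u, pU u * ∑ v, pV u v * f' u v := fun f f' h =>
    Finset.sum_le_sum fun u _ => mul_le_mul_of_nonneg_left
      (Finset.sum_le_sum fun v _ => mul_le_mul_of_nonneg_left (h u v) ((hV u).1 v)) (hU.1 u)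
  have hα₁0 : 0 ≤ α₁ := Finset.sum_nonneg fun u _ => mul_nonneg (hU.1 u) <|
    Finset.sum_nonneg fun v _ => mul_nonneg ((hV u).1 v) <| Finset.sum_nonneg fun y _ =>
      mul_nonneg ((hK v).1 y) <| Real.rpow_nonneg
        (div_nonneg (mul_nonneg hγ₁.le ((hQm u).1 y)) ((hK v).1 y)) _
  have hα₂0 : 0 ≤ α₂ := Finset.sum_nonneg fun u _ => mul_nonneg (hU.1 u) <|
    Finset.sum_nonneg fun v _ => mul_nonneg ((hV u).1 v) <| Finset.sum_nonneg fun y _ =>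
      mul_nonneg ((hK v).1 y) <| Real.rpow_nonneg
        (div_nonneg (mul_nonneg hγ₂.le (hqm.1 y)) ((hK v).1 y)) _
  -- the transmitted codeword fails a test
  have m1 : codebookE pU pV g (fun c v => ∑ y, K (v j) y *
      (if γ₁ * Q (c (g j.1)) y < K (v j) y then 0 else 1)) ≤ α₁ := by
    rw [codebookE_eval hU hV g j
      (fun u v => ∑ y, K v y * (if γ₁ * Q u y < K v y then 0 else 1))]
    exact hmono _ _ fun u v => Finset.sum_le_sum fun y _ =>
      mul_ite_le_tilt hγ₁ ((hQm u).1 y) ((hK v).1 y) hs₁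
  have m2 : codebookE pU pV g (fun c v => ∑ y, K (v j) y *
      (if γ₂ * q y < K (v j) y then 0 else 1)) ≤ α₂ := by
    rw [codebookE_eval hU hV g j
      (fun u v => ∑ y, K v y * (if γ₂ * q y < K v y then 0 else 1))]
    exact hmono _ _ fun u v => Finset.sum_le_sum fun y _ =>
      mul_ite_le_tilt hγ₂ (hqm.1 y) ((hK v).1 y) hs₂
  -- a competitor passes a test
  let T : A × S → (B → U) → (A × S → V) → ℝ := fun j' c v => ∑ y, K (v j) y *
    (if g j'.1 = g j.1 then (if γ₁ * Q (c (g j.1)) y < K (v j') y then 1 else 0)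
      else (if γ₂ * q y < K (v j') y then 1 else 0))
  have m3 : ∀ j', j' ≠ j → g j'.1 = g j.1 → codebookE pU pV g (T j') ≤ α₁ / γ₁ := by
    intro j' hj' hg
    have e : T j' = fun c v => (fun u x x' => ∑ y, K x y *
        (if γ₁ * Q u y < K x' y then 1 else 0)) (c (g j.1)) (v j) (v j') := by
      funext c v; simp [T, hg]
    rw [e, codebookE_same hU hV g hj'.symm hg (fun u x x' => ∑ y, K x y *
        (if γ₁ * Q u y < K x' y then 1 else 0))]
    have e2 : ∀ u, ∑ v, pV u v * ∑ v', pV u v' * ∑ y, K v y *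
        (if γ₁ * Q u y < K v' y then (1 : ℝ) else 0)
        = ∑ v', pV u v' * ∑ y, Q u y * (if γ₁ * Q u y < K v' y then 1 else 0) := by
      intro u
      simp only [hQ, push, Finset.mul_sum, Finset.sum_mul]
      rw [Finset.sum_comm]
      refine Finset.sum_congr rfl fun v' _ => ?_
      rw [Finset.sum_comm]
      exact Finset.sum_congr rfl fun y _ => Finset.sum_congr rfl fun v _ => by ring
    simp only [e2]
    refine (hmono _ (fun u v' => (∑ y, K v' y * (γ₁ * Q u y / K v' y) ^ s₁) / γ₁)
      fun u v' => ?_).trans_eq ?_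
    · rw [Finset.sum_div]
      exact Finset.sum_le_sum fun y _ =>
        mul_ite_le_tilt_div ((hQm u).1 y) ((hK v').1 y) hγ₁ hs₁ hs₁'
    · simp only [hα₁, tilted, mul_div_assoc', ← Finset.sum_div]
  have m4 : ∀ j', g j'.1 ≠ g j.1 → codebookE pU pV g (T j') ≤ α₂ / γ₂ := by
    intro j' hg
    have e : T j' = fun c v => (fun x x' => ∑ y, K x y *
        (if γ₂ * q y < K x' y then 1 else 0)) (v j) (v j') := by
      funext c v; simp [T, hg]
    rw [e, codebookE_diff hU hV g hg (fun x x' => ∑ y, K x y *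
        (if γ₂ * q y < K x' y then 1 else 0))]
    have e2 : ∑ u, pU u * ∑ u', pU u' * ∑ v, pV u v * ∑ v', pV u' v' * ∑ y, K v y *
        (if γ₂ * q y < K v' y then (1 : ℝ) else 0)
        = ∑ u', pU u' * ∑ v', pV u' v' * ∑ y, q y * (if γ₂ * q y < K v' y then 1 else 0) := by
      have : ∀ y, q y = ∑ u, pU u * ∑ v, pV u v * K v y := fun y => rfl
      conv_rhs => enter [2, u', 2, 2, v', 2, 2, y, 1]; rw [this y]
      simp only [Finset.mul_sum, Finset.sum_mul]
      rw [Finset.sum_comm]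
      refine Finset.sum_congr rfl fun u' _ => ?_
      conv_lhs => enter [2, u]; rw [Finset.sum_comm]
      rw [Finset.sum_comm]
      refine Finset.sum_congr rfl fun v' _ => ?_
      conv_lhs => enter [2, u]; rw [Finset.sum_comm]
      rw [Finset.sum_comm]
      exact Finset.sum_congr rfl fun y _ => Finset.sum_congr rfl fun u _ =>
        Finset.sum_congr rfl fun v _ => by ring
    rw [e2]
    refine (hmono _ (fun u v' => (∑ y, K v' y * (γ₂ * q y / K v' y) ^ s₂) / γ₂)
      fun u v' => ?_).trans_eq ?_
    · rw [Finset.sum_div]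
      exact Finset.sum_le_sum fun y _ =>
        mul_ite_le_tilt_div (hqm.1 y) ((hK v').1 y) hγ₂ hs₂ hs₂'
    · simp only [hα₂, tilted, mul_div_assoc', ← Finset.sum_div]
  have hsplit : errorTerm K Q q γ₁ γ₂ g j = fun c v =>
      (∑ y, K (v j) y * (if γ₁ * Q (c (g j.1)) y < K (v j) y then 0 else 1)
        + ∑ y, K (v j) y * (if γ₂ * q y < K (v j) y then 0 else 1))
        + ∑ j' ∈ Finset.univ.filter (· ≠ j), T j' c v := by
    funext c v
    simp only [errorTerm, T]
    rw [Finset.sum_comm, ← Finset.sum_add_distrib, ← Finset.sum_add_distrib]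
    refine Finset.sum_congr rfl fun y _ => ?_
    rw [mul_add, mul_add, Finset.mul_sum]
  have hsumT : ∑ j' ∈ Finset.univ.filter (· ≠ j), codebookE pU pV g (T j') ≤ α₁ + α₂ := by
    have hb : ∀ j' ∈ Finset.univ.filter (· ≠ j), codebookE pU pV g (T j')
        ≤ (if g j'.1 = g j.1 then α₁ / γ₁ else 0) + α₂ / γ₂ := by
      intro j' hj'
      have hne : j' ≠ j := by simpa using hj'
      by_cases hg : g j'.1 = g j.1
      · rw [if_pos hg]
        have := m3 j' hne hg
        have : 0 ≤ α₂ / γ₂ := by positivity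
        linarith
      · rw [if_neg hg, zero_add]; exact m4 j' hg
    have hnn : ∀ j' : A × S, 0 ≤ (if g j'.1 = g j.1 then α₁ / γ₁ else 0) + α₂ / γ₂ := fun j' => by
      split_ifs <;> positivity
    refine (Finset.sum_le_sum hb).trans ((Finset.sum_le_sum_of_subset_of_nonneg
      (Finset.filter_subset _ _) fun j' _ _ => hnn j').trans ?_)
    rw [Finset.sum_add_distrib, Finset.sum_const, Finset.card_univ, Fintype.card_prod,
      nsmul_eq_mul, Fintype.sum_prod_type_right]
    simp only [← Finset.sum_filter, Finset.sum_const, Finset.card_univ, nsmul_eq_mul]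
    have f1 : (Fintype.card S : ℝ) * ((Finset.univ.filter fun a => g a = g j.1).card * (α₁ / γ₁))
        ≤ α₁ := by
      calc _ = ((Finset.univ.filter fun a => g a = g j.1).card * Fintype.card S) * (α₁ / γ₁) := by
            ring
        _ ≤ γ₁ * (α₁ / γ₁) := mul_le_mul_of_nonneg_right hN₁ (by positivity)
        _ = α₁ := by field_simp
    have f2 : ((Fintype.card A * Fintype.card S : ℕ) : ℝ) * (α₂ / γ₂) ≤ α₂ := by
      push_cast
      calc _ ≤ γ₂ * (α₂ / γ₂) := mul_le_mul_of_nonneg_right hN₂ (by positivity)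
        _ = α₂ := by field_simp
    linarith
  rw [hsplit, codebookE_add, codebookE_add, codebookE_sum (Finset.univ.filter (· ≠ j)) g T]
  linarith

end RandomCodebook

/-! ### Leakage of a random superposition code -/

section Leakage

theorem shannon_le_crossEntropy {Z : Type*} [Fintype Z] {m r : Z → ℝ} (hm : m ∈ stdSimplex ℝ Z)
    (hr : r ∈ stdSimplex ℝ Z) (hpos : ∀ z, 0 < m z → 0 < r z) :
    shannon m ≤ ∑ z, m z * -Real.log (r z) := by
  have h := ent_le_crossEntropy hm (fun z => z) hr.1 hr.2.le hpos
  rw [ent_eq_sum_negMulLog] at h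
  have e : ∀ z, law m (fun z => z) z = m z := fun z => by simp [law_eq]
  simp only [e] at h
  exact h

theorem log_one_add_le_rpow_div {x s : ℝ} (hx : 0 ≤ x) (hs : 0 < s) (hs1 : s ≤ 1) :
    Real.log (1 + x) ≤ x ^ s / s := by
  rw [le_div_iff₀ hs, mul_comm, ← Real.log_rpow (by positivity)]
  have h1 : (1 + x) ^ s ≤ 1 + x ^ s := by
    have := NNReal.rpow_add_le_add_rpow (1 : NNReal) ⟨x, hx⟩ hs.le hs1
    rw [NNReal.one_rpow] at this
    exact_mod_cast this
  have hxs : 0 ≤ x ^ s := Real.rpow_nonneg hx s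
  calc _ ≤ Real.log (1 + x ^ s) := Real.log_le_log (Real.rpow_pos_of_pos (by positivity) s) h1
    _ ≤ x ^ s := by
      have := Real.log_le_sub_one_of_pos (show 0 < 1 + x ^ s by positivity)
      linarith

/-- **Jensen's inequality** for the logarithm. -/
theorem piE_log_le {ι β : Type*} [Fintype ι] [DecidableEq ι] [Fintype β] {q : ι → β → ℝ}
    (hq : ∀ i, q i ∈ stdSimplex ℝ β) {F : (ι → β) → ℝ} (hF : ∀ t, 0 < F t) :
    piE q (fun t => Real.log (F t)) ≤ Real.log (piE q F) := by
  set m := piE q F with hm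
  have hm0 : 0 < m := by
    obtain ⟨t, -, ht⟩ := exists_le_piE hq F
    exact (hF t).trans_le ht
  have h : piE q (fun t => Real.log (F t)) ≤ piE q (fun t => (Real.log m + -1) + m⁻¹ * F t) := by
    refine piE_mono hq fun t _ => ?_
    have := Real.log_le_sub_one_of_pos (div_pos (hF t) hm0)
    rw [Real.log_div (hF t).ne' hm0.ne', div_eq_inv_mul] at this
    linarith
  rw [piE_add, piE_const hq, piE_const_mul, ← hm, inv_mul_cancel₀ hm0.ne'] at h
  linarith

variable {U V Z A S B : Type*} [Fintype U] [Fintype V] [Fintype Z] [Fintype A] [Fintype S]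
  [Fintype B] {pU : U → ℝ} {pV : U → V → ℝ}

/-- The members of the cloud `b`. -/
def cloud (g : A → B) (b : B) : Finset A := Finset.univ.filter fun a => g a = b

/-- The contribution of the codeword of `j = (a, w)` to the divergence between the output law of
the codewords of `w` in the cloud of `a` and the law `Q` induced by the cloud centre. -/
def leakageTerm (K : V → Z → ℝ) (Q : U → Z → ℝ) (g : A → B) (j : A × S) (c : B → U)
    (v : A × S → V) : ℝ :=
  ∑ z, K (v j) z * Real.log ((∑ a ∈ cloud g (g j.1), K (v (a, j.2)) z)
    / ((cloud g (g j.1)).card * Q (c (g j.1)) z))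

/-- **Soft covering**: a cloud of at least `L` codewords approximates the output law of its centre
up to a tilted moment. Jensen's inequality averages the codewords other than `j`. -/
theorem codebookE_leakageTerm_le (hU : pU ∈ stdSimplex ℝ U) (hV : ∀ u, pV u ∈ stdSimplex ℝ V)
    {K : V → Z → ℝ} (hK : ∀ v, K v ∈ stdSimplex ℝ Z) {L s : ℝ} (hL : 0 < L)
    (hs : 0 < s) (hs1 : s ≤ 1) (g : A → B) (j : A × S) (hcard : L ≤ (cloud g (g j.1)).card) :
    codebookE pU pV g (leakageTerm K (fun u => push (pV u) K) g j)
      ≤ (∑ u, pU u * ∑ v, pV u v * ∑ z, K v z * (K v z / (L * push (pV u) K z)) ^ s) / s := by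
  set Q : U → Z → ℝ := fun u => push (pV u) K with hQ
  have hQm : ∀ u, Q u ∈ stdSimplex ℝ Z := fun u => push_mem (hV u) hK
  have hQpos : ∀ u v z, 0 < pV u v → 0 < K v z → 0 < Q u z := fun u v z h1 h2 =>
    (mul_pos h1 h2).trans_le (Finset.single_le_sum (f := fun v => pV u v * K v z)
      (fun v _ => mul_nonneg ((hV u).1 v) ((hK v).1 z)) (Finset.mem_univ v))
  rw [Finset.sum_div]
  simp only [mul_div_assoc]
  rw [codebookE, ← piE_eval (fun _ : B => hU) (g j.1)
    (fun u => (∑ v, pV u v * ∑ z, K v z * (K v z / (L * Q u z)) ^ s) / s)]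
  refine piE_mono (fun _ => hU) fun c _ => ?_
  set u := c (g j.1) with hu
  set N : ℝ := ((cloud g (g j.1)).card : ℝ) with hN
  have hN0 : 0 < N := hL.trans_le hcard
  set C' := (cloud g (g j.1)).erase j.1 with hC'
  have hjC : j.1 ∈ cloud g (g j.1) := by simp [cloud]
  have hq : ∀ i : A × S, pV (c (g i.1)) ∈ stdSimplex ℝ V := fun i => hV _
  rw [piE_resample j (hq j).2]
  have hupd : ∀ (t : A × S → V) (x : V), leakageTerm K Q g j c (Function.update t j x)
      = ∑ z, K x z * Real.log ((K x z + ∑ a ∈ C', K (t (a, j.2)) z) / (N * Q u z)) := by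
    intro t x
    simp only [leakageTerm, Function.update_self]
    refine Finset.sum_congr rfl fun z _ => ?_
    rw [← Finset.add_sum_erase _ _ hjC]
    congr 4
    · simp
    · refine Finset.sum_congr rfl fun a ha => ?_
      rw [Function.update_of_ne]
      intro h
      exact Finset.ne_of_mem_erase ha (congrArg Prod.fst h)
  simp only [hupd]
  rw [piE_sum, Finset.sum_div]
  refine Finset.sum_le_sum fun x _ => ?_
  rw [piE_const_mul, mul_div_assoc]
  rcases ((hV u).1 x).eq_or_lt with hx | hx
  · rw [← hu, ← hx]; simp
  refine mul_le_mul_of_nonneg_left ?_ hx.le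
  rw [piE_sum, Finset.sum_div]
  refine Finset.sum_le_sum fun z _ => ?_
  rw [piE_const_mul, mul_div_assoc]
  rcases ((hK x).1 z).eq_or_lt with hz | hz
  · rw [← hz]; simp
  refine mul_le_mul_of_nonneg_left ?_ hz.le
  have hQ0 := hQpos u x z hx hz
  refine (piE_log_le hq fun t => ?_).trans ?_
  · have : 0 ≤ ∑ a ∈ C', K (t (a, j.2)) z := Finset.sum_nonneg fun a _ => (hK _).1 z
    positivity
  have hmean : piE (fun i : A × S => pV (c (g i.1)))
      (fun t => (K x z + ∑ a ∈ C', K (t (a, j.2)) z) / (N * Q u z))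
      = (K x z + (N - 1) * Q u z) / (N * Q u z) := by
    simp only [div_eq_inv_mul]
    rw [piE_const_mul, piE_add, piE_const hq, piE_sum]
    congr 2
    have : ∀ a ∈ C', piE (fun i : A × S => pV (c (g i.1))) (fun t => K (t (a, j.2)) z)
        = Q u z := by
      intro a ha
      rw [piE_eval hq (a, j.2) (fun x => K x z)]
      have : g a = g j.1 := by simpa [cloud] using Finset.mem_of_mem_erase ha
      simp only [this, hQ, push, hu]
    rw [Finset.sum_congr rfl this, Finset.sum_const, nsmul_eq_mul, hC',
      Finset.card_erase_of_mem hjC, Nat.cast_sub (Finset.card_pos.2 ⟨_, hjC⟩), Nat.cast_one]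
  rw [hmean]
  have hle : (K x z + (N - 1) * Q u z) / (N * Q u z) ≤ 1 + K x z / (L * Q u z) := by
    have e : (K x z + (N - 1) * Q u z) / (N * Q u z) = 1 + K x z / (N * Q u z) - 1 / N := by
      field_simp
      ring
    have h1 : K x z / (N * Q u z) ≤ K x z / (L * Q u z) :=
      div_le_div_of_nonneg_left hz.le (by positivity) (by gcongr)
    have h2 : 0 < 1 / N := by positivity
    linarith
  have hpos : 0 < (K x z + (N - 1) * Q u z) / (N * Q u z) := by
    have : 1 ≤ N := by
      rw [hN]; exact_mod_cast Finset.card_pos.2 ⟨_, hjC⟩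
    have : 0 ≤ (N - 1) * Q u z := mul_nonneg (by linarith) hQ0.le
    positivity
  exact (Real.log_le_log hpos hle).trans (log_one_add_le_rpow_div (by positivity) hs hs1)

/-- The output law of the eavesdropper given the confidential message `w`. -/
def outLaw (K : V → Z → ℝ) (v : A × S → V) (w : S) (z : Z) : ℝ :=
  (Fintype.card A : ℝ)⁻¹ * ∑ a, K (v (a, w)) z

theorem outLaw_mem {V S : Type*} [Nonempty A] {K : V → Z → ℝ} (hK : ∀ v, K v ∈ stdSimplex ℝ Z)
    (v : A × S → V) (w : S) : outLaw K v w ∈ stdSimplex ℝ Z := by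
  refine ⟨fun z => mul_nonneg (by positivity) (Finset.sum_nonneg fun a _ => (hK _).1 z), ?_⟩
  simp only [outLaw, ← Finset.mul_sum]
  rw [Finset.sum_comm]
  simp only [(hK _).2, Finset.sum_const, Finset.card_univ, nsmul_eq_mul, mul_one]
  exact inv_mul_cancel₀ (by positivity)

/-- The information in nats between a uniform confidential message and the eavesdropper's output. -/
def codebookLeakage (K : V → Z → ℝ) (v : A × S → V) : ℝ :=
  shannon (fun z => (Fintype.card S : ℝ)⁻¹ * ∑ w, outLaw K v w z)
    - (Fintype.card S : ℝ)⁻¹ * ∑ w, shannon (outLaw K v w)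

/-- Averaging `f` over each cloud does not change its sum against a function of the cloud. -/
theorem sum_mul_cloud_average (g : A → B) (f : A → ℝ) (h : B → ℝ) :
    ∑ a, f a * h (g a)
      = ∑ a, ((∑ a' ∈ cloud g (g a), f a') / (cloud g (g a)).card) * h (g a) := by
  rw [← Finset.sum_fiberwise Finset.univ g, ← Finset.sum_fiberwise Finset.univ g
    (fun a => ((∑ a' ∈ cloud g (g a), f a') / (cloud g (g a)).card) * h (g a))]
  refine Finset.sum_congr rfl fun b _ => ?_
  have e1 : ∑ a ∈ Finset.univ.filter (fun a => g a = b), f a * h (g a)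
      = ∑ a ∈ cloud g b, f a * h b := Finset.sum_congr rfl fun a ha => by
    rw [(Finset.mem_filter.1 ha).2]
  have e2 : ∑ a ∈ Finset.univ.filter (fun a => g a = b),
      ((∑ a' ∈ cloud g (g a), f a') / (cloud g (g a)).card) * h (g a)
      = ∑ a ∈ cloud g b, ((∑ a' ∈ cloud g b, f a') / (cloud g b).card) * h b :=
    Finset.sum_congr rfl fun a ha => by rw [(Finset.mem_filter.1 ha).2]
  rw [e1, e2, Finset.sum_const, nsmul_eq_mul, ← Finset.sum_mul]
  rcases (cloud g b).eq_empty_or_nonempty with h0 | h0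
  · simp [h0]
  · have : ((cloud g b).card : ℝ) ≠ 0 := by
      exact_mod_cast (Finset.card_pos.2 h0).ne'
    field_simp

/-- Convexity of the divergence bounds the leakage by the average divergence within clouds. -/
theorem codebookLeakage_le {U : Type*} {pV : U → V → ℝ} [Nonempty A] [Nonempty S] {K : V → Z → ℝ}
    (hK : ∀ v, K v ∈ stdSimplex ℝ Z) (hV : ∀ u, pV u ∈ stdSimplex ℝ V) (g : A → B) (c : B → U)
    (v : A × S → V) (hv : ∀ j : A × S, 0 < pV (c (g j.1)) (v j)) :
    codebookLeakage K v ≤ (Fintype.card S : ℝ)⁻¹ * ∑ w, (Fintype.card A : ℝ)⁻¹ *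
      ∑ a, leakageTerm K (fun u => push (pV u) K) g (a, w) c v := by
  set Q : U → Z → ℝ := fun u => push (pV u) K with hQ
  have hQm : ∀ u, Q u ∈ stdSimplex ℝ Z := fun u => push_mem (hV u) hK
  have hQpos : ∀ (j : A × S) z, 0 < K (v j) z → 0 < Q (c (g j.1)) z := fun j z h =>
    (mul_pos (hv j) h).trans_le (Finset.single_le_sum (f := fun x => pV (c (g j.1)) x * K x z)
      (fun x _ => mul_nonneg ((hV _).1 x) ((hK x).1 z)) (Finset.mem_univ (v j)))
  have hA : (0 : ℝ) < Fintype.card A := by exact_mod_cast Fintype.card_pos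
  have hS : (0 : ℝ) < Fintype.card S := by exact_mod_cast Fintype.card_pos
  -- the reference law mixes the laws induced by the cloud centres
  set R : Z → ℝ := fun z => (Fintype.card A : ℝ)⁻¹ * ∑ a, Q (c (g a)) z with hR
  have hRm : R ∈ stdSimplex ℝ Z := by
    refine ⟨fun z => mul_nonneg (by positivity) (Finset.sum_nonneg fun a _ => (hQm _).1 z), ?_⟩
    simp only [hR, ← Finset.mul_sum]
    rw [Finset.sum_comm]
    simp only [(hQm _).2, Finset.sum_const, Finset.card_univ, nsmul_eq_mul, mul_one]
    exact inv_mul_cancel₀ hA.ne'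
  have hRpos : ∀ w z, 0 < outLaw K v w z → 0 < R z := by
    intro w z h
    obtain ⟨a, -, ha⟩ := Finset.exists_lt_of_sum_lt (s := Finset.univ) (f := fun _ => (0 : ℝ))
      (g := fun a => K (v (a, w)) z) (by
        simpa using pos_of_mul_pos_right h (by positivity))
    exact mul_pos (by positivity) ((hQpos (a, w) z ha).trans_le
      (Finset.single_le_sum (f := fun a => Q (c (g a)) z) (fun a _ => (hQm _).1 z)
        (Finset.mem_univ a)))
  have hmix : (fun z => (Fintype.card S : ℝ)⁻¹ * ∑ w, outLaw K v w z) ∈ stdSimplex ℝ Z := by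
    refine ⟨fun z => mul_nonneg (by positivity)
      (Finset.sum_nonneg fun w _ => (outLaw_mem hK v w).1 z), ?_⟩
    rw [← Finset.mul_sum, Finset.sum_comm]
    simp only [(outLaw_mem hK v _).2, Finset.sum_const, Finset.card_univ, nsmul_eq_mul, mul_one]
    exact inv_mul_cancel₀ hS.ne'
  have h1 := shannon_le_crossEntropy hmix hRm (fun z hz => by
    obtain ⟨w, -, hw⟩ := Finset.exists_lt_of_sum_lt (s := Finset.univ) (f := fun _ => (0 : ℝ))
      (g := fun w => outLaw K v w z) (by
        simpa using pos_of_mul_pos_right hz (by positivity))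
    exact hRpos w z hw)
  have h2 : ∑ z, ((Fintype.card S : ℝ)⁻¹ * ∑ w, outLaw K v w z) * -Real.log (R z)
      = (Fintype.card S : ℝ)⁻¹ * ∑ w, ∑ z, outLaw K v w z * -Real.log (R z) := by
    simp only [Finset.mul_sum, Finset.sum_mul]
    rw [Finset.sum_comm]
    exact Finset.sum_congr rfl fun w _ => Finset.sum_congr rfl fun z _ => by ring
  rw [codebookLeakage]
  refine (sub_le_sub_right (h1.trans_eq h2) _).trans ?_
  rw [← mul_sub, ← Finset.sum_sub_distrib]
  refine mul_le_mul_of_nonneg_left (Finset.sum_le_sum fun w _ => ?_) (by positivity)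
  simp only [leakageTerm]
  rw [Finset.sum_comm, Finset.mul_sum, shannon, ← Finset.sum_sub_distrib]
  refine Finset.sum_le_sum fun z _ => ?_
  -- the log-sum inequality at a fixed output `z`
  set P := outLaw K v w z with hP
  set k : A → ℝ := fun a => K (v (a, w)) z with hk
  have hk0 : ∀ a, 0 ≤ k a := fun a => (hK _).1 z
  have hPk : (Fintype.card A : ℝ) * P = ∑ a, k a := by
    rw [hP, outLaw, mul_inv_cancel_left₀ hA.ne']
  let T : B → ℝ := fun b => (∑ a ∈ cloud g b, k a) / (cloud g b).card
  have hT0 : ∀ b, 0 ≤ T b := fun b => div_nonneg (Finset.sum_nonneg fun a _ => hk0 a)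
    (by positivity)
  have hTpos : ∀ a, 0 < k a → 0 < T (g a) := fun a ha => by
    have hmem : a ∈ cloud g (g a) := by simp [cloud]
    have h1 : 0 < ∑ a' ∈ cloud g (g a), k a' :=
      ha.trans_le (Finset.single_le_sum (fun a _ => hk0 a) hmem)
    have h2 : (0 : ℝ) < (cloud g (g a)).card := by
      exact_mod_cast Finset.card_pos.2 ⟨a, hmem⟩
    exact div_pos h1 h2
  have hlogT : ∀ a, Real.log ((∑ a' ∈ cloud g (g a), k a')
      / ((cloud g (g a)).card * Q (c (g a)) z)) = Real.log (T (g a) / Q (c (g a)) z) := fun a => by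
    rw [div_mul_eq_div_div]
  rcases ((outLaw_mem hK v w).1 z).eq_or_lt with h0 | h0
  · have hz : ∀ a, k a = 0 := fun a => by
      have : ∑ a, k a = 0 := by rw [← hPk, hP, ← h0, mul_zero]
      exact (Finset.sum_eq_zero_iff_of_nonneg fun a _ => hk0 a).1 this a (Finset.mem_univ a)
    have : P = 0 := h0.symm
    rw [this]
    simp only [hk] at hz
    simp [hz]
  have hR0 := hRpos w z h0
  have hstep : ∀ a, k a * (Real.log P - Real.log (R z) + 1)
      ≤ k a * Real.log (T (g a) / Q (c (g a)) z)
        + k a * (P / R z * (Q (c (g a)) z / T (g a))) := by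
    intro a
    rcases (hk0 a).eq_or_lt with ha | ha
    · simp [← ha]
    rw [← mul_add]
    refine mul_le_mul_of_nonneg_left ?_ ha.le
    have hq := hQpos (a, w) z ha
    have ht := hTpos a ha
    have := Real.log_le_sub_one_of_pos (mul_pos (div_pos h0 hR0) (div_pos hq ht))
    rw [Real.log_mul (div_pos h0 hR0).ne' (div_pos hq ht).ne', Real.log_div h0.ne' hR0.ne',
      Real.log_div hq.ne' ht.ne'] at this
    rw [Real.log_div ht.ne' hq.ne']
    linarith
  have hcross : ∑ a, k a * (P / R z * (Q (c (g a)) z / T (g a)))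
      ≤ Fintype.card A * P := by
    rw [sum_mul_cloud_average g k (fun b => P / R z * (Q (c b) z / T b))]
    calc _ ≤ ∑ a, P / R z * Q (c (g a)) z := Finset.sum_le_sum fun a _ => by
          change T (g a) * (P / R z * (Q (c (g a)) z / T (g a))) ≤ _
          rcases (hT0 (g a)).eq_or_lt with h | h
          · rw [← h, zero_mul]
            exact mul_nonneg (div_pos h0 hR0).le ((hQm _).1 z)
          · exact le_of_eq (by field_simp)
      _ = P / R z * (Fintype.card A * R z) := by
          rw [← Finset.mul_sum, hR]
          simp only
          rw [mul_inv_cancel_left₀ hA.ne']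
      _ = _ := by field_simp
  have hfin := Finset.sum_le_sum fun a (_ : a ∈ Finset.univ) => hstep a
  rw [← Finset.sum_mul, ← hPk, Finset.sum_add_distrib] at hfin
  have hgoal : ∑ a, K (v (a, w)) z * Real.log ((∑ a' ∈ cloud g (g a), K (v (a', w)) z)
      / ((cloud g (g a)).card * Q (c (g a)) z))
      = ∑ a, k a * Real.log (T (g a) / Q (c (g a)) z) :=
    Finset.sum_congr rfl fun a _ => by rw [← hlogT a]
  rw [hgoal, le_inv_mul_iff₀ hA, Real.negMulLog]
  linarith

end Leakage

section OneShot

variable {U V Y Z A S B : Type*} [Fintype U] [Fintype V] [Fintype Y] [Fintype Z]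
  [Fintype A] [Fintype S] [Fintype B]

/-- The average probability that the decoder misses the transmitted codeword. -/
def codebookError {V Y J : Type*} [Fintype Y] [Fintype J] (K : V → Y → ℝ) (v : J → V)
    (dec : Y → J) : ℝ :=
  (Fintype.card J : ℝ)⁻¹ * ∑ j, ∑ y, K (v j) y * (if dec y = j then 0 else 1)

/-- **One-shot coding theorem**: some codebook has error probability and leakage bounded by the
sum of the three tilted moments. -/
theorem exists_codebook [Nonempty A] [Nonempty S] {pU : U → ℝ} {pV : U → V → ℝ}
    (hU : pU ∈ stdSimplex ℝ U) (hV : ∀ u, pV u ∈ stdSimplex ℝ V) {KY : V → Y → ℝ}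
    (hKY : ∀ v, KY v ∈ stdSimplex ℝ Y) {KZ : V → Z → ℝ} (hKZ : ∀ v, KZ v ∈ stdSimplex ℝ Z)
    {γ₁ γ₂ L s₁ s₂ s₃ : ℝ} (hγ₁ : 0 < γ₁) (hγ₂ : 0 < γ₂) (hL : 0 < L) (hs₁ : 0 < s₁)
    (hs₁' : s₁ ≤ 1) (hs₂ : 0 < s₂) (hs₂' : s₂ ≤ 1) (hs₃ : 0 < s₃) (hs₃' : s₃ ≤ 1) (g : A → B)
    (hN₁ : ∀ a, ((cloud g (g a)).card * Fintype.card S : ℝ) ≤ γ₁)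
    (hN₂ : (Fintype.card A * Fintype.card S : ℝ) ≤ γ₂)
    (hN₃ : ∀ a, L ≤ (cloud g (g a)).card) :
    ∃ (v : A × S → V) (dec : Y → A × S),
      codebookError KY v dec + codebookLeakage KZ v
      ≤ 2 * tilted pU pV KY (fun u => push (pV u) KY) γ₁ s₁
        + 2 * tilted pU pV KY (fun _ => push pU fun u => push (pV u) KY) γ₂ s₂
        + (∑ u, pU u * ∑ v, pV u v * ∑ z, KZ v z *
            (KZ v z / (L * push (pV u) KZ z)) ^ s₃) / s₃ := by
  set bound := 2 * tilted pU pV KY (fun u => push (pV u) KY) γ₁ s₁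
        + 2 * tilted pU pV KY (fun _ => push pU fun u => push (pV u) KY) γ₂ s₂
        + (∑ u, pU u * ∑ v, pV u v * ∑ z, KZ v z * (KZ v z / (L * push (pV u) KZ z)) ^ s₃) / s₃
  let F : A × S → (B → U) → (A × S → V) → ℝ := fun j c v =>
    errorTerm KY (fun u => push (pV u) KY) (push pU fun u => push (pV u) KY) γ₁ γ₂ g j c v
      + leakageTerm KZ (fun u => push (pV u) KZ) g j c v
  have hF : ∀ j, codebookE pU pV g (F j) ≤ bound := fun j => by
    rw [codebookE_add]
    exact add_le_add (codebookE_errorTerm_le hU hV hKY hγ₁ hγ₂ hs₁ hs₁' hs₂ hs₂' g j (hN₁ _) hN₂)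
      (codebookE_leakageTerm_le hU hV hKZ hL hs₃ hs₃' g j (hN₃ _))
  have hJ : (0 : ℝ) < Fintype.card (A × S) := by exact_mod_cast Fintype.card_pos
  have hE : codebookE pU pV g (fun c v => (Fintype.card (A × S) : ℝ)⁻¹ * ∑ j, F j c v) ≤ bound := by
    rw [codebookE_const_mul, codebookE_sum, inv_mul_le_iff₀ hJ]
    refine (Finset.sum_le_sum fun j _ => hF j).trans_eq ?_
    rw [Finset.sum_const, Finset.card_univ, nsmul_eq_mul]
  obtain ⟨c, v, hv, hcv⟩ := exists_le_codebookE hU hV g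
    (fun c v => (Fintype.card (A × S) : ℝ)⁻¹ * ∑ j : A × S, F j c v)
  obtain ⟨dec, hdec⟩ := exists_decoder hKY (fun u => push (pV u) KY)
    (push pU fun u => push (pV u) KY) γ₁ γ₂ g c v
  refine ⟨v, dec, le_trans ?_ (hcv.trans hE)⟩
  simp only [F, Finset.sum_add_distrib, mul_add]
  refine add_le_add (mul_le_mul_of_nonneg_left (Finset.sum_le_sum fun j _ => ?_)
    (by positivity)) ((codebookLeakage_le hKZ hV g c v hv).trans_eq ?_)
  · refine le_trans (le_of_eq (Finset.sum_congr rfl fun y _ => ?_)) (hdec j)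
    by_cases h : dec y = j <;> simp [h]
  rw [Fintype.sum_prod_type_right, Fintype.card_prod, Nat.cast_mul, mul_inv, mul_comm
    (Fintype.card A : ℝ)⁻¹, mul_assoc]
  simp only [Finset.mul_sum]

end OneShot

/-! ### Exponents for memoryless channels -/

section Exponents

variable {U V Y : Type*} [Fintype U] [Fintype V] [Fintype Y]

/-- The `n`-fold memoryless extension of a kernel. -/
def kernelPow (n : ℕ) (K : V → Y → ℝ) (v : Fin n → V) (y : Fin n → Y) : ℝ := ∏ i, K (v i) (y i)

theorem kernelPow_mem {V : Type*} {n : ℕ} {K : V → Y → ℝ} (hK : ∀ v, K v ∈ stdSimplex ℝ Y)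
    (v : Fin n → V) : kernelPow n K v ∈ stdSimplex ℝ (Fin n → Y) :=
  prod_mem_stdSimplex fun i => hK (v i)

theorem push_kernelPow {Y : Type*} {n : ℕ} (P : Fin n → V → ℝ) (K : V → Y → ℝ) (y : Fin n → Y) :
    push (fun v : Fin n → V => ∏ i, P i (v i)) (kernelPow n K) y = ∏ i, push (P i) K (y i) := by
  simp only [push, kernelPow, ← Finset.prod_mul_distrib]
  exact sum_prod_pi (fun i v => P i v * K v (y i))

/-- The moment `E[ρ ^ s]` under the law `pU u * pV u v * K v y`. -/
def moment (pU : U → ℝ) (pV : U → V → ℝ) (K : V → Y → ℝ) (ρ : U → V → Y → ℝ) (s : ℝ) : ℝ :=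
  ∑ u, pU u * ∑ v, pV u v * ∑ y, K v y * ρ u v y ^ s

theorem moment_kernelPow {n : ℕ} {pU : U → ℝ} {pV : U → V → ℝ} {K : V → Y → ℝ}
    {ρ : U → V → Y → ℝ} (hρ : ∀ u v y, 0 ≤ ρ u v y) {γ : ℝ} (hγ : 0 ≤ γ) (s : ℝ) :
    moment (fun u : Fin n → U => ∏ i, pU (u i)) (kernelPow n pV) (kernelPow n K)
      (fun u v y => γ * ∏ i, ρ (u i) (v i) (y i)) s = γ ^ s * moment pU pV K ρ s ^ n := by
  have h1 : ∀ (u : Fin n → U) (v : Fin n → V),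
      ∑ y, kernelPow n K v y * (γ * ∏ i, ρ (u i) (v i) (y i)) ^ s
        = γ ^ s * ∏ i, ∑ y, K (v i) y * ρ (u i) (v i) y ^ s := by
    intro u v
    rw [← sum_prod_pi, Finset.mul_sum]
    refine Finset.sum_congr rfl fun y _ => ?_
    rw [Real.mul_rpow hγ (Finset.prod_nonneg fun i _ => hρ _ _ _),
      ← Real.finsetProd_rpow _ _ fun i _ => hρ _ _ _, Finset.prod_mul_distrib, kernelPow]
    ring
  have h2 : ∀ u : Fin n → U, ∑ v, kernelPow n pV u v *
      (γ ^ s * ∏ i, ∑ y, K (v i) y * ρ (u i) (v i) y ^ s)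
        = γ ^ s * ∏ i, ∑ v, pV (u i) v * ∑ y, K v y * ρ (u i) v y ^ s := by
    intro u
    rw [← sum_prod_pi, Finset.mul_sum]
    refine Finset.sum_congr rfl fun v _ => ?_
    rw [Finset.prod_mul_distrib, kernelPow]
    ring
  simp only [moment, h1, h2]
  rw [← Fin.prod_const n (∑ u, pU u * ∑ v, pV u v * ∑ y, K v y * ρ u v y ^ s), ← sum_prod_pi,
    Finset.mul_sum]
  refine Finset.sum_congr rfl fun u _ => ?_
  rw [Finset.prod_mul_distrib]
  ring

theorem moment_nonneg {pU : U → ℝ} (hU : pU ∈ stdSimplex ℝ U) {pV : U → V → ℝ}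
    (hV : ∀ u, pV u ∈ stdSimplex ℝ V) {K : V → Y → ℝ} (hK : ∀ v y, 0 ≤ K v y)
    {ρ : U → V → Y → ℝ} (hρ : ∀ u v y, 0 ≤ ρ u v y) (s : ℝ) : 0 ≤ moment pU pV K ρ s :=
  Finset.sum_nonneg fun u _ => mul_nonneg (hU.1 u) <| Finset.sum_nonneg fun v _ =>
    mul_nonneg ((hV u).1 v) <| Finset.sum_nonneg fun y _ => mul_nonneg (hK v y)
      (Real.rpow_nonneg (hρ u v y) _)

/-- A **Chernoff bound**: if `E[log ρ] + t < 0`, some small power has `exp (s t) E[ρ ^ s] < 1`,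
because this function of `s` has value `1` and negative derivative at `0`. -/
theorem exists_moment_lt_one {pU : U → ℝ} (hU : pU ∈ stdSimplex ℝ U) {pV : U → V → ℝ}
    (hV : ∀ u, pV u ∈ stdSimplex ℝ V) {K : V → Y → ℝ} (hK : ∀ v, K v ∈ stdSimplex ℝ Y)
    {ρ : U → V → Y → ℝ} (hρ : ∀ u v y, 0 < pU u → 0 < pV u v → 0 < K v y → 0 < ρ u v y) {t : ℝ}
    (ht : ∑ u, pU u * ∑ v, pV u v * ∑ y, K v y * Real.log (ρ u v y) + t < 0) :
    ∃ s, 0 < s ∧ s ≤ 1 ∧ Real.exp (s * t) * moment pU pV K ρ s < 1 := by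
  let φ : ℝ → ℝ := fun s => ∑ u, pU u * ∑ v, pV u v * ∑ y, K v y *
    Real.exp (s * (Real.log (ρ u v y) + t))
  have hone : ∀ r : ℝ, ∑ u, pU u * ∑ v, pV u v * ∑ y, K v y * r = r := fun r => by
    simp only [← Finset.sum_mul, (hK _).2, (hV _).2, hU.2, one_mul]
  have hφ0 : φ 0 = 1 := by simpa [φ] using hone 1
  have hderiv : HasDerivAt φ (∑ u, pU u * ∑ v, pV u v * ∑ y, K v y *
      (Real.log (ρ u v y) + t)) 0 := by
    refine HasDerivAt.fun_sum fun u _ => HasDerivAt.const_mul _ <| HasDerivAt.fun_sum fun v _ =>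
      HasDerivAt.const_mul _ <| HasDerivAt.fun_sum fun y _ => HasDerivAt.const_mul _ ?_
    have := ((hasDerivAt_id (0 : ℝ)).mul_const (Real.log (ρ u v y) + t)).exp
    simpa using this
  have hneg : ∑ u, pU u * ∑ v, pV u v * ∑ y, K v y * (Real.log (ρ u v y) + t) < 0 := by
    simp only [mul_add, Finset.sum_add_distrib]
    have := hone t
    simp only [Finset.mul_sum] at this ht ⊢
    linarith
  have hev : ∀ᶠ s in 𝓝[>] (0 : ℝ), slope φ 0 s < 0 :=
    ((hasDerivAt_iff_tendsto_slope.1 hderiv).eventually (gt_mem_nhds hneg)).filter_mono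
      (nhdsWithin_mono _ fun x hx => (ne_of_gt hx))
  obtain ⟨s, hs, hs01⟩ := (hev.and (Ioo_mem_nhdsGT (show (0 : ℝ) < 1 by norm_num))).exists
  refine ⟨s, hs01.1, hs01.2.le, ?_⟩
  have hlt : φ s < 1 := by
    rw [slope_def_field, hφ0, sub_zero] at hs
    have := (div_neg_iff.1 hs)
    rcases this with h | h
    · linarith [h.2, hs01.1]
    · linarith [h.1]
  refine lt_of_eq_of_lt ?_ hlt
  simp only [moment, φ, Finset.mul_sum]
  refine Finset.sum_congr rfl fun u _ => Finset.sum_congr rfl fun v _ =>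
    Finset.sum_congr rfl fun y _ => ?_
  rcases (hU.1 u).eq_or_lt with h1 | h1
  · simp [← h1]
  rcases ((hV u).1 v).eq_or_lt with h2 | h2
  · simp [← h2]
  rcases ((hK v).1 y).eq_or_lt with h3 | h3
  · simp [← h3]
  rw [mul_add, Real.exp_add, Real.rpow_def_of_pos (hρ u v y h1 h2 h3), mul_comm s (Real.log _)]
  ring

/-- Conditioning lowers entropy: `H(Y|V) ≤ H(Y)`. -/
theorem sum_mul_shannon_le_shannon_push {P : V → ℝ} (hP : P ∈ stdSimplex ℝ V) {K : V → Y → ℝ}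
    (hK : ∀ v, K v ∈ stdSimplex ℝ Y) : ∑ v, P v * shannon (K v) ≤ shannon (push P K) := by
  have h := concaveOn_shannon.le_map_sum (t := Finset.univ) (w := P) (p := K)
    (fun v _ => hP.1 v) hP.2 (fun v _ => (hK v).1)
  have e : ∑ v, P v • K v = push P K := by
    funext y
    simp [push]
  rw [e] at h
  simpa using h

/-- `I(V;Y|U)` in nats, for the law `pU u * pV u v * K v y`. -/
def condInfo (pU : U → ℝ) (pV : U → V → ℝ) (K : V → Y → ℝ) : ℝ :=
  ∑ u, pU u * shannon (push (pV u) K) - ∑ u, ∑ v, pU u * pV u v * shannon (K v)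

/-- `I(V;Y)` in nats, for the law `pU u * pV u v * K v y`. -/
def totalInfo (pU : U → ℝ) (pV : U → V → ℝ) (K : V → Y → ℝ) : ℝ :=
  shannon (push pU fun u => push (pV u) K) - ∑ u, ∑ v, pU u * pV u v * shannon (K v)

variable {pU : U → ℝ} {pV : U → V → ℝ} {K : V → Y → ℝ}

theorem condInfo_nonneg (hU : pU ∈ stdSimplex ℝ U) (hV : ∀ u, pV u ∈ stdSimplex ℝ V)
    (hK : ∀ v, K v ∈ stdSimplex ℝ Y) : 0 ≤ condInfo pU pV K := by
  rw [condInfo, ← Finset.sum_sub_distrib]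
  refine Finset.sum_nonneg fun u _ => ?_
  have := mul_le_mul_of_nonneg_left (sum_mul_shannon_le_shannon_push (hV u) hK) (hU.1 u)
  simp only [Finset.mul_sum, ← mul_assoc] at this
  linarith

theorem condInfo_le_totalInfo (hU : pU ∈ stdSimplex ℝ U) (hV : ∀ u, pV u ∈ stdSimplex ℝ V)
    (hK : ∀ v, K v ∈ stdSimplex ℝ Y) : condInfo pU pV K ≤ totalInfo pU pV K :=
  sub_le_sub_right (sum_mul_shannon_le_shannon_push hU fun u => push_mem (hV u) hK) _

theorem sum_log_ratio {R : U → Y → ℝ} (hU : pU ∈ stdSimplex ℝ U)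
    (hV : ∀ u, pV u ∈ stdSimplex ℝ V) (hK : ∀ v, K v ∈ stdSimplex ℝ Y)
    (hR : ∀ u v y, 0 < pU u → 0 < pV u v → 0 < K v y → 0 < R u y) :
    ∑ u, pU u * ∑ v, pV u v * ∑ y, K v y * Real.log (R u y / K v y)
      = ∑ u, pU u * ∑ y, push (pV u) K y * Real.log (R u y)
        + ∑ u, ∑ v, pU u * pV u v * shannon (K v) := by
  rw [← Finset.sum_add_distrib]
  refine Finset.sum_congr rfl fun u _ => ?_
  simp only [push, Finset.sum_mul]
  rw [Finset.sum_comm, Finset.mul_sum, Finset.mul_sum, ← Finset.sum_add_distrib]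
  refine Finset.sum_congr rfl fun v _ => ?_
  rw [shannon, Finset.mul_sum, Finset.mul_sum, Finset.mul_sum, Finset.mul_sum,
    ← Finset.sum_add_distrib]
  refine Finset.sum_congr rfl fun y _ => ?_
  rcases (hU.1 u).eq_or_lt with h1 | h1
  · simp [← h1]
  rcases ((hV u).1 v).eq_or_lt with h2 | h2
  · simp [← h2]
  rcases ((hK v).1 y).eq_or_lt with h3 | h3
  · simp [← h3]
  rw [Real.log_div (hR u v y h1 h2 h3).ne' h3.ne', Real.negMulLog]
  ring

theorem push_pos {U : Type*} {pV : U → V → ℝ} (hV : ∀ u, pV u ∈ stdSimplex ℝ V)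
    (hK : ∀ v, K v ∈ stdSimplex ℝ Y) {u : U} {v : V}
    {y : Y} (h2 : 0 < pV u v) (h3 : 0 < K v y) : 0 < push (pV u) K y :=
  (mul_pos h2 h3).trans_le (Finset.single_le_sum (f := fun v => pV u v * K v y)
    (fun v _ => mul_nonneg ((hV u).1 v) ((hK v).1 y)) (Finset.mem_univ v))

theorem sum_log_cond_ratio (hU : pU ∈ stdSimplex ℝ U) (hV : ∀ u, pV u ∈ stdSimplex ℝ V)
    (hK : ∀ v, K v ∈ stdSimplex ℝ Y) :
    ∑ u, pU u * ∑ v, pV u v * ∑ y, K v y * Real.log (push (pV u) K y / K v y)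
      = -condInfo pU pV K := by
  rw [sum_log_ratio hU hV hK fun u v y _ h2 h3 => push_pos hV hK h2 h3, condInfo, neg_sub,
    sub_eq_add_neg, add_comm, ← Finset.sum_neg_distrib]
  congr 1
  refine Finset.sum_congr rfl fun u _ => ?_
  simp only [shannon, Real.negMulLog, ← mul_neg, ← Finset.sum_neg_distrib, neg_mul, neg_neg]

theorem sum_log_total_ratio (hU : pU ∈ stdSimplex ℝ U) (hV : ∀ u, pV u ∈ stdSimplex ℝ V)
    (hK : ∀ v, K v ∈ stdSimplex ℝ Y) :
    ∑ u, pU u * ∑ v, pV u v * ∑ y, K v y *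
      Real.log (push pU (fun u => push (pV u) K) y / K v y) = -totalInfo pU pV K := by
  rw [sum_log_ratio (R := fun _ => push pU fun u => push (pV u) K) hU hV hK
    fun u v y h1 h2 h3 => push_pos (pV := fun _ : Unit => pU) (u := ()) (fun _ => hU)
      (fun u => push_mem (hV u) hK) h1 (push_pos hV hK h2 h3), totalInfo, neg_sub,
    sub_eq_add_neg, add_comm]
  congr 1
  simp only [shannon, Real.negMulLog, ← Finset.sum_neg_distrib, neg_mul, neg_neg]
  simp only [Finset.mul_sum]
  rw [Finset.sum_comm]
  refine Finset.sum_congr rfl fun y _ => ?_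
  change _ = (∑ u, pU u * push (pV u) K y) * Real.log (push pU (fun u => push (pV u) K) y)
  rw [Finset.sum_mul]
  exact Finset.sum_congr rfl fun u _ => by ring

end Exponents

/-! ### Codebooks of growing block length -/

section Sequences

theorem card_filter_mod {M m : ℕ} (hm : 0 < m) (b : ℕ) :
    M / m ≤ (Finset.univ.filter fun i : Fin M => i.val % m = b % m).card ∧
      (Finset.univ.filter fun i : Fin M => i.val % m = b % m).card ≤ M / m + 1 := by
  have h := Nat.count_modEq_card (b := M) hm b
  have e : (Finset.univ.filter fun i : Fin M => i.val % m = b % m).card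
      = Nat.count (· ≡ b [MOD m]) M := by
    rw [Nat.count_eq_card_filter_range]
    refine Finset.card_bij (fun i _ => i.val) (fun i hi => ?_) (fun i _ j _ h => Fin.ext h)
      fun x hx => ?_
    · rw [Finset.mem_filter] at hi
      rw [Finset.mem_filter, Finset.mem_range]
      exact ⟨i.isLt, hi.2⟩
    · rw [Finset.mem_filter, Finset.mem_range] at hx
      exact ⟨⟨x, hx.1⟩, by simpa [Nat.ModEq] using hx.2, rfl⟩
  rw [e, h]
  split_ifs <;> omega

theorem tilted_kernelPow {U V Y : Type*} [Fintype U] [Fintype V] [Fintype Y] {n : ℕ} {pU : U → ℝ}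
    {pV : U → V → ℝ} {K : V → Y → ℝ} (hK : ∀ v, K v ∈ stdSimplex ℝ Y) {R : U → Y → ℝ}
    (hR : ∀ u y, 0 ≤ R u y) {γ : ℝ} (hγ : 0 ≤ γ) (s : ℝ) :
    tilted (fun u : Fin n → U => ∏ i, pU (u i)) (kernelPow n pV) (kernelPow n K)
      (fun u y => ∏ i, R (u i) (y i)) γ s
      = γ ^ s * moment pU pV K (fun u v y => R u y / K v y) s ^ n := by
  rw [← moment_kernelPow (fun u v y => div_nonneg (hR u y) ((hK v).1 y)) hγ]
  simp only [tilted, moment, kernelPow, Finset.prod_div_distrib, mul_div_assoc]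

/-- `M` messages and a local index of size `D` are split over `m` clouds by the residue of the
message, so that the size of each cloud is within constant factors of `exp (n r)`. Either `D` is
about `exp (n (r - ρ))` and there are few clouds, or `m` is about `exp (n (ρ - r))` and `D` is
bounded. -/
theorem exists_clouds {ρ r : ℝ} (hr : 0 ≤ r) (n : ℕ) {M : ℕ}
    (hM : Real.exp (n * ρ) ≤ M) (hM' : (M : ℝ) ≤ 2 * Real.exp (n * ρ)) :
    ∃ (D m : ℕ) (g : Fin M × Fin D → Fin m), 0 < D ∧
      (∀ a, Real.exp (n * r) / 4 ≤ (cloud g (g a)).card) ∧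
      (∀ a, ((cloud g (g a)).card : ℝ) ≤ 8 * Real.exp (n * r)) ∧
      ((M : ℝ) * D ≤ 4 * Real.exp (n * max ρ r)) := by
  have hceil : ∀ x : ℝ, 1 ≤ x → (⌈x⌉₊ : ℝ) ≤ 2 * x := fun x hx => by
    have := Nat.ceil_lt_add_one (show 0 ≤ x by linarith)
    linarith
  have hn : (0 : ℝ) ≤ n := Nat.cast_nonneg n
  set xd := Real.exp (n * max (r - ρ) 0) with hxd
  set xm := Real.exp (n * max (ρ - r) 0) with hxm
  set D := ⌈xd⌉₊ with hD
  set m := ⌈xm⌉₊ with hm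
  have hxd1 : 1 ≤ xd := Real.one_le_exp (mul_nonneg hn (le_max_right _ _))
  have hxm1 : 1 ≤ xm := Real.one_le_exp (mul_nonneg hn (le_max_right _ _))
  have hD1 : xd ≤ D := Nat.le_ceil _
  have hD2 : (D : ℝ) ≤ 2 * xd := hceil _ hxd1
  have hm1 : xm ≤ m := Nat.le_ceil _
  have hm2 : (m : ℝ) ≤ 2 * xm := hceil _ hxm1
  have hD0 : 0 < D := by
    have : (0 : ℝ) < D := by linarith
    exact_mod_cast this
  have hm0 : 0 < m := by
    have : (0 : ℝ) < m := by linarith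
    exact_mod_cast this
  have hM0 : 0 < M := by
    have : (0 : ℝ) < M := (Real.exp_pos _).trans_le hM
    exact_mod_cast this
  have hmul : Real.exp (n * ρ) * xd = Real.exp (n * r) * xm := by
    rw [hxd, hxm, ← Real.exp_add, ← Real.exp_add]
    congr 1
    rcases le_total ρ r with h | h
    · rw [max_eq_left (by linarith), max_eq_right (by linarith)]; ring
    · rw [max_eq_right (by linarith), max_eq_left (by linarith)]; ring
  have hmulmax : Real.exp (n * ρ) * xd = Real.exp (n * max ρ r) := by
    rw [hxd, ← Real.exp_add]
    congr 1
    rcases le_total ρ r with h | h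
    · rw [max_eq_left (by linarith), max_eq_right h]; ring
    · rw [max_eq_right (by linarith), max_eq_left h]; ring
  have hmM : m ≤ M := by
    refine Nat.ceil_le.2 ?_
    rcases le_total ρ r with h | h
    · rw [hxm, max_eq_right (by linarith), mul_zero, Real.exp_zero]
      exact_mod_cast hM0
    · refine le_trans (Real.exp_le_exp.2 ?_) hM
      rw [max_eq_left (by linarith)]
      exact mul_le_mul_of_nonneg_left (by linarith) hn
  have hq1 : 1 ≤ M / m := (Nat.one_le_div_iff hm0).2 hmM
  set q := M / m with hq
  have hMr : (M : ℝ) ≤ 2 * (q * m) := by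
    have h1 : M < m * (q + 1) := Nat.lt_mul_div_succ M hm0
    have h2 : M ≤ 2 * (q * m) := by nlinarith
    exact_mod_cast h2
  have hMr' : (q : ℝ) * m ≤ M := by exact_mod_cast Nat.div_mul_le_self M m
  let g : Fin M × Fin D → Fin m := fun a => ⟨a.1.val % m, Nat.mod_lt _ hm0⟩
  have hcard : ∀ a, q * D ≤ (cloud g (g a)).card ∧ (cloud g (g a)).card ≤ 2 * q * D := by
    intro a
    have e : cloud g (g a) = (Finset.univ.filter fun i : Fin M => i.val % m = a.1.val % m) ×ˢ
        (Finset.univ : Finset (Fin D)) := by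
      ext b
      simp [cloud, g]
    rw [e, Finset.card_product, Finset.card_univ, Fintype.card_fin]
    obtain ⟨h1, h2⟩ := card_filter_mod (M := M) hm0 a.1.val
    exact ⟨Nat.mul_le_mul_right _ h1, Nat.mul_le_mul_right _ (h2.trans (by omega))⟩
  have he := Real.exp_pos (n * ρ)
  have hqx : (0 : ℝ) ≤ q := Nat.cast_nonneg q
  refine ⟨D, m, g, hD0, fun a => ?_, fun a => ?_, ?_⟩
  · have h1 : ((q * D : ℕ) : ℝ) ≤ (cloud g (g a)).card := by exact_mod_cast (hcard a).1
    refine le_trans ?_ h1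
    push_cast
    have h2 : Real.exp (n * r) * xm ≤ (4 * (q * D)) * xm := by
      calc _ = Real.exp (n * ρ) * xd := hmul.symm
        _ ≤ (2 * (q * m)) * D := mul_le_mul (hM.trans hMr) hD1 (by linarith) (by positivity)
        _ ≤ (2 * (q * (2 * xm))) * D := by gcongr
        _ = _ := by ring
    have h3 := le_of_mul_le_mul_right h2 (by linarith)
    linarith
  · have h1 : ((cloud g (g a)).card : ℝ) ≤ (2 * q * D : ℕ) := by exact_mod_cast (hcard a).2
    refine h1.trans ?_
    push_cast
    have h2 : (2 * q * D) * xm ≤ 8 * Real.exp (n * r) * xm := by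
      calc (2 * q * D) * xm ≤ (2 * q * (2 * xd)) * m := by gcongr
        _ = 4 * (q * m) * xd := by ring
        _ ≤ 4 * (2 * Real.exp (n * ρ)) * xd := by
          have := hMr'.trans hM'
          gcongr
        _ = 8 * (Real.exp (n * ρ) * xd) := by ring
        _ = _ := by rw [hmul]; ring
    exact le_of_mul_le_mul_right h2 (by linarith)
  · calc (M : ℝ) * D ≤ (2 * Real.exp (n * ρ)) * (2 * xd) :=
        mul_le_mul hM' hD2 (by positivity) (by positivity)
      _ = 4 * (Real.exp (n * ρ) * xd) := by ring
      _ = _ := by rw [hmulmax]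

/-- Below the information bounds there are superposition codebooks with vanishing error and
leakage. The rate `r` of a cloud is chosen just above `I(V;Z|U)`. -/
theorem exists_codebooks {U V Y Z : Type*} [Fintype U] [Fintype V] [Fintype Y] [Fintype Z]
    {pU : U → ℝ} {pV : U → V → ℝ} (hU : pU ∈ stdSimplex ℝ U) (hV : ∀ u, pV u ∈ stdSimplex ℝ V)
    {KY : V → Y → ℝ} (hKY : ∀ v, KY v ∈ stdSimplex ℝ Y) {KZ : V → Z → ℝ}
    (hKZ : ∀ v, KZ v ∈ stdSimplex ℝ Z) {ρp ρs : ℝ}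
    (h1 : ρs < condInfo pU pV KY - condInfo pU pV KZ) (h2 : ρs + ρp < totalInfo pU pV KY)
    {Mp Ms : ℕ → ℕ} (hMp : ∀ n : ℕ, Real.exp (n * ρp) ≤ Mp n)
    (hMp' : ∀ n : ℕ, (Mp n : ℝ) ≤ 2 * Real.exp (n * ρp)) (hMs : ∀ n, 0 < Ms n)
    (hMs' : ∀ n : ℕ, (Ms n : ℝ) ≤ 2 * Real.exp (n * ρs)) :
    ∃ ε : ℕ → ℝ, Tendsto ε atTop (𝓝 0) ∧ ∀ n, ∃ D : ℕ, 0 < D ∧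
      ∃ (v : (Fin (Mp n) × Fin D) × Fin (Ms n) → Fin n → V)
        (dec : (Fin n → Y) → (Fin (Mp n) × Fin D) × Fin (Ms n)),
        codebookError (kernelPow n KY) v dec + codebookLeakage (kernelPow n KZ) v ≤ ε n := by
  obtain ⟨r, hr1, hr2⟩ := exists_between
    (show condInfo pU pV KZ < condInfo pU pV KY - ρs by linarith)
  have hr0 : 0 ≤ r := (condInfo_nonneg hU hV hKZ).trans hr1.le
  set QY : U → Y → ℝ := fun u => push (pV u) KY with hQY
  set qY : Y → ℝ := push pU QY with hqY
  set QZ : U → Z → ℝ := fun u => push (pV u) KZ with hQZ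
  have hQYm : ∀ u, QY u ∈ stdSimplex ℝ Y := fun u => push_mem (hV u) hKY
  have hqYm : qY ∈ stdSimplex ℝ Y := push_mem hU hQYm
  have hQZm : ∀ u, QZ u ∈ stdSimplex ℝ Z := fun u => push_mem (hV u) hKZ
  obtain ⟨s₁, hs₁, hs₁', hlt₁⟩ := exists_moment_lt_one hU hV hKY
    (ρ := fun u v y => QY u y / KY v y) (t := r + ρs)
    (fun u v y _ b c => div_pos (push_pos hV hKY b c) c) (by
      rw [sum_log_cond_ratio hU hV hKY]; linarith)
  obtain ⟨s₂, hs₂, hs₂', hlt₂⟩ := exists_moment_lt_one hU hV hKY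
    (ρ := fun u v y => qY y / KY v y) (t := max ρp r + ρs)
    (fun u v y a b c => div_pos (push_pos (pV := fun _ : Unit => pU) (u := ()) (fun _ => hU)
      hQYm a (push_pos hV hKY b c)) c) (by
      rw [sum_log_total_ratio hU hV hKY]
      have := condInfo_le_totalInfo hU hV hKY
      rcases max_cases ρp r with h | h <;> linarith)
  obtain ⟨s₃, hs₃, hs₃', hlt₃⟩ := exists_moment_lt_one hU hV hKZ
    (ρ := fun u v z => KZ v z / QZ u z) (t := -r)
    (fun u v y _ b c => div_pos c (push_pos hV hKZ b c)) (by
      have : ∀ u v z, Real.log (KZ v z / QZ u z) = -Real.log (QZ u z / KZ v z) := fun u v z => by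
        rw [← Real.log_inv, inv_div]
      simp only [this, mul_neg, Finset.sum_neg_distrib]
      rw [sum_log_cond_ratio hU hV hKZ]; linarith)
  set m₁ := moment pU pV KY (fun u v y => QY u y / KY v y) s₁ with hm₁
  set m₂ := moment pU pV KY (fun u v y => qY y / KY v y) s₂ with hm₂
  set m₃ := moment pU pV KZ (fun u v z => KZ v z / QZ u z) s₃ with hm₃
  have hm₁0 : 0 ≤ m₁ := moment_nonneg hU hV (fun v => (hKY v).1)
    (fun u v y => div_nonneg ((hQYm u).1 y) ((hKY v).1 y)) s₁
  have hm₂0 : 0 ≤ m₂ := moment_nonneg hU hV (fun v => (hKY v).1)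
    (fun u v y => div_nonneg (hqYm.1 y) ((hKY v).1 y)) s₂
  have hm₃0 : 0 ≤ m₃ := moment_nonneg hU hV (fun v => (hKZ v).1)
    (fun u v z => div_nonneg ((hKZ v).1 z) ((hQZm u).1 z)) s₃
  have hpow : ∀ (n : ℕ) (C t s m : ℝ), 0 ≤ C →
      (C * Real.exp (n * t)) ^ s * m ^ n = C ^ s * (Real.exp (s * t) * m) ^ n := by
    intro n C t s m hC
    rw [Real.mul_rpow hC (Real.exp_pos _).le, ← Real.exp_mul, mul_pow, ← Real.exp_nat_mul,
      mul_assoc]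
    congr 3
    ring
  refine ⟨fun n => 2 * ((16 : ℝ) ^ s₁ * (Real.exp (s₁ * (r + ρs)) * m₁) ^ n)
    + 2 * ((8 : ℝ) ^ s₂ * (Real.exp (s₂ * (max ρp r + ρs)) * m₂) ^ n)
    + (4 : ℝ) ^ s₃ * (Real.exp (s₃ * -r) * m₃) ^ n / s₃, ?_, fun n => ?_⟩
  · have t1 := tendsto_pow_atTop_nhds_zero_of_lt_one
      (mul_nonneg (Real.exp_pos (s₁ * (r + ρs))).le hm₁0) hlt₁
    have t2 := tendsto_pow_atTop_nhds_zero_of_lt_one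
      (mul_nonneg (Real.exp_pos (s₂ * (max ρp r + ρs))).le hm₂0) hlt₂
    have t3 := tendsto_pow_atTop_nhds_zero_of_lt_one
      (mul_nonneg (Real.exp_pos (s₃ * -r)).le hm₃0) hlt₃
    have := (((t1.const_mul ((16 : ℝ) ^ s₁)).const_mul 2).add
      ((t2.const_mul ((8 : ℝ) ^ s₂)).const_mul 2)).add ((t3.const_mul ((4 : ℝ) ^ s₃)).div_const s₃)
    simpa using this
  obtain ⟨D, m, g, hD, hg1, hg2, hMD⟩ := exists_clouds hr0 n (hMp n) (hMp' n)
  have hMp0 : 0 < Mp n := by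
    have : (0 : ℝ) < Mp n := (Real.exp_pos _).trans_le (hMp n)
    exact_mod_cast this
  have : Nonempty (Fin (Mp n) × Fin D) := ⟨(⟨0, hMp0⟩, ⟨0, hD⟩)⟩
  have : Nonempty (Fin (Ms n)) := ⟨⟨0, hMs n⟩⟩
  have hexp : ∀ t : ℝ, 2 * Real.exp (n * ρs) * Real.exp (n * t) = 2 * Real.exp (n * (t + ρs)) :=
    fun t => by rw [mul_assoc, ← Real.exp_add]; ring_nf
  obtain ⟨v, dec, hvd⟩ := exists_codebook (S := Fin (Ms n))
    (prod_mem_stdSimplex fun _ : Fin n => hU)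
    (kernelPow_mem hV) (kernelPow_mem hKY) (kernelPow_mem hKZ)
    (γ₁ := 16 * Real.exp (n * (r + ρs))) (γ₂ := 8 * Real.exp (n * (max ρp r + ρs)))
    (L := Real.exp (n * r) / 4) (by positivity) (by positivity) (by positivity)
    hs₁ hs₁' hs₂ hs₂' hs₃ hs₃' g (fun a => by
      rw [Fintype.card_fin]
      calc _ ≤ (8 * Real.exp (n * r)) * (2 * Real.exp (n * ρs)) :=
            mul_le_mul (hg2 a) (hMs' n) (by positivity) (by positivity)
        _ = 8 * (2 * Real.exp (n * ρs) * Real.exp (n * r)) := by ring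
        _ = _ := by rw [hexp]; ring)
    (by
      rw [Fintype.card_prod, Fintype.card_fin, Fintype.card_fin, Fintype.card_fin, Nat.cast_mul]
      calc _ ≤ (4 * Real.exp (n * max ρp r)) * (2 * Real.exp (n * ρs)) :=
            mul_le_mul hMD (hMs' n) (by positivity) (by positivity)
        _ = 4 * (2 * Real.exp (n * ρs) * Real.exp (n * max ρp r)) := by ring
        _ = _ := by rw [hexp]; ring)
    hg1
  refine ⟨D, hD, v, dec, hvd.trans (le_of_eq ?_)⟩
  have eQY : (fun u : Fin n → U => push (kernelPow n pV u) (kernelPow n KY))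
      = fun u y => ∏ i, QY (u i) (y i) := by
    funext u y
    exact push_kernelPow (fun i => pV (u i)) KY y
  have eqY : push (fun u : Fin n → U => ∏ i, pU (u i))
        (fun u (y : Fin n → Y) => ∏ i, QY (u i) (y i))
      = fun y => ∏ i, qY (y i) := by
    funext y
    exact push_kernelPow (fun _ => pU) QY y
  have eQZ : (fun u : Fin n → U => push (kernelPow n pV u) (kernelPow n KZ))
      = fun u z => ∏ i, QZ (u i) (z i) := by
    funext u y
    exact push_kernelPow (fun i => pV (u i)) KZ y
  have e3 : ∑ u : Fin n → U, (∏ i, pU (u i)) * ∑ v, kernelPow n pV u v * ∑ z, kernelPow n KZ v z *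
      (kernelPow n KZ v z / (Real.exp (n * r) / 4 *
        push (kernelPow n pV u) (kernelPow n KZ) z)) ^ s₃
      = (4 * Real.exp (n * -r)) ^ s₃ * m₃ ^ n := by
    rw [hm₃, ← moment_kernelPow (fun u v z => div_nonneg ((hKZ v).1 z) ((hQZm u).1 z))
      (by positivity)]
    simp only [moment]
    refine Finset.sum_congr rfl fun u _ => ?_
    congr 1
    refine Finset.sum_congr rfl fun v _ => ?_
    congr 1
    refine Finset.sum_congr rfl fun z _ => ?_
    congr 2
    rw [congrFun (congrFun eQZ u) z, Finset.prod_div_distrib, mul_neg, Real.exp_neg, kernelPow]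
    simp only [div_eq_mul_inv, mul_inv, inv_inv]
    ring
  rw [e3, eQY, eqY, tilted_kernelPow hKY (fun u => (hQYm u).1) (by positivity),
    tilted_kernelPow hKY (R := fun _ => qY) (fun _ => hqYm.1) (by positivity), ← hm₁, ← hm₂,
    hpow _ _ _ _ _ (by norm_num), hpow _ _ _ _ _ (by norm_num), hpow _ _ _ _ _ (by norm_num)]

end Sequences

/-! ### From codebooks to codes -/

section Codes

variable {V X Y Z : Type*} [Fintype X] [Fintype Y] [Fintype Z]

/-- The law of `g` applied to independent coordinates. -/
theorem piE_map {ι σ T : Type*} [Fintype ι] [DecidableEq ι] [Fintype σ] [Fintype T]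
    (q : ι → σ → ℝ) (g : σ → T) (f : (ι → T) → ℝ) :
    piE q (fun t => f fun i => g (t i))
      = ∑ y : ι → T, (∏ i, ∑ s, if g s = y i then q i s else 0) * f y := by
  simp only [← sum_prod_pi, Finset.prod_ite_zero, Finset.sum_mul]
  rw [Finset.sum_comm, piE]
  refine Finset.sum_congr rfl fun t _ => ?_
  rw [Finset.sum_eq_single (fun i => g (t i))]
  · simp
  · intro y _ hy
    rw [if_neg, zero_mul]
    intro h
    exact hy (funext fun i => (h i (Finset.mem_univ i)).symm)
  · simp

/-- The code of a codebook `v`: the encoder draws an index `d` uniformly, passes the codeword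
`v ((wp, d), ws)` letter by letter through the prefix channel `pX`, and the decoder drops `d`. -/
def codebookCode {n Mp Ms D : ℕ} (hD : 0 < D) {pX : V → X → ℝ} (hX : ∀ v, pX v ∈ stdSimplex ℝ X)
    (v : (Fin Mp × Fin D) × Fin Ms → Fin n → V)
    (dec : (Fin n → Y) → (Fin Mp × Fin D) × Fin Ms) : Code X Y n Mp Ms where
  enc w x := (D : ℝ)⁻¹ * ∑ d, kernelPow n pX (v ((w.1, d), w.2)) x
  enc_mem w := by
    refine ⟨fun x => mul_nonneg (by positivity)
      (Finset.sum_nonneg fun d _ => (kernelPow_mem hX _).1 x), ?_⟩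
    rw [← Finset.mul_sum, Finset.sum_comm]
    simp only [(kernelPow_mem hX _).2, Finset.sum_const, Finset.card_univ, Fintype.card_fin,
      nsmul_eq_mul, mul_one]
    exact inv_mul_cancel₀ (by positivity)
  dec y := ((dec y).1.1, (dec y).2)

/-- Expectations under the joint law of `codebookCode` only see the channels
`p(t|v) = ∑ x, p(x|v) p(t|x)` from the codeword letters to the output `g (y, z)`. -/
theorem sum_jointLaw_codebookCode {n Mp Ms D : ℕ} (hD : 0 < D) {pX : V → X → ℝ}
    (hX : ∀ v, pX v ∈ stdSimplex ℝ X) (v : (Fin Mp × Fin D) × Fin Ms → Fin n → V)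
    (dec : (Fin n → Y) → (Fin Mp × Fin D) × Fin Ms) (W : Channel X Y Z) {T : Type*} [Fintype T]
    (g : Y × Z → T) {κ : X → T → ℝ} (hκ : ∀ x b, (∑ s, if g s = b then W.trans x s else 0) = κ x b)
    (f : Fin Mp × Fin Ms → (Fin n → T) → ℝ) :
    ∑ ω, (codebookCode hD hX v dec).jointLaw W ω * f ω.1 (fun i => g (ω.2.2.1 i, ω.2.2.2 i))
      = ((Mp : ℝ) * Ms)⁻¹ * ∑ w, (D : ℝ)⁻¹ * ∑ d, ∑ y,
          kernelPow n (fun v => push (pX v) κ) (v ((w.1, d), w.2)) y * f w y := by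
  rw [sum_jointLaw_mul]
  congr 1
  refine Finset.sum_congr rfl fun w _ => ?_
  have h : ∀ x : Fin n → X, piE (fun i => W.trans (x i))
        (fun t => f w fun i => g ((t i).1, (t i).2))
      = ∑ y, (∏ i, κ (x i) (y i)) * f w y := fun x => by
    rw [piE_map (fun i => W.trans (x i)) g (f w)]
    simp only [hκ]
  have e : ∀ d y, kernelPow n (fun v => push (pX v) κ) (v ((w.1, d), w.2)) y
      = ∑ x, kernelPow n pX (v ((w.1, d), w.2)) x * ∏ i, κ (x i) (y i) := fun d y =>
    (push_kernelPow (fun i => pX (v ((w.1, d), w.2) i)) κ y).symm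
  simp only [h, codebookCode, e, Finset.mul_sum, Finset.sum_mul]
  rw [Finset.sum_comm]
  conv_rhs => rw [Finset.sum_comm]
  refine Finset.sum_congr rfl fun y _ => ?_
  rw [Finset.sum_comm]
  exact Finset.sum_congr rfl fun d _ => Finset.sum_congr rfl fun x _ => by ring

theorem prob_nonneg {Ω : Type*} [Fintype Ω] {p : Ω → ℝ} (hp : ∀ ω, 0 ≤ p ω) (E : Ω → Prop) :
    0 ≤ prob p E :=
  Finset.sum_nonneg fun ω _ => by split_ifs <;> simp [hp]

theorem errorProb_codebookCode_le {n Mp Ms D : ℕ} (hD : 0 < D) {pX : V → X → ℝ}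
    (hX : ∀ v, pX v ∈ stdSimplex ℝ X) (v : (Fin Mp × Fin D) × Fin Ms → Fin n → V)
    (dec : (Fin n → Y) → (Fin Mp × Fin D) × Fin Ms) (W : Channel X Y Z) :
    (codebookCode hD hX v dec).errorProb W
      ≤ codebookError (kernelPow n fun v => push (pX v) W.toY) v dec := by
  have hK0 : ∀ v y, 0 ≤ kernelPow n (fun v => push (pX v) W.toY) v y := fun v =>
    (kernelPow_mem (fun v => push_mem (hX v) W.toY_mem) v).1
  have hdec : ∀ y, (codebookCode hD hX v dec).dec y = ((dec y).1.1, (dec y).2) := fun _ => rfl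
  have h3 := sum_jointLaw_codebookCode hD hX v dec W Prod.fst W.sum_fst
    fun w y => if ((dec y).1.1, (dec y).2) = w then 0 else 1
  have h1 : (codebookCode hD hX v dec).errorProb W = ∑ ω, (codebookCode hD hX v dec).jointLaw W ω
      * (if ((dec ω.2.2.1).1.1, (dec ω.2.2.1).2) = ω.1 then 0 else 1) := by
    rw [Code.errorProb, prob]
    refine Finset.sum_congr rfl fun ω _ => ?_
    rw [hdec]
    by_cases h : ((dec ω.2.2.1).1.1, (dec ω.2.2.1).2) = ω.1
    · rw [if_neg (not_not.2 h), if_pos h, mul_zero]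
    · rw [if_pos h, if_neg h, mul_one]
  rw [← h1] at h3
  generalize kernelPow n (fun v => push (pX v) W.toY) = K at h3 hK0 ⊢
  have h4 : ∀ (w : Fin Mp × Fin Ms) d y, (if ((dec y).1.1, (dec y).2) = w then (0 : ℝ) else 1)
      ≤ if dec y = ((w.1, d), w.2) then 0 else 1 := by
    intro w d y
    by_cases b : dec y = ((w.1, d), w.2)
    · simp [b]
    · rw [if_neg b]
      split_ifs <;> norm_num
  rw [h3, codebookError, Fintype.card_prod, Fintype.card_prod, Fintype.card_fin, Fintype.card_fin,
    Fintype.card_fin, ← Finset.mul_sum, ← mul_assoc, ← mul_inv]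
  have h5 : (Mp : ℝ) * Ms * D = ((Mp * D * Ms : ℕ) : ℝ) := by push_cast; ring
  rw [h5]
  refine mul_le_mul_of_nonneg_left ?_ (by positivity)
  rw [Fintype.sum_prod_type, Fintype.sum_prod_type, Fintype.sum_prod_type]
  refine Finset.sum_le_sum fun wp _ => ?_
  rw [Finset.sum_comm]
  refine Finset.sum_le_sum fun d _ => Finset.sum_le_sum fun ws _ => Finset.sum_le_sum fun y _ => ?_
  refine mul_le_mul_of_nonneg_left ?_ (hK0 _ _)
  refine (h4 (wp, ws) d y).trans_eq ?_
  congr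

theorem leakage_codebookCode {n Mp Ms D : ℕ} (hD : 0 < D) (hMp : 0 < Mp)
    {pX : V → X → ℝ} (hX : ∀ v, pX v ∈ stdSimplex ℝ X)
    (v : (Fin Mp × Fin D) × Fin Ms → Fin n → V)
    (dec : (Fin n → Y) → (Fin Mp × Fin D) × Fin Ms) (W : Channel X Y Z) :
    (codebookCode hD hX v dec).leakage W
      = codebookLeakage (kernelPow n fun v => push (pX v) W.toZ) v / Real.log 2 := by
  have hKm : ∀ v, kernelPow n (fun v => push (pX v) W.toZ) v ∈ stdSimplex ℝ (Fin n → Z) :=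
    kernelPow_mem (fun v => push_mem (hX v) W.toZ_mem)
  have : Nonempty (Fin Mp × Fin D) := ⟨(⟨0, hMp⟩, ⟨0, hD⟩)⟩
  have hsum := sum_jointLaw_codebookCode hD hX v dec W Prod.snd W.sum_snd
  generalize codebookCode hD hX v dec = c at hsum ⊢
  generalize kernelPow n (fun v => push (pX v) W.toZ) = K at hsum hKm ⊢
  have hlaw : ∀ s z, law (c.jointLaw W) (fun ω => (ω.1.2, ω.2.2.2)) (s, z)
      = (Ms : ℝ)⁻¹ * outLaw K v s z := by
    intro s z
    have h1 : law (c.jointLaw W) (fun ω => (ω.1.2, ω.2.2.2)) (s, z) = ∑ ω, c.jointLaw W ω *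
        if ω.1.2 = s then if ω.2.2.2 = z then 1 else 0 else 0 := by
      rw [law_eq]
      refine Finset.sum_congr rfl fun ω _ => ?_
      by_cases h : ω.1.2 = s <;> by_cases h' : ω.2.2.2 = z <;> simp [h, h']
    have h2 := hsum fun w z' => if w.2 = s then if z' = z then 1 else 0 else 0
    rw [← h1] at h2
    rw [h2]
    have h3 : ∀ w : Fin Mp × Fin Ms, (D : ℝ)⁻¹ * ∑ d, ∑ z', K (v ((w.1, d), w.2)) z' *
          (if w.2 = s then if z' = z then 1 else 0 else 0)
        = if w.2 = s then (D : ℝ)⁻¹ * ∑ d, K (v ((w.1, d), s)) z else 0 := by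
      intro w
      by_cases h : w.2 = s
      · simp [h]
      · simp [h]
    have h4 : ∑ w : Fin Mp × Fin Ms, (if w.2 = s then (D : ℝ)⁻¹ * ∑ d, K (v ((w.1, d), s)) z else 0)
        = ∑ wp, (D : ℝ)⁻¹ * ∑ d, K (v ((wp, d), s)) z := by
      rw [Fintype.sum_prod_type]
      exact Finset.sum_congr rfl fun wp _ => by simp
    rw [Finset.sum_congr rfl fun w _ => h3 w, h4, outLaw, Fintype.card_prod, Fintype.card_fin,
      Fintype.card_fin, Fintype.sum_prod_type, ← Finset.mul_sum]
    push_cast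
    rw [mul_inv, mul_inv]
    ring
  have hS : ∀ s, law (c.jointLaw W) (fun ω => ω.1.2) s = (Ms : ℝ)⁻¹ := fun s =>
    law_confidential c W hMp s
  have hZ : ∀ z : Fin n → Z, law (c.jointLaw W) (fun ω => ω.2.2.2) z
      = (Ms : ℝ)⁻¹ * ∑ s, outLaw K v s z := by
    intro z
    rw [← sum_law_prod _ _ (fun ω : (Fin Mp × Fin Ms) × _ => ω.1.2), Finset.mul_sum]
    refine Finset.sum_congr rfl fun s _ => ?_
    rw [← hlaw]
    exact law_congr _ fun ω => by simp only [Prod.mk.injEq]; tauto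
  have e1 : ent (c.jointLaw W) (fun ω => ω.1.2) = shannon (fun _ : Fin Ms => (Ms : ℝ)⁻¹) := by
    rw [ent_eq_sum_negMulLog, shannon]; simp only [hS]
  have e2 : ent (c.jointLaw W) (fun ω => ω.2.2.2)
      = shannon (fun z : Fin n → Z => (Ms : ℝ)⁻¹ * ∑ s, outLaw K v s z) := by
    rw [ent_eq_sum_negMulLog, shannon]; simp only [hZ]
  have e3 : ent (c.jointLaw W) (fun ω => (ω.1.2, ω.2.2.2))
      = ∑ s, (Ms : ℝ)⁻¹ * shannon (outLaw K v s) + shannon (fun _ : Fin Ms => (Ms : ℝ)⁻¹) := by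
    rw [← sum_negMulLog_mul (fun _ : Fin Ms => (Ms : ℝ)⁻¹) (fun s => (outLaw_mem hKm v s).2),
      ent_eq_sum_negMulLog, Fintype.sum_prod_type]
    simp only [hlaw]
  simp only [Code.leakage, mutualInfo, entropy_eq_ent_div, e1, e2, e3, codebookLeakage,
    Fintype.card_fin, ← Finset.mul_sum]
  ring

theorem codebookLeakage_nonneg {V Z A S : Type*} [Fintype Z] [Fintype A] [Fintype S]
    [Nonempty A] [Nonempty S] {K : V → Z → ℝ} (hK : ∀ v, K v ∈ stdSimplex ℝ Z) (v : A × S → V) :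
    0 ≤ codebookLeakage K v := by
  have hS : (0 : ℝ) < Fintype.card S := by exact_mod_cast Fintype.card_pos
  have hu : (fun _ : S => (Fintype.card S : ℝ)⁻¹) ∈ stdSimplex ℝ S := by
    refine ⟨fun _ => by positivity, ?_⟩
    rw [Finset.sum_const, Finset.card_univ, nsmul_eq_mul, mul_inv_cancel₀ hS.ne']
  have h := sum_mul_shannon_le_shannon_push hu (outLaw_mem hK v)
  rw [← Finset.mul_sum] at h
  have e : push (fun _ : S => (Fintype.card S : ℝ)⁻¹) (outLaw K v)
      = fun z => (Fintype.card S : ℝ)⁻¹ * ∑ w, outLaw K v w z := by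
    funext z
    rw [push, Finset.mul_sum]
  rw [e] at h
  exact sub_nonneg.2 h

theorem codebookError_nonneg {V Y J : Type*} [Fintype Y] [Fintype J] {K : V → Y → ℝ}
    (hK : ∀ v, K v ∈ stdSimplex ℝ Y) (v : J → V) (dec : Y → J) : 0 ≤ codebookError K v dec :=
  mul_nonneg (by positivity) (Finset.sum_nonneg fun j _ => Finset.sum_nonneg fun y _ =>
    mul_nonneg ((hK _).1 y) (by split_ifs <;> norm_num))

/-- A single confidential message cannot leak. -/
theorem leakage_eq_zero {n Mp Ms : ℕ} (c : Code X Y n Mp Ms) (W : Channel X Y Z) (hMp : 0 < Mp)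
    (hMs : Ms = 1) : c.leakage W = 0 := by
  subst hMs
  have hp := jointLaw_mem c W hMp one_pos
  have e1 : ent (c.jointLaw W) (fun ω => ω.1.2) = 0 := by
    rw [← ent_const hp.2 ()]
    exact ent_congr _ fun ω ω' => by simp [Subsingleton.elim ω.1.2 ω'.1.2]
  have e2 : ent (c.jointLaw W) (fun ω => (ω.1.2, ω.2.2.2))
      = ent (c.jointLaw W) (fun ω => ω.2.2.2) :=
    ent_congr _ fun ω ω' => by simp [Subsingleton.elim ω.1.2 ω'.1.2]
  simp only [Code.leakage, mutualInfo, entropy_eq_ent_div, e1, e2]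
  ring

end Codes

/-! ### Achievability -/

section Achievability

variable {U V X Y Z : Type*} [Fintype U] [Fintype V] [Fintype X] [Fintype Y] [Fintype Z]

theorem two_rpow_eq_exp (n : ℕ) (R : ℝ) :
    (2 : ℝ) ^ ((n : ℝ) * R) = Real.exp (n * (Real.log 2 * R)) := by
  rw [Real.rpow_def_of_pos (by norm_num)]
  ring_nf

theorem exp_le_ceil (n : ℕ) (R : ℝ) :
    Real.exp (n * (Real.log 2 * R)) ≤ ⌈(2 : ℝ) ^ ((n : ℝ) * R)⌉₊ := by
  rw [← two_rpow_eq_exp]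
  exact Nat.le_ceil _

theorem ceil_pos (n : ℕ) (R : ℝ) : 0 < ⌈(2 : ℝ) ^ ((n : ℝ) * R)⌉₊ :=
  Nat.ceil_pos.2 (by positivity)

theorem ceil_le_exp (n : ℕ) {R : ℝ} (hR : 0 ≤ R) :
    (⌈(2 : ℝ) ^ ((n : ℝ) * R)⌉₊ : ℝ) ≤ 2 * Real.exp (n * (Real.log 2 * R)) := by
  rw [← two_rpow_eq_exp]
  have h1 : (1 : ℝ) ≤ (2 : ℝ) ^ ((n : ℝ) * R) := Real.one_le_rpow (by norm_num) (by positivity)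
  have := Nat.ceil_lt_add_one (show 0 ≤ (2 : ℝ) ^ ((n : ℝ) * R) by positivity)
  linarith

variable (W : Channel X Y Z) {pU : U → ℝ} {pV : U → V → ℝ} {pX : V → X → ℝ}

theorem achievable_of_lt (hU : pU ∈ stdSimplex ℝ U) (hV : ∀ u, pV u ∈ stdSimplex ℝ V)
    (hX : ∀ v, pX v ∈ stdSimplex ℝ X) {Rp Rs : ℝ} (hRp : 0 ≤ Rp) (hRs : 0 ≤ Rs)
    (h1 : Real.log 2 * Rs < condInfo pU pV (fun v => push (pX v) W.toY)
      - condInfo pU pV (fun v => push (pX v) W.toZ))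
    (h2 : Real.log 2 * (Rs + Rp) < totalInfo pU pV (fun v => push (pX v) W.toY)) :
    Achievable W Rp Rs := by
  have hKY : ∀ v, push (pX v) W.toY ∈ stdSimplex ℝ Y := fun v => push_mem (hX v) W.toY_mem
  have hKZ : ∀ v, push (pX v) W.toZ ∈ stdSimplex ℝ Z := fun v => push_mem (hX v) W.toZ_mem
  rw [mul_add] at h2
  obtain ⟨ε, hε, hcodes⟩ := exists_codebooks hU hV hKY hKZ h1 h2 (fun n => exp_le_ceil n Rp)
    (fun n => ceil_le_exp n hRp) (fun n => ceil_pos n Rs) (fun n => ceil_le_exp n hRs)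
  choose D hD v dec hvd using hcodes
  have hleak0 : ∀ n, 0 ≤ codebookLeakage (kernelPow n fun v => push (pX v) W.toZ) (v n) :=
    fun n => by
      have : Nonempty (Fin ⌈(2 : ℝ) ^ ((n : ℝ) * Rp)⌉₊ × Fin (D n)) :=
        ⟨(⟨0, ceil_pos n Rp⟩, ⟨0, hD n⟩)⟩
      have : Nonempty (Fin ⌈(2 : ℝ) ^ ((n : ℝ) * Rs)⌉₊) := ⟨⟨0, ceil_pos n Rs⟩⟩
      exact codebookLeakage_nonneg (kernelPow_mem hKZ) (v n)
  have hl2 : 0 < Real.log 2 := Real.log_pos (by norm_num)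
  refine ⟨hRp, hRs, fun n => codebookCode (hD n) hX (v n) (dec n), ?_, ?_⟩
  · refine squeeze_zero (fun n => prob_nonneg
      (jointLaw_mem _ W (ceil_pos n Rp) (ceil_pos n Rs)).1 _) (fun n => ?_) hε
    have := errorProb_codebookCode_le (hD n) hX (v n) (dec n) W
    linarith [hvd n, hleak0 n]
  · have hε2 : Tendsto (fun n => ε n / Real.log 2) atTop (𝓝 0) := by
      simpa using hε.div_const (Real.log 2)
    refine squeeze_zero (fun n => ?_) (fun n => ?_) hε2
    · rw [leakage_codebookCode (hD n) (ceil_pos n Rp) hX]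
      exact div_nonneg (div_nonneg (hleak0 n) hl2.le) (Nat.cast_nonneg n)
    · rw [leakage_codebookCode (hD n) (ceil_pos n Rp) hX]
      have h3 : codebookLeakage (kernelPow n fun v => push (pX v) W.toZ) (v n) / Real.log 2
          ≤ ε n / Real.log 2 := by
        refine div_le_div_of_nonneg_right ?_ hl2.le
        linarith [hvd n, codebookError_nonneg (kernelPow_mem hKY) (v n) (dec n)]
      refine le_trans ?_ h3
      rcases n.eq_zero_or_pos with rfl | hn
      · simpa using div_nonneg (hleak0 0) hl2.le
      · exact div_le_self (div_nonneg (hleak0 n) hl2.le) (by exact_mod_cast hn)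

/-- Without a confidential message secrecy is void, so that only `I(V;Y)` matters: the codebooks
are those for a constant `U` and an eavesdropper with a constant output. -/
theorem achievable_private_of_lt (hU : pU ∈ stdSimplex ℝ U) (hV : ∀ u, pV u ∈ stdSimplex ℝ V)
    (hX : ∀ v, pX v ∈ stdSimplex ℝ X) {Rp : ℝ} (hRp : 0 ≤ Rp)
    (h : Real.log 2 * Rp < totalInfo pU pV (fun v => push (pX v) W.toY)) :
    Achievable W Rp 0 := by
  have hKY : ∀ v, push (pX v) W.toY ∈ stdSimplex ℝ Y := fun v => push_mem (hX v) W.toY_mem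
  have hU' : (fun _ => 1 : Unit → ℝ) ∈ stdSimplex ℝ Unit := ⟨fun _ => zero_le_one, by simp⟩
  have hKZ : ∀ _ : V, (fun _ => 1 : Unit → ℝ) ∈ stdSimplex ℝ Unit := fun _ => hU'
  have hpush : push (fun _ : Unit => (1 : ℝ)) (fun _ : Unit => push pU pV) = push pU pV := by
    funext v; simp [push]
  have hsum : ∑ v, push pU pV v * shannon (push (pX v) W.toY)
      = ∑ u, ∑ v, pU u * pV u v * shannon (push (pX v) W.toY) := by
    simp only [push, Finset.sum_mul]
    exact Finset.sum_comm
  have e1 : condInfo (fun _ : Unit => 1) (fun _ => push pU pV) (fun v => push (pX v) W.toY)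
      = totalInfo pU pV (fun v => push (pX v) W.toY) := by
    simp only [condInfo, totalInfo, Finset.univ_unique, Finset.sum_singleton, one_mul, hsum,
      push_push]
  have e2 : totalInfo (fun _ : Unit => 1) (fun _ => push pU pV) (fun v => push (pX v) W.toY)
      = totalInfo pU pV (fun v => push (pX v) W.toY) := by
    rw [totalInfo, ← push_push, hpush]
    simp only [totalInfo, Finset.univ_unique, Finset.sum_singleton, one_mul, hsum, push_push]
  have e3 : condInfo (fun _ : Unit => 1) (fun _ => push pU pV) (fun (_ : V) (_ : Unit) => (1 : ℝ))
      = 0 := by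
    have : push (push pU pV) (fun (_ : V) (_ : Unit) => (1 : ℝ)) = fun _ => 1 := by
      funext y
      simpa [push] using (push_mem hU hV).2
    simp [condInfo, this, shannon]
  have hlt : Real.log 2 * 0 < totalInfo pU pV (fun v => push (pX v) W.toY) := by
    refine lt_of_le_of_lt ?_ h
    rw [mul_zero]
    exact mul_nonneg (Real.log_nonneg (by norm_num)) hRp
  obtain ⟨ε, hε, hcodes⟩ := exists_codebooks hU' (fun _ => push_mem hU hV) hKY hKZ
    (ρs := Real.log 2 * 0) (ρp := Real.log 2 * Rp) (by rw [e1, e3, sub_zero]; exact hlt)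
    (by rw [e2, mul_zero, zero_add]; exact h) (fun n => exp_le_ceil n Rp)
    (fun n => ceil_le_exp n hRp) (fun n => ceil_pos n 0) (fun n => ceil_le_exp n le_rfl)
  choose D hD v dec hvd using hcodes
  refine ⟨hRp, le_rfl, fun n => codebookCode (hD n) hX (v n) (dec n), ?_, ?_⟩
  · refine squeeze_zero (fun n => prob_nonneg
      (jointLaw_mem _ W (ceil_pos n Rp) (ceil_pos n 0)).1 _) (fun n => ?_) hε
    have h1 := errorProb_codebookCode_le (hD n) hX (v n) (dec n) W
    have h2 : 0 ≤ codebookLeakage (kernelPow n fun (_ : V) (_ : Unit) => (1 : ℝ)) (v n) := by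
      have : Nonempty (Fin ⌈(2 : ℝ) ^ ((n : ℝ) * Rp)⌉₊ × Fin (D n)) :=
        ⟨(⟨0, ceil_pos n Rp⟩, ⟨0, hD n⟩)⟩
      have : Nonempty (Fin ⌈(2 : ℝ) ^ ((n : ℝ) * 0)⌉₊) := ⟨⟨0, ceil_pos n 0⟩⟩
      exact codebookLeakage_nonneg (kernelPow_mem hKZ) (v n)
    linarith [hvd n]
  · have : ∀ n : ℕ, (codebookCode (hD n) hX (v n) (dec n)).leakage W / (n : ℝ) = 0 := fun n => by
      rw [leakage_eq_zero _ W (ceil_pos n Rp) (by simp), zero_div]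
    simp only [this]
    exact tendsto_const_nhds

/-- The zero pair needs no strict inequality: there is a single message. -/
theorem achievable_zero {P : X → ℝ} (hP : P ∈ stdSimplex ℝ X) : Achievable W 0 0 := by
  have hone : ∀ n : ℕ, ⌈(2 : ℝ) ^ ((n : ℝ) * 0)⌉₊ = 1 := fun n => by simp
  let c : ∀ n : ℕ, Code X Y n ⌈(2 : ℝ) ^ ((n : ℝ) * 0)⌉₊ ⌈(2 : ℝ) ^ ((n : ℝ) * 0)⌉₊ := fun n =>
    { enc := fun _ x => ∏ i, P (x i)
      enc_mem := fun _ => prod_mem_stdSimplex fun _ => hP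
      dec := fun _ => (⟨0, ceil_pos n 0⟩, ⟨0, ceil_pos n 0⟩) }
  refine ⟨le_rfl, le_rfl, c, ?_, ?_⟩
  · have : ∀ n, (c n).errorProb W = 0 := fun n => by
      have hs : Subsingleton (Fin ⌈(2 : ℝ) ^ ((n : ℝ) * 0)⌉₊) := by
        rw [hone n]; infer_instance
      exact Finset.sum_eq_zero fun ω _ => if_neg (not_not.2 (Subsingleton.elim _ _))
    simp only [this]
    exact tendsto_const_nhds
  · have : ∀ n : ℕ, (c n).leakage W / (n : ℝ) = 0 := fun n => by
      rw [leakage_eq_zero _ W (ceil_pos n 0) (hone n), zero_div]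
    simp only [this]
    exact tendsto_const_nhds

/-- Rate pairs inside the bounds are limits of achievable ones: lower both rates slightly. -/
theorem mem_capacityRegion (hU : pU ∈ stdSimplex ℝ U) (hV : ∀ u, pV u ∈ stdSimplex ℝ V)
    (hX : ∀ v, pX v ∈ stdSimplex ℝ X) {R : ℝ × ℝ} (hRp : 0 ≤ R.1) (hRs : 0 ≤ R.2)
    (h1 : Real.log 2 * R.2 ≤ condInfo pU pV (fun v => push (pX v) W.toY)
      - condInfo pU pV (fun v => push (pX v) W.toZ))
    (h2 : Real.log 2 * (R.2 + R.1) ≤ totalInfo pU pV (fun v => push (pX v) W.toY)) :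
    R ∈ capacityRegion W := by
  have hl2 : 0 < Real.log 2 := Real.log_pos (by norm_num)
  let f : ℕ → ℝ × ℝ := fun k => (max (R.1 - 1 / ((k : ℝ) + 1)) 0, max (R.2 - 1 / ((k : ℝ) + 1)) 0)
  have hf : Tendsto f atTop (𝓝 R) := by
    have ht : ∀ r : ℝ, 0 ≤ r →
        Tendsto (fun k : ℕ => max (r - 1 / ((k : ℝ) + 1)) 0) atTop (𝓝 r) := by
      intro r hr
      have := ((tendsto_const_nhds (x := r)).sub
        (tendsto_one_div_add_atTop_nhds_zero_nat (𝕜 := ℝ))).max (tendsto_const_nhds (x := (0 : ℝ)))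
      simpa [hr] using this
    exact (ht R.1 hRp).prodMk_nhds (ht R.2 hRs)
  refine mem_closure_of_tendsto hf (Eventually.of_forall fun k => ?_)
  have hδ : 0 < 1 / ((k : ℝ) + 1) := by positivity
  change Achievable W (f k).1 (f k).2
  have hle : ∀ r : ℝ, 0 ≤ r → max (r - 1 / ((k : ℝ) + 1)) 0 ≤ r := fun r hr =>
    max_le (by linarith) hr
  have hlt : ∀ r : ℝ, 0 < r → max (r - 1 / ((k : ℝ) + 1)) 0 < r := fun r hr =>
    max_lt (by linarith) hr
  have hzero : max ((0 : ℝ) - 1 / ((k : ℝ) + 1)) 0 = 0 := max_eq_right (by linarith)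
  rcases hRs.eq_or_lt with h0 | hpos
  · simp only [f, ← h0, hzero]
    rcases hRp.eq_or_lt with h0' | hpos'
    · rw [← h0', hzero]
      obtain ⟨u⟩ : Nonempty U := by
        by_contra hne
        rw [not_nonempty_iff] at hne
        simpa using hU.2
      obtain ⟨v⟩ : Nonempty V := by
        by_contra hne
        rw [not_nonempty_iff] at hne
        simpa using (hV u).2
      exact achievable_zero W (hX v)
    · refine achievable_private_of_lt W hU hV hX (le_max_right _ _) (lt_of_lt_of_le ?_ h2)
      rw [← h0, zero_add]
      exact mul_lt_mul_of_pos_left (hlt _ hpos') hl2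
  · refine achievable_of_lt W hU hV hX (le_max_right _ _) (le_max_right _ _)
      (lt_of_lt_of_le ?_ h1) (lt_of_lt_of_le ?_ h2)
    · exact mul_lt_mul_of_pos_left (hlt _ hpos) hl2
    · exact mul_lt_mul_of_pos_left (add_lt_add_of_lt_of_le (hlt _ hpos) (hle _ hRp)) hl2

end Achievability

/-! ### The capacity region -/

section Capacity

variable {X Y Z : Type*} [Fintype X] [Fintype Y] [Fintype Z] (W : Channel X Y Z)

/-- The converse in the limit: the Fano and leakage terms of `converse_bound` vanish after division
by the block length, and `boundSet W` is closed. -/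
theorem mem_boundSet_of_achievable {Rp Rs : ℝ} (h : Achievable W Rp Rs) :
    (Real.log 2 * Rs, Real.log 2 * (Rs + Rp)) ∈ boundSet W := by
  obtain ⟨hRp, hRs, c, herr, hleak⟩ := h
  have hl2 : 0 < Real.log 2 := Real.log_pos (by norm_num)
  let φ : ℕ → ℝ := fun n => Real.log 2 * (1 / (n : ℝ))
    + (c n).errorProb W * (Real.log 2 * (Rs + Rp) + 2 * Real.log 2 * (1 / (n : ℝ)))
  have hφ : Tendsto φ atTop (𝓝 0) := by
    have t := tendsto_one_div_atTop_nhds_zero_nat (𝕜 := ℝ)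
    have := (t.const_mul (Real.log 2)).add
      (herr.mul ((tendsto_const_nhds (x := Real.log 2 * (Rs + Rp))).add
        (t.const_mul (2 * Real.log 2))))
    rwa [mul_zero, zero_mul, add_zero] at this
  have hlim : Tendsto (fun n : ℕ => (Real.log 2 * Rs - Real.log 2 * ((c n).leakage W / n) - φ n,
      Real.log 2 * (Rs + Rp) - φ n)) atTop
      (𝓝 (Real.log 2 * Rs, Real.log 2 * (Rs + Rp))) := by
    have t1 := ((tendsto_const_nhds (x := Real.log 2 * Rs)).sub
      (hleak.const_mul (Real.log 2))).sub hφ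
    have t2 := (tendsto_const_nhds (x := Real.log 2 * (Rs + Rp))).sub hφ
    simpa using t1.prodMk_nhds t2
  refine (isClosed_boundSet W).mem_of_tendsto hlim ?_
  filter_upwards [eventually_gt_atTop 0] with n hn
  have hn0 : (0 : ℝ) < n := by exact_mod_cast hn
  set Mp := ⌈(2 : ℝ) ^ ((n : ℝ) * Rp)⌉₊ with hMp
  set Ms := ⌈(2 : ℝ) ^ ((n : ℝ) * Rs)⌉₊ with hMs
  have hMp0 : 0 < Mp := ceil_pos n Rp
  have hMs0 : 0 < Ms := ceil_pos n Rs
  have hMp0' : (0 : ℝ) < Mp := by exact_mod_cast hMp0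
  have hMs0' : (0 : ℝ) < Ms := by exact_mod_cast hMs0
  have lower : ∀ R : ℝ, n * (Real.log 2 * R) ≤ Real.log ⌈(2 : ℝ) ^ ((n : ℝ) * R)⌉₊ := fun R => by
    rw [Real.le_log_iff_exp_le (by exact_mod_cast ceil_pos n R)]
    exact exp_le_ceil n R
  have upper : ∀ R : ℝ, 0 ≤ R →
      Real.log ⌈(2 : ℝ) ^ ((n : ℝ) * R)⌉₊ ≤ Real.log 2 + n * (Real.log 2 * R) := fun R hR => by
    have := Real.log_le_log (by exact_mod_cast ceil_pos n R) (ceil_le_exp n hR)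
    rwa [Real.log_mul (by norm_num) (Real.exp_pos _).ne', Real.log_exp] at this
  have hlog : Real.log (Mp * Ms) = Real.log Mp + Real.log Ms :=
    Real.log_mul hMp0'.ne' hMs0'.ne'
  have herr0 : 0 ≤ (c n).errorProb W := prob_nonneg (jointLaw_mem _ W hMp0 hMs0).1 _
  have hfano : (Real.log 2 + (c n).errorProb W * Real.log (Mp * Ms)) / n ≤ φ n := by
    have h1 : Real.log (Mp * Ms) / n ≤ Real.log 2 * (Rs + Rp) + 2 * Real.log 2 * (1 / (n : ℝ)) := by
      rw [div_le_iff₀ hn0, hlog]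
      have a := upper Rp hRp
      have b := upper Rs hRs
      have e : (Real.log 2 * (Rs + Rp) + 2 * Real.log 2 * (1 / (n : ℝ))) * n
          = n * (Real.log 2 * Rp) + n * (Real.log 2 * Rs) + 2 * Real.log 2 := by
        field_simp
        ring
      rw [e]
      linarith
    have h2 := mul_le_mul_of_nonneg_left h1 herr0
    rw [add_div, mul_div_assoc]
    have e : Real.log 2 / n = Real.log 2 * (1 / (n : ℝ)) := by ring
    rw [e]
    exact add_le_add le_rfl h2
  refine boundSet_lower W (converse_bound (c n) W hn hMp0 hMs0) ?_ ?_
  · change Real.log 2 * Rs - Real.log 2 * ((c n).leakage W / n) - φ n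
      ≤ (Real.log Ms - Real.log 2 * (c n).leakage W
        - (Real.log 2 + (c n).errorProb W * Real.log (Mp * Ms))) / n
    have h1 : Real.log 2 * Rs ≤ Real.log Ms / n := by
      rw [le_div_iff₀ hn0]
      linarith [lower Rs]
    rw [sub_div, sub_div, mul_div_assoc]
    linarith
  · change Real.log 2 * (Rs + Rp) - φ n ≤ (Real.log (Mp * Ms)
      - (Real.log 2 + (c n).errorProb W * Real.log (Mp * Ms))) / n
    have h1 : Real.log 2 * (Rs + Rp) ≤ Real.log (Mp * Ms) / n := by
      rw [le_div_iff₀ hn0, hlog]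
      linarith [lower Rs, lower Rp]
    rw [sub_div]
    linarith

end Capacity

end

end Wiretap

theorem lemma1 {X Y Z : Type*} [Fintype X] [Fintype Y] [Fintype Z]
    (W : Wiretap.Channel X Y Z) :
    Wiretap.capacityRegion W =
      {R : ℝ × ℝ | 0 ≤ R.1 ∧ 0 ≤ R.2 ∧
        ∃ (k l : ℕ) (pU : Fin k → ℝ) (pV : Fin k → Fin l → ℝ) (pX : Fin l → X → ℝ),
          pU ∈ stdSimplex ℝ (Fin k) ∧
          (∀ u, pV u ∈ stdSimplex ℝ (Fin l)) ∧
          (∀ v, pX v ∈ stdSimplex ℝ X) ∧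
          R.2 ≤
            Wiretap.condMutualInfo (Wiretap.auxLaw W pU pV pX)
              Wiretap.rvV Wiretap.rvY Wiretap.rvU
            - Wiretap.condMutualInfo (Wiretap.auxLaw W pU pV pX)
              Wiretap.rvV Wiretap.rvZ Wiretap.rvU ∧
          R.2 + R.1 ≤
            Wiretap.mutualInfo (Wiretap.auxLaw W pU pV pX) Wiretap.rvV Wiretap.rvY} := by
  have hl2 : 0 < Real.log 2 := Real.log_pos (by norm_num)
  refine Set.Subset.antisymm (fun R hR => ?_) ?_
  · have hclosed : IsClosed {R : ℝ × ℝ | 0 ≤ R.1 ∧ 0 ≤ R.2 ∧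
        (Real.log 2 * R.2, Real.log 2 * (R.2 + R.1)) ∈ Wiretap.boundSet W} :=
      (isClosed_le continuous_const continuous_fst).inter
        ((isClosed_le continuous_const continuous_snd).inter
          ((Wiretap.isClosed_boundSet W).preimage (by fun_prop)))
    have hsub : {R : ℝ × ℝ | Wiretap.Achievable W R.1 R.2} ⊆ {R : ℝ × ℝ | 0 ≤ R.1 ∧ 0 ≤ R.2 ∧
        (Real.log 2 * R.2, Real.log 2 * (R.2 + R.1)) ∈ Wiretap.boundSet W} := fun R hR =>
      ⟨hR.1, hR.2.1, Wiretap.mem_boundSet_of_achievable W hR⟩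
    obtain ⟨h1, h2, h3⟩ := closure_minimal hsub hclosed hR
    obtain ⟨k, l, pU, pV, pX, hU, hV, hX, h4, h5⟩ := Wiretap.exists_aux_of_mem_boundSet W h3
    simp only [mul_div_cancel_left₀ _ hl2.ne'] at h4 h5
    exact ⟨h1, h2, k, l, pU, pV, pX, hU, hV, hX, h4, h5⟩
  · rintro R ⟨hRp, hRs, k, l, pU, pV, pX, hU, hV, hX, h1, h2⟩
    have hKY : ∀ v, Wiretap.push (pX v) W.toY ∈ stdSimplex ℝ Y := fun v =>
      Wiretap.push_mem (hX v) W.toY_mem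
    have hKZ : ∀ v, Wiretap.push (pX v) W.toZ ∈ stdSimplex ℝ Z := fun v =>
      Wiretap.push_mem (hX v) W.toZ_mem
    rw [Wiretap.condMutualInfo_of_law hV hKY (Wiretap.law_auxLaw_Y W),
      Wiretap.condMutualInfo_of_law hV hKZ (Wiretap.law_auxLaw_Z W), ← sub_div,
      le_div_iff₀ hl2, mul_comm] at h1
    rw [Wiretap.mutualInfo_of_law hKY (Wiretap.law_auxLaw_Y W), le_div_iff₀ hl2, mul_comm] at h2
    exact Wiretap.mem_capacityRegion W hU hV hX hRp hRs h1 h2
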